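/- Let $n\ge 2$. Let $A:\mathbb R^n\to\mathbb R^n$ and $V:\mathbb R^n\to\mathbb R$ be of class $C^1$ on $\mathbb R^n\setminus\{0\}$, with $|A|^2\in L^1_{loc}(\mathbb R^n)$, and put $\nabla_A=\nabla-iA$ (in the weak sense). Let $H_A=-\nabla_A^2$ be the self-adjoint operator on $L^2(\mathbb R^n)$ with form domain $\{f\in L^2:\nabla_A f\in L^2\}$ and quadratic form $\int|\nabla_A f|^2$, and assume that for some $\epsilon\in(0,1)$ and $C\in\mathbb R$ $$\|Vf\|_{L^2}\le(1-\epsilon)\|H_Af\|_{L^2}+C\|f\|_{L^2}\qquad\text{for all } f\in L^2 \text{ with } H_Af\in L^2 .$$ Let $H=H_A+V$, and let $u:\mathbb R\to L^2(\mathbb R^n)$ be a solution of $$iu_t=Hu=(-\nabla_A^2+V)u,\qquad u(0)=f,\qquad f\in L^2,\ H_Af\in L^2,$$ that is, $u$ is differentiable as a curve in $L^2$ and $u(t)$ lies in the domain of $H$ for every $t\in\mathbb R$. Let $\phi\in C^4(\mathbb R^n;\mathbb R)$ be radial, $\phi=\phi(|x|)$, with bounded Hessian $(D^2\phi)_{jk}=\partial^2\phi/\partial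 x^j\partial x^k$, and suppose $\int_{\mathbb R^n}(|\phi|+|\phi'|^2)|f|^2\,dx<\infty$. Let $$B=DA-DA^t,\quad B_{ij}=\frac{\partial A^i}{\partial x^j}-\frac{\partial A^j}{\partial x^i},\qquad B_\tau=\frac{x}{|x|}B,\qquad V_r=\frac{x}{|x|}\cdot\nabla V,$$ and suppose that the integrals $\int|u|^2\Delta^2\phi\,dx$, $\int\phi'V_r|u|^2\,dx$ and $\int u\,\phi'B_\tau\cdot\overline{\nabla_Au}\,dx$ converge absolutely, locally uniformly in $t$: for all $T,\delta>0$ there is a compact set $K\subset\mathbb R^n\setminus\{0\}$ such that for $|t|\le T$ the integrals of the absolute values of the integrands over $\mathbb R^n\setminus K$ are at most $\delta$. Then the integral $$\Theta_S(t)=\int_{\mathbb R^n}\phi\,|u(t,x)|^2\,dx$$ and the integral $\int\nabla_Au\,D^2\phi\,\overline{\nabla_Au}\,dx$ converge absolutely for every $t\in\mathbb R$, $\Theta_S$ is twice differentiable on $\mathbb R$, and for all $t\in\mathbb R$ $$\ddot\Theta_S(t)=4\int_{\mathbb R^n}\nabla_Au\,D^2\phi\,\overline{\nabla_Au}\,dx-\int_{\mathbb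 R^n}|u|^2\Delta^2\phi\,dx-2\int_{\mathbb R^n}\phi'V_r|u|^2\,dx+4\,\mathrm{Im}\int_{\mathbb R^n}u\,\phi'B_\tau\cdot\overline{\nabla_Au}\,dx .$$ -/

import Mathlib

open MeasureTheory Matrix
open scoped ContDiff ComplexConjugate InnerProductSpace

noncomputable section

/-- Euclidean space `ℝⁿ`. -/
abbrev Rn (n : ℕ) : Type := EuclideanSpace ℝ (Fin n)

/-- The complex Hilbert space `L²(ℝⁿ)`. -/
abbrev L2 (n : ℕ) : Type := Lp ℂ 2 (volume : Measure (Rn n))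

/-- The (classical) partial derivative `∂f / ∂xʲ`. -/
def pderiv {n : ℕ} {F : Type*} [NormedAddCommGroup F] [NormedSpace ℝ F]
    (j : Fin n) (f : Rn n → F) (x : Rn n) : F :=
  fderiv ℝ f x (EuclideanSpace.single j 1)

/-- The Hessian matrix `(D²φ)_{jk} = ∂²φ / ∂xʲ∂xᵏ`. -/
def hessian {n : ℕ} (φ : Rn n → ℝ) (x : Rn n) : Matrix (Fin n) (Fin n) ℝ :=
  Matrix.of fun j k => pderiv j (pderiv k φ) x

/-- The bi-Laplacian `Δ²φ = Δ(Δφ)`. -/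
def biLaplacian {n : ℕ} (φ : Rn n → ℝ) : Rn n → ℝ :=
  Laplacian.laplacian (Laplacian.laplacian φ)

/-- The radial derivative `V_r = (x / |x|) · ∇V`. -/
def radialDeriv {n : ℕ} (V : Rn n → ℝ) (x : Rn n) : ℝ :=
  fderiv ℝ V x (‖x‖⁻¹ • x)

/-- The magnetic field `B = DA - DAᵗ`, that is `B_{ij} = ∂Aⁱ/∂xʲ - ∂Aʲ/∂xⁱ`. -/
def magneticField {n : ℕ} (A : Rn n → Rn n) (x : Rn n) : Matrix (Fin n) (Fin n) ℝ :=
  Matrix.of fun i j => pderiv j (fun y => A y i) x - pderiv i (fun y => A y j) x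

/-- The vector field `B_τ = (x / |x|) B` (a row vector times a matrix). -/
def tangentialField {n : ℕ} (A : Rn n → Rn n) (x : Rn n) : Fin n → ℝ :=
  (fun i => x i / ‖x‖) ᵥ* magneticField A x

/-- `u ∈ L²` has the weak magnetic gradient `∇_A u = ∇u - iAu = G ∈ L²`. The functions `u`
having such a `G` make up the form domain of `H_A`. -/
def HasMagneticGradient {n : ℕ} (A : Rn n → Rn n) (u : L2 n) (G : Fin n → L2 n) : Prop :=
  ∀ j : Fin n, ∀ ψ : Rn n → ℂ, ContDiff ℝ ∞ ψ → HasCompactSupport ψ →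
    ∫ x, G j x * ψ x = -∫ x, u x * (pderiv j ψ x + Complex.I * (A x j : ℂ) * ψ x)

/-- `f` lies in the domain of `H_A = -∇_A²` and `H_A f = g`. Here `H_A` is the self-adjoint
operator with form domain `{f ∈ L² : ∇_A f ∈ L²}` and quadratic form `∫ |∇_A f|²`:
`∫ ∇_A f · conj (∇_A ψ) = ∫ g · conj ψ` for every `ψ` in the form domain. -/
def IsMagneticLaplacian {n : ℕ} (A : Rn n → Rn n) (f g : L2 n) : Prop :=
  ∃ G : Fin n → L2 n, HasMagneticGradient A f G ∧
    ∀ (ψ : L2 n) (Ψ : Fin n → L2 n), HasMagneticGradient A ψ Ψ →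
      ∑ j, ⟪Ψ j, G j⟫_ℂ = ⟪ψ, g⟫_ℂ

/-- `v ∈ L²` is the product `V f`. -/
def IsPotentialMul {n : ℕ} (V : Rn n → ℝ) (f v : L2 n) : Prop :=
  v =ᵐ[volume] fun x => (V x : ℂ) * f x

/-- `f` lies in the domain of `H = -∇_A² + V` and `H f = h`. -/
def IsHamiltonian {n : ℕ} (A : Rn n → Rn n) (V : Rn n → ℝ) (f h : L2 n) : Prop :=
  ∃ g v : L2 n, IsMagneticLaplacian A f g ∧ IsPotentialMul V f v ∧ h = g + v

/-- `V` is a Kato-Rellich perturbation of `H_A`: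
`‖V f‖ ≤ (1 - ε) ‖H_A f‖ + C ‖f‖` on the domain of `H_A`, for some `ε > 0`. -/
def IsKatoRellich {n : ℕ} (A : Rn n → Rn n) (V : Rn n → ℝ) : Prop :=
  ∃ ε : ℝ, 0 < ε ∧ ε < 1 ∧ ∃ C : ℝ, ∀ f g : L2 n, IsMagneticLaplacian A f g →
    ∃ v : L2 n, IsPotentialMul V f v ∧ ‖v‖ ≤ (1 - ε) * ‖g‖ + C * ‖f‖

/-- `u` solves `i u_t = H u`, `u(0) = f`: at every time `u(t)` is in the domain of `H` and
`u` is differentiable as a curve in `L²`. -/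
structure IsSchrodingerSolution {n : ℕ} (A : Rn n → Rn n) (V : Rn n → ℝ)
    (f : L2 n) (u : ℝ → L2 n) : Prop where
  initial : u 0 = f
  equation : ∀ t : ℝ, ∃ u' h : L2 n, HasDerivAt u u' t ∧ IsHamiltonian A V (u t) h ∧
    Complex.I • u' = h

/-- The integrals `∫ F(t, x) dx` converge absolutely, and locally uniformly in `t`
(at infinity and at the origin). -/
def ConvergesLocallyUniformly {n : ℕ} (F : ℝ → Rn n → ℂ) : Prop :=
  (∀ t, Integrable (F t)) ∧
    ∀ T δ : ℝ, 0 < δ → ∃ K : Set (Rn n), IsCompact K ∧ (0 : Rn n) ∉ K ∧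
      ∀ t : ℝ, |t| ≤ T → ∫ x in Kᶜ, ‖F t x‖ ≤ δ

/-- `Θ_S(t) = ∫ φ |u(t)|² dx`. -/
def thetaS {n : ℕ} (φ : Rn n → ℝ) (u : ℝ → L2 n) (t : ℝ) : ℝ :=
  ∫ x, φ x * ‖u t x‖ ^ 2

/-- The integrand `∇_A u D²φ conj (∇_A u)`, for `G = ∇_A u`. -/
def hessianTerm {n : ℕ} (φ : Rn n → ℝ) (G : Fin n → L2 n) (x : Rn n) : ℂ :=
  ∑ j, ∑ k, G j x * ((hessian φ x j k : ℝ) : ℂ) * conj (G k x)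

/-- The integrand `|u|² Δ²φ`. -/
def biLaplacianTerm {n : ℕ} (φ : Rn n → ℝ) (u : L2 n) (x : Rn n) : ℂ :=
  ((‖u x‖ ^ 2 * biLaplacian φ x : ℝ) : ℂ)

/-- The integrand `φ' V_r |u|²`, for the multiplier `φ = φ₀(|x|)`. -/
def electricTerm {n : ℕ} (φ₀ : ℝ → ℝ) (V : Rn n → ℝ) (u : L2 n) (x : Rn n) : ℂ :=
  ((deriv φ₀ ‖x‖ * radialDeriv V x * ‖u x‖ ^ 2 : ℝ) : ℂ)

/-- The integrand `u φ' B_τ · conj (∇_A u)`, for `φ = φ₀(|x|)` and `G = ∇_A u`. -/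
def magneticTerm {n : ℕ} (φ₀ : ℝ → ℝ) (A : Rn n → Rn n) (u : L2 n) (G : Fin n → L2 n)
    (x : Rn n) : ℂ :=
  u x * ((deriv φ₀ ‖x‖ : ℝ) : ℂ) * ∑ k, ((tangentialField A x k : ℝ) : ℂ) * conj (G k x)

end

/-! ### Calculus of coordinate partial derivatives. -/

section PartialDerivatives

variable {n : ℕ}

/-! Write `Dⱼ` for the components of `∇_A`. Formally the first derivative of `∫ φ|u|²` is the action
`2 Im ∫ ū ∇φ·∇_A u`. A second derivative amounts to commuting `H` with the formally
anti-self-adjoint operator `2∇φ·∇_A + Δφ`. Moving `Dⱼ` past `∇φ` gives the Hessian term, the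
relation `[Dⱼ, Dₖ] = -i Bₖⱼ` gives the magnetic term, the commutator with `V` gives `∇φ·∇V`, and the
remaining `∇Δφ` term integrates by parts to `Δ²φ`. The work lies in justifying this for unbounded
`∇φ`, for `A` and `V` singular at the origin, and for a solution that is only a differentiable curve
in `L²` with values in the domain of `H`.

Control in time. Symmetry of `H` makes `‖u(t)‖` constant, and also `‖u(t+a) - u(t)‖`, hence
`‖Hu(t)‖`. The Kato-Rellich bound turns this into a uniform bound on `‖H_A u(t)‖`, and testing the
form with `u` bounds `∇_A u(t)`. Testing it with `u(t) - u(s)` shows that `∇_A u` is continuous in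
time (`IsFlow.continuous_grad`). Since `∇_A u` need not be differentiable in time, the action is
differentiated through antisymmetry, which transfers every difference onto `u`
(`hasDerivAt_inner_of_antisymm`).

The origin. On compact sets avoiding `0`, mollification approximates `u`, `∇u` and `Δu` in `L²`, so
the classical virial identity `virial_smooth_component` passes to the limit. A cut-off `1 - χ(kx)`
then reaches the origin: its derivative has size `1/|x|`, which is harmless for multipliers
vanishing at `0` (`exists_bound_pderiv_cutOrigin`). A radial `φ` is even, so `∇φ` and `∇Δφ` do
vanish there.

Infinity. For the first derivative `φ` is divided by `1 + δ(1 + φ² + |∇φ|²)`, which keeps the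
gradient bounded by a multiple of `|∇φ|` uniformly in `δ`. The moment `∫ |∇φ|²|u|²` stays finite
because its square root grows at most linearly (`IsFlow.sqrt_moment_le`). For the second derivative
the field `∇φ` is cut off at radius of order `1/s`. The bounded Hessian gives `|∇φ| ≲ |x|`, so the
derivatives of the cut field are bounded uniformly in `s`, and the errors created in the `Δ²φ` term
are `O(s)` (`IsMultiplier.exists_cutDiv_error_le`). The assumed uniform tails handle the other
integrals. In both cases the derivatives converge uniformly on bounded time intervals, which
legitimates differentiating the limit. -/

theorem ContDiff.continuous_pderiv {F : Type*} [NormedAddCommGroup F] [NormedSpace ℝ F]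
    {f : Rn n → F} (hf : ContDiff ℝ 1 f) (j : Fin n) : Continuous (pderiv j f) :=
  (hf.continuous_fderiv one_ne_zero).clm_apply continuous_const

theorem ContDiff.contDiff_pderiv {F : Type*} [NormedAddCommGroup F] [NormedSpace ℝ F]
    {f : Rn n → F} {m k : ℕ∞ω} (hf : ContDiff ℝ k f) (hm : m + 1 ≤ k) (j : Fin n) :
    ContDiff ℝ m (pderiv j f) :=
  (hf.fderiv_right hm).clm_apply contDiff_const

theorem ContDiffAt.contDiffAt_pderiv {F : Type*} [NormedAddCommGroup F] [NormedSpace ℝ F]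
    {f : Rn n → F} {m k : ℕ∞ω} {x : Rn n} (hf : ContDiffAt ℝ k f x) (hm : m + 1 ≤ k) (j : Fin n) :
    ContDiffAt ℝ m (pderiv j f) x :=
  (hf.fderiv_right hm).clm_apply contDiffAt_const

theorem pderiv_of_notMem_tsupport {F : Type*} [NormedAddCommGroup F] [NormedSpace ℝ F]
    {f : Rn n → F} {x : Rn n} (hx : x ∉ tsupport f) (j : Fin n) : pderiv j f x = 0 := by
  have : fderiv ℝ f x = 0 := by
    by_contra h
    exact hx (support_fderiv_subset ℝ h)
  simp [pderiv, this]

theorem tsupport_pderiv_subset {F : Type*} [NormedAddCommGroup F] [NormedSpace ℝ F]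
    (f : Rn n → F) (j : Fin n) : tsupport (pderiv j f) ⊆ tsupport f :=
  closure_minimal (fun _ hx => by_contra fun h => hx (pderiv_of_notMem_tsupport h j))
    (isClosed_tsupport f)

theorem HasCompactSupport.pderiv {F : Type*} [NormedAddCommGroup F] [NormedSpace ℝ F]
    {f : Rn n → F} (hf : HasCompactSupport f) (j : Fin n) : HasCompactSupport (pderiv j f) :=
  hf.of_isClosed_subset (isClosed_tsupport _) (tsupport_pderiv_subset f j)

theorem pderiv_add {F : Type*} [NormedAddCommGroup F] [NormedSpace ℝ F] {f g : Rn n → F}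
    {x : Rn n} (hf : DifferentiableAt ℝ f x) (hg : DifferentiableAt ℝ g x) (j : Fin n) :
    pderiv j (fun y => f y + g y) x = pderiv j f x + pderiv j g x := by
  simp [pderiv, fderiv_fun_add hf hg]

theorem pderiv_sub {F : Type*} [NormedAddCommGroup F] [NormedSpace ℝ F] {f g : Rn n → F}
    {x : Rn n} (hf : DifferentiableAt ℝ f x) (hg : DifferentiableAt ℝ g x) (j : Fin n) :
    pderiv j (fun y => f y - g y) x = pderiv j f x - pderiv j g x := by
  simp [pderiv, fderiv_fun_sub hf hg]

theorem pderiv_sum {F ι : Type*} [NormedAddCommGroup F] [NormedSpace ℝ F] {s : Finset ι}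
    {f : ι → Rn n → F} {x : Rn n} (hf : ∀ i ∈ s, DifferentiableAt ℝ (f i) x) (j : Fin n) :
    pderiv j (fun y => ∑ i ∈ s, f i y) x = ∑ i ∈ s, pderiv j (f i) x := by
  simp [pderiv, fderiv_fun_sum hf]

theorem pderiv_mul {𝔸 : Type*} [NormedCommRing 𝔸] [NormedAlgebra ℝ 𝔸] {f g : Rn n → 𝔸}
    {x : Rn n} (hf : DifferentiableAt ℝ f x) (hg : DifferentiableAt ℝ g x) (j : Fin n) :
    pderiv j (fun y => f y * g y) x = pderiv j f x * g x + f x * pderiv j g x := by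
  simp [pderiv, fderiv_fun_mul hf hg]
  ring

theorem pderiv_const_mul {𝔸 : Type*} [NormedCommRing 𝔸] [NormedAlgebra ℝ 𝔸] {g : Rn n → 𝔸}
    {x : Rn n} (c : 𝔸) (hg : DifferentiableAt ℝ g x) (j : Fin n) :
    pderiv j (fun y => c * g y) x = c * pderiv j g x := by
  simp [pderiv, fderiv_const_mul hg]

theorem pderiv_ofReal {f : Rn n → ℝ} {x : Rn n} (hf : DifferentiableAt ℝ f x) (j : Fin n) :
    pderiv j (fun y => (f y : ℂ)) x = ((pderiv j f x : ℝ) : ℂ) := by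
  have := (Complex.ofRealCLM.hasFDerivAt (x := f x)).comp x hf.hasFDerivAt
  simp only [pderiv]
  rw [show (fun y => (f y : ℂ)) = Complex.ofRealCLM ∘ f from rfl, this.fderiv]
  simp

theorem pderiv_conj {f : Rn n → ℂ} {x : Rn n} (hf : DifferentiableAt ℝ f x) (j : Fin n) :
    pderiv j (fun y => conj (f y)) x = conj (pderiv j f x) := by
  have := (Complex.conjCLE.toContinuousLinearMap.hasFDerivAt (x := f x)).comp x hf.hasFDerivAt
  simp only [pderiv]
  rw [show (fun y => conj (f y)) = Complex.conjCLE.toContinuousLinearMap ∘ f from rfl,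
    this.fderiv]
  simp

theorem Filter.EventuallyEq.pderiv_eq {F : Type*} [NormedAddCommGroup F] [NormedSpace ℝ F]
    {f g : Rn n → F} {x : Rn n} (h : f =ᶠ[nhds x] g) (j : Fin n) :
    pderiv j f x = pderiv j g x := by
  simp [pderiv, h.fderiv_eq]

/-- Integration by parts against the constant `1`. -/
theorem integral_pderiv_eq_zero {F : Type*} [NormedAddCommGroup F] [NormedSpace ℝ F]
    {f : Rn n → F} (hf : ContDiff ℝ 1 f)
    (hc : HasCompactSupport f) (j : Fin n) : ∫ x, pderiv j f x = 0 := by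
  have h := integral_smul_fderiv_eq_neg_fderiv_smul_of_integrable (μ := (volume : Measure (Rn n)))
    (f := fun _ => (1 : ℝ)) (g := f) (v := EuclideanSpace.single j 1)
    (by simp)
    (by simp only [one_smul]
        exact (hf.continuous_pderiv j).integrable_of_hasCompactSupport (hc.pderiv j))
    (by simpa using hf.continuous.integrable_of_hasCompactSupport hc)
    (by simp) (fun x _ => hf.differentiable one_ne_zero x)
  simpa [pderiv] using h

theorem fderiv_apply_eq_sum_pderiv {F : Type*} [NormedAddCommGroup F] [NormedSpace ℝ F]
    (f : Rn n → F) (x v : Rn n) : fderiv ℝ f x v = ∑ j, v j • pderiv j f x := by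
  conv_lhs => rw [← (EuclideanSpace.basisFun (Fin n) ℝ).sum_repr v]
  simp [pderiv]

/-- The bridge to the second Fréchet derivative, from which the coordinate formula for the Laplacian
and the symmetry of mixed partials are both read off. -/
theorem pderiv_pderiv {F : Type*} [NormedAddCommGroup F] [NormedSpace ℝ F]
    {f : Rn n → F} (hf : ContDiff ℝ 2 f) (j k : Fin n) (x : Rn n) :
    pderiv j (pderiv k f) x =
      fderiv ℝ (fderiv ℝ f) x (EuclideanSpace.single j 1) (EuclideanSpace.single k 1) := by
  have hd : DifferentiableAt ℝ (fderiv ℝ f) x :=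
    (hf.fderiv_right (m := 1) (by norm_num)).differentiable one_ne_zero x
  change fderiv ℝ (fun y => fderiv ℝ f y (EuclideanSpace.single k 1)) x _ = _
  rw [fderiv_clm_apply hd (differentiableAt_const _)]
  simp

theorem laplacian_eq_sum_pderiv {F : Type*} [NormedAddCommGroup F] [NormedSpace ℝ F]
    {f : Rn n → F} (hf : ContDiff ℝ 2 f) (x : Rn n) :
    Laplacian.laplacian f x = ∑ j, pderiv j (pderiv j f) x := by
  rw [InnerProductSpace.laplacian_eq_iteratedFDeriv_orthonormalBasis f
    (EuclideanSpace.basisFun (Fin n) ℝ)]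
  refine Finset.sum_congr rfl fun j _ => ?_
  rw [iteratedFDeriv_two_apply, pderiv_pderiv hf]
  simp

theorem pderiv_comm {F : Type*} [NormedAddCommGroup F] [NormedSpace ℝ F]
    {f : Rn n → F} (hf : ContDiff ℝ 2 f) (j k : Fin n) (x : Rn n) :
    pderiv j (pderiv k f) x = pderiv k (pderiv j f) x := by
  rw [pderiv_pderiv hf, pderiv_pderiv hf]
  exact (hf.contDiffAt.isSymmSndFDerivAt (by simp)) _ _

/-- Off its topological support a function is locally zero. This makes products of `A` or `V`,
singular at the origin, with multipliers supported away from it globally `C¹`. -/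
theorem contDiff_of_forall_mem_tsupport {F : Type*} [NormedAddCommGroup F] [NormedSpace ℝ F]
    {f : Rn n → F} {m : ℕ∞ω} (h : ∀ x ∈ tsupport f, ContDiffAt ℝ m f x) : ContDiff ℝ m f := by
  rw [contDiff_iff_contDiffAt]
  intro x
  by_cases hx : x ∈ tsupport f
  · exact h x hx
  · have : f =ᶠ[nhds x] fun _ => 0 := notMem_tsupport_iff_eventuallyEq.mp hx
    exact contDiffAt_const.congr_of_eventuallyEq this

/-- The derivative falls on the smooth factor, so `f` may be merely locally integrable. -/
theorem pderiv_convolution {f g : Rn n → ℂ} (hf : LocallyIntegrable f volume)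
    (hg : ContDiff ℝ 1 g) (hc : HasCompactSupport g) (j : Fin n) (x : Rn n) :
    pderiv j (convolution f g (ContinuousLinearMap.mul ℝ ℂ) volume) x =
      convolution f (pderiv j g) (ContinuousLinearMap.mul ℝ ℂ) volume x := by
  have h := hc.hasFDerivAt_convolution_right (ContinuousLinearMap.mul ℝ ℂ) hf hg x
  rw [pderiv, h.fderiv]
  have hi : ConvolutionExistsAt f (fderiv ℝ g) x
      ((ContinuousLinearMap.mul ℝ ℂ).precompR (Rn n)) volume :=
    (hc.fderiv ℝ).convolutionExists_right _ hf (hg.continuous_fderiv one_ne_zero) x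
  simp only [convolution]
  rw [ContinuousLinearMap.integral_apply hi]
  simp [pderiv]

end PartialDerivatives

/-! ### Mollification: pointwise convergence for continuous functions and convergence in `L²`. -/

section Mollification

open Filter Topology

variable {n : ℕ}

/-- A sequence of smooth bump functions shrinking to the origin. -/
noncomputable def mollifierBump (n k : ℕ) : ContDiffBump (0 : Rn n) where
  rIn := 1 / (k + 2)
  rOut := 1 / (k + 1)
  rIn_pos := by positivity
  rIn_lt_rOut := by gcongr; norm_num

/-- The normalized bump function, with complex values. -/
noncomputable def mollifier (n k : ℕ) (x : Rn n) : ℂ :=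
  (((mollifierBump n k).normed volume x : ℝ) : ℂ)

/-- Mollification by convolution with a normalized bump function. -/
noncomputable def mollify (k : ℕ) (f : Rn n → ℂ) : Rn n → ℂ :=
  convolution f (mollifier n k) (ContinuousLinearMap.mul ℝ ℂ) volume

theorem contDiff_mollifier (k : ℕ) : ContDiff ℝ ∞ (mollifier n k) :=
  Complex.ofRealCLM.contDiff.comp (mollifierBump n k).contDiff_normed

theorem support_mollifier (k : ℕ) :
    Function.support (mollifier n k) = Metric.ball 0 (1 / (k + 1 : ℝ)) := by
  rw [show (1 / (k + 1 : ℝ)) = (mollifierBump n k).rOut from rfl,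
    ← (mollifierBump n k).support_normed_eq (μ := volume)]
  ext x
  simp [mollifier]

theorem tsupport_mollifier (k : ℕ) :
    tsupport (mollifier n k) = Metric.closedBall 0 (1 / (k + 1 : ℝ)) := by
  rw [tsupport, support_mollifier, closure_ball]
  positivity

theorem hasCompactSupport_mollifier (k : ℕ) : HasCompactSupport (mollifier n k) := by
  rw [HasCompactSupport, tsupport_mollifier]
  exact isCompact_closedBall _ _

theorem integral_mollifier (k : ℕ) : ∫ x, mollifier n k x = 1 := by
  have h : ∫ x, mollifier n k x = ((∫ x, (mollifierBump n k).normed volume x : ℝ) : ℂ) :=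
    integral_ofReal
  rw [h, ContDiffBump.integral_normed, Complex.ofReal_one]

theorem tendsto_rOut_mollifierBump :
    Tendsto (fun k => (mollifierBump n k).rOut) atTop (𝓝 0) :=
  tendsto_one_div_add_atTop_nhds_zero_nat

theorem mollify_apply (k : ℕ) (f : Rn n → ℂ) (x : Rn n) :
    mollify k f x = ∫ t, f t * mollifier n k (x - t) := by
  simp [mollify, convolution]

theorem mollify_apply' (k : ℕ) (f : Rn n → ℂ) (x : Rn n) :
    mollify k f x = ∫ t, mollifier n k t * f (x - t) := by
  rw [mollify_apply, ← integral_sub_left_eq_self _ _ x]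
  simp [mul_comm]

theorem mollify_congr_ae (k : ℕ) {f g : Rn n → ℂ} (h : f =ᵐ[volume] g) :
    mollify k f = mollify k g := by
  ext x
  rw [mollify_apply, mollify_apply]
  exact integral_congr_ae (h.mono fun t ht => by simp [ht])

theorem contDiff_mollify (k : ℕ) {f : Rn n → ℂ} (hf : LocallyIntegrable f volume) :
    ContDiff ℝ ∞ (mollify k f) :=
  (hasCompactSupport_mollifier k).contDiff_convolution_right _ hf (contDiff_mollifier k)

theorem pderiv_mollify (k : ℕ) {f : Rn n → ℂ} (hf : LocallyIntegrable f volume) (j : Fin n)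
    (x : Rn n) : pderiv j (mollify k f) x = ∫ t, f t * pderiv j (mollifier n k) (x - t) := by
  rw [mollify, pderiv_convolution hf ((contDiff_mollifier k).of_le (by simp))
    (hasCompactSupport_mollifier k)]
  simp [convolution]

theorem pderiv_pderiv_mollify (k : ℕ) {f : Rn n → ℂ} (hf : LocallyIntegrable f volume)
    (j : Fin n) (x : Rn n) : pderiv j (pderiv j (mollify k f)) x =
      ∫ t, f t * pderiv j (pderiv j (mollifier n k)) (x - t) := by
  have h : pderiv j (mollify k f) =
      convolution f (pderiv j (mollifier n k)) (ContinuousLinearMap.mul ℝ ℂ) volume := by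
    ext x
    exact pderiv_convolution hf ((contDiff_mollifier k).of_le (by simp))
      (hasCompactSupport_mollifier k) j x
  rw [h, pderiv_convolution hf ((contDiff_mollifier k).contDiff_pderiv (m := 1)
    (by norm_cast) j) ((hasCompactSupport_mollifier k).pderiv j)]
  simp [convolution]

/-- Convolution commutes, so for a `C¹` function the derivative may be placed on `f` instead of on
the mollifier. -/
theorem pderiv_mollify_of_contDiff (k : ℕ) {f : Rn n → ℂ} (hf : ContDiff ℝ 1 f)
    (hc : HasCompactSupport f) (j : Fin n) :
    pderiv j (mollify k f) = mollify k (pderiv j f) := by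
  have h : ∀ g : Rn n → ℂ, mollify k g =
      convolution (mollifier n k) g (ContinuousLinearMap.mul ℝ ℂ) volume := by
    intro g
    ext x
    rw [mollify_apply']
    simp [convolution]
  ext x
  rw [h, h, pderiv_convolution
    ((contDiff_mollifier k).continuous.locallyIntegrable) hf hc]

theorem tendsto_mollify_of_continuous {f : Rn n → ℂ} (hf : Continuous f) (x : Rn n) :
    Tendsto (fun k => mollify k f x) atTop (𝓝 (f x)) := by
  have h := ContDiffBump.convolution_tendsto_right_of_continuous
    (μ := (volume : Measure (Rn n))) (tendsto_rOut_mollifierBump (n := n)) hf x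
  refine h.congr fun k => ?_
  rw [mollify_apply']
  simp [convolution, mollifier]

theorem norm_mollify_le (k : ℕ) {f : Rn n → ℂ} {C : ℝ} (hC : ∀ x, ‖f x‖ ≤ C) (x : Rn n) :
    ‖mollify k f x‖ ≤ C := by
  rw [mollify_apply']
  have hi : Integrable (fun t => C * ‖mollifier n k t‖) (volume : Measure (Rn n)) :=
    (((contDiff_mollifier k).continuous.integrable_of_hasCompactSupport
      (hasCompactSupport_mollifier k)).norm).const_mul C
  calc ‖∫ t, mollifier n k t * f (x - t)‖ ≤ ∫ t, C * ‖mollifier n k t‖ := by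
        refine norm_integral_le_of_norm_le hi (Eventually.of_forall fun t => ?_)
        rw [norm_mul, mul_comm]
        gcongr
        exact hC _
    _ = C := by
        rw [integral_const_mul]
        have : ∀ t, ‖mollifier n k t‖ = (mollifierBump n k).normed volume t := fun t => by
          simp [mollifier, abs_of_nonneg ((mollifierBump n k).nonneg_normed t)]
        simp only [this, ContDiffBump.integral_normed, mul_one]

theorem mollify_eq_zero {k : ℕ} {f : Rn n → ℂ} {x : Rn n}
    (hx : x ∉ Metric.cthickening 1 (tsupport f)) : mollify k f x = 0 := by
  rw [mollify_apply]
  refine integral_eq_zero_of_ae (Eventually.of_forall fun t => ?_)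
  by_cases ht : t ∈ tsupport f
  · have h : mollifier n k (x - t) = 0 := by
      rw [← Function.notMem_support, support_mollifier]
      intro hm
      refine hx (Metric.mem_cthickening_of_dist_le x t 1 _ ht ?_)
      rw [mem_ball_zero_iff, ← dist_eq_norm] at hm
      refine hm.le.trans ?_
      rw [div_le_one (by positivity)]
      simp
    simp [h]
  · simp [image_eq_zero_of_notMem_tsupport ht]

/-- Strong continuity of translations on `L²`, an instance of the continuity of composition with
measure-preserving maps. -/
theorem tendsto_eLpNorm_translate_sub {f : Rn n → ℂ} (hf : MemLp f 2 volume) :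
    Tendsto (fun t : Rn n => eLpNorm (fun x => f (x - t) - f x) 2 volume) (𝓝 0) (𝓝 0) := by
  let g : C(Rn n, C(Rn n, Rn n)) :=
    (ContinuousMap.mk (fun p : Rn n × Rn n => p.2 - p.1) (by fun_prop)).curry
  have hg : ∀ t, MeasurePreserving (g t) (volume : Measure (Rn n)) volume := fun t =>
    measurePreserving_sub_right volume t
  have h0 : Lp.compMeasurePreserving (g 0) (hg 0) (hf.toLp f) = hf.toLp f := by
    refine Lp.ext ?_
    refine (Lp.coeFn_compMeasurePreserving _ _).trans ?_
    simp [g, Function.comp_def]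
  have h := Filter.Tendsto.compMeasurePreservingLp (l := 𝓝 (0 : Rn n))
    (tendsto_const_nhds (x := hf.toLp f)) (g.continuous.tendsto 0) hg (hg 0) (by simp)
  rw [h0, tendsto_iff_edist_tendsto_0] at h
  refine h.congr fun t => ?_
  rw [Lp.edist_def]
  refine eLpNorm_congr_ae ?_
  have h1 := (hg t).quasiMeasurePreserving.ae_eq_comp hf.coeFn_toLp
  filter_upwards [Lp.coeFn_compMeasurePreserving (hf.toLp f) (hg t), h1, hf.coeFn_toLp]
    with x hx1 hx2 hx3
  simp only [Pi.sub_apply, hx1, hx3]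
  rw [hx2]
  simp [g]

theorem lintegral_sq_le_of_isProbabilityMeasure {α : Type*} [MeasurableSpace α] {ν : Measure α}
    [IsProbabilityMeasure ν] {F : α → ℂ} (hF : AEStronglyMeasurable F ν) :
    (∫⁻ t, ‖F t‖ₑ ∂ν) ^ 2 ≤ ∫⁻ t, ‖F t‖ₑ ^ 2 ∂ν := by
  have h := eLpNorm_le_eLpNorm_of_exponent_le (p := 1) (q := 2) (by norm_num) hF
  rw [eLpNorm_one_eq_lintegral_enorm, eLpNorm_eq_lintegral_rpow_enorm_toReal (by simp) (by simp)] at h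
  have h2 := pow_le_pow_left₀ zero_le h 2
  refine h2.trans (le_of_eq ?_)
  rw [← ENNReal.rpow_natCast, ← ENNReal.rpow_mul]
  simp

/-- The mollification error is an average of the differences `f(x - t) - f(x)` over small `t`.
Jensen's inequality and Tonelli bound its `L²` norm by the largest such translation error. -/
theorem tendsto_eLpNorm_mollify_sub {f : Rn n → ℂ} (hf : MemLp f 2 volume) :
    Tendsto (fun k => eLpNorm (fun x => mollify k f x - f x) 2 volume) atTop (𝓝 0) := by
  -- Tonelli needs joint measurability of `(x, t) ↦ f(x - t) - f(x)`, hence a genuinely measurable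
  -- representative.
  wlog hm : StronglyMeasurable f generalizing f
  · have hae := hf.1.ae_eq_mk
    have h := this ((memLp_congr_ae hae).mp hf) hf.1.stronglyMeasurable_mk
    refine h.congr fun k => eLpNorm_congr_ae ?_
    filter_upwards [hae] with x hx
    rw [mollify_congr_ae k hae, hx]
  have hloc : LocallyIntegrable f volume := hf.locallyIntegrable (by norm_num)
  rw [ENNReal.tendsto_nhds_zero]
  intro ε hε
  have htr := (ENNReal.tendsto_nhds_zero.mp (tendsto_eLpNorm_translate_sub hf)) ε hε
  obtain ⟨δ, hδ, hδε⟩ := Metric.eventually_nhds_iff_ball.mp htr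
  have hk : ∀ᶠ k : ℕ in atTop, (1 / (k + 1 : ℝ)) < δ :=
    (tendsto_order.mp tendsto_one_div_add_atTop_nhds_zero_nat).2 δ hδ
  filter_upwards [hk] with k hk
  have hηc : Continuous (mollifier n k) := (contDiff_mollifier k).continuous
  have hηi : Integrable (mollifier n k) volume :=
    hηc.integrable_of_hasCompactSupport (hasCompactSupport_mollifier k)
  have hηm : Measurable fun t => ‖mollifier n k t‖ₑ := hηc.measurable.enorm
  -- The mollifier is a probability density, which is what Jensen's inequality requires.
  set ν : Measure (Rn n) := volume.withDensity fun t => ‖mollifier n k t‖ₑ with hν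
  have hprob : IsProbabilityMeasure ν := by
    refine ⟨?_⟩
    rw [hν, withDensity_apply _ MeasurableSet.univ, Measure.restrict_univ]
    have h1 : ∫⁻ t, ‖mollifier n k t‖ₑ =
        ENNReal.ofReal (∫ t, (mollifierBump n k).normed volume t) := by
      rw [ofReal_integral_eq_lintegral_ofReal (mollifierBump n k).integrable_normed
        (Eventually.of_forall (mollifierBump n k).nonneg_normed)]
      refine lintegral_congr fun t => ?_
      rw [← ofReal_norm]
      simp [mollifier, abs_of_nonneg ((mollifierBump n k).nonneg_normed t)]
    rw [h1, ContDiffBump.integral_normed, ENNReal.ofReal_one]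
  have hFm : StronglyMeasurable fun p : Rn n × Rn n => f (p.1 - p.2) - f p.1 :=
    (hm.comp_measurable (measurable_fst.sub measurable_snd)).sub (hm.comp_measurable measurable_fst)
  have hpt : ∀ x, ‖mollify k f x - f x‖ₑ ^ 2 ≤ ∫⁻ t, ‖f (x - t) - f x‖ₑ ^ 2 ∂ν := by
    intro x
    have hex : Integrable (fun t => mollifier n k t * f (x - t)) volume := by
      have : ConvolutionExistsAt f (mollifier n k) x (ContinuousLinearMap.mul ℝ ℂ) volume :=
        (hasCompactSupport_mollifier k).convolutionExists_right _ hloc hηc x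
      have h2 := (Integrable.comp_sub_left this x)
      simpa [mul_comm] using h2
    have heq : mollify k f x - f x = ∫ t, mollifier n k t * (f (x - t) - f x) := by
      simp only [mul_sub]
      rw [integral_sub hex (hηi.mul_const _), integral_mul_const, integral_mollifier, one_mul,
        mollify_apply']
    have hFx : StronglyMeasurable fun t => f (x - t) - f x :=
      hFm.comp_measurable (measurable_const.prodMk measurable_id)
    refine le_trans ?_ (lintegral_sq_le_of_isProbabilityMeasure hFx.aestronglyMeasurable)
    rw [heq]
    gcongr
    refine (enorm_integral_le_lintegral_enorm _).trans (le_of_eq ?_)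
    rw [hν, lintegral_withDensity_eq_lintegral_mul _ hηm hFx.measurable.enorm]
    simp [enorm_mul]
  have hsq : ∫⁻ x, ‖mollify k f x - f x‖ₑ ^ 2 ≤ ε ^ 2 := by
    calc ∫⁻ x, ‖mollify k f x - f x‖ₑ ^ 2
        ≤ ∫⁻ x, ∫⁻ t, ‖f (x - t) - f x‖ₑ ^ 2 ∂ν := lintegral_mono hpt
      _ = ∫⁻ t, (∫⁻ x, ‖f (x - t) - f x‖ₑ ^ 2) ∂ν :=
          lintegral_lintegral_swap (hFm.measurable.enorm.pow_const 2).aemeasurable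
      _ ≤ ∫⁻ _, ε ^ 2 ∂ν := by
          rw [hν, lintegral_withDensity_eq_lintegral_mul₀ hηm.aemeasurable,
            lintegral_withDensity_eq_lintegral_mul₀ hηm.aemeasurable aemeasurable_const]
          · refine lintegral_mono fun t => ?_
            simp only [Pi.mul_apply]
            by_cases ht : mollifier n k t = 0
            · simp [ht]
            · have htb : t ∈ Metric.ball (0 : Rn n) (1 / (k + 1 : ℝ)) := by
                rw [← support_mollifier]
                exact ht
              have := hδε t (Metric.ball_subset_ball hk.le htb)
              rw [eLpNorm_eq_lintegral_rpow_enorm_toReal (by simp) (by simp)] at this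
              have h2 := pow_le_pow_left₀ zero_le this 2
              rw [← ENNReal.rpow_natCast, ← ENNReal.rpow_mul] at h2
              gcongr
              simpa using h2
          · exact (Measurable.lintegral_prod_left' (f := fun p : Rn n × Rn n =>
              ‖f (p.1 - p.2) - f p.1‖ₑ ^ 2) (hFm.measurable.enorm.pow_const 2)).aemeasurable
      _ = ε ^ 2 := by simp
  rw [eLpNorm_eq_lintegral_rpow_enorm_toReal (by simp) (by simp)]
  calc _ ≤ (ε ^ 2) ^ (1 / (2 : ENNReal).toReal) := by
        gcongr
        simpa using hsq
    _ = ε := by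
        rw [← ENNReal.rpow_natCast, ← ENNReal.rpow_mul]
        simp

end Mollification

/-! ### Bounded real multipliers on `L²`. -/

section Multiplication

open Filter Topology BoundedContinuousFunction

variable {n : ℕ}

theorem memLp_bdd_mul (c : Rn n →ᵇ ℝ) (f : L2 n) :
    MemLp (fun x => (c x : ℂ) * f x) 2 volume :=
  (Lp.memLp f).of_le_mul (c := ‖c‖)
    ((Complex.continuous_ofReal.comp c.continuous).aestronglyMeasurable.mul
      (Lp.aestronglyMeasurable f))
    (Eventually.of_forall fun x => by
      rw [norm_mul, Complex.norm_real]
      gcongr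
      exact c.norm_coe_le_norm x)

/-- Multiplication by a bounded continuous real function on `L²(ℝⁿ)`. -/
noncomputable def mulL2 (c : Rn n →ᵇ ℝ) : L2 n →L[ℂ] L2 n :=
  LinearMap.mkContinuous
    { toFun := fun f => (memLp_bdd_mul c f).toLp _
      map_add' := fun f g => by
        refine Lp.ext ?_
        filter_upwards [(memLp_bdd_mul c (f + g)).coeFn_toLp, (memLp_bdd_mul c f).coeFn_toLp,
          (memLp_bdd_mul c g).coeFn_toLp, Lp.coeFn_add f g, Lp.coeFn_add ((memLp_bdd_mul c f).toLp _) ((memLp_bdd_mul c g).toLp _)] with x h1 h2 h3 h4 h5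
        rw [h1, h5, Pi.add_apply, h2, h3, h4, Pi.add_apply, mul_add]
      map_smul' := fun a f => by
        refine Lp.ext ?_
        filter_upwards [(memLp_bdd_mul c (a • f)).coeFn_toLp, (memLp_bdd_mul c f).coeFn_toLp,
          Lp.coeFn_smul a f, Lp.coeFn_smul a ((memLp_bdd_mul c f).toLp _)] with x h1 h2 h3 h4
        rw [h1, RingHom.id_apply, h4, Pi.smul_apply, h2, h3, Pi.smul_apply, smul_eq_mul,
          smul_eq_mul]
        ring }
    ‖c‖ fun f => Lp.norm_le_mul_norm_of_ae_le_mul (by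
      filter_upwards [(memLp_bdd_mul c f).coeFn_toLp] with x h1
      simp only [LinearMap.coe_mk, AddHom.coe_mk, h1, norm_mul, Complex.norm_real]
      gcongr
      exact c.norm_coe_le_norm x)

theorem coeFn_mulL2 (c : Rn n →ᵇ ℝ) (f : L2 n) :
    mulL2 c f =ᵐ[volume] fun x => (c x : ℂ) * f x :=
  MemLp.coeFn_toLp (memLp_bdd_mul c f)

theorem norm_mulL2_le {c : Rn n →ᵇ ℝ} {C : ℝ} (hC : ∀ x, |c x| ≤ C) (f : L2 n) :
    ‖mulL2 c f‖ ≤ C * ‖f‖ :=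
  Lp.norm_le_mul_norm_of_ae_le_mul (by
    filter_upwards [coeFn_mulL2 c f] with x h1
    rw [h1, norm_mul, Complex.norm_real]
    gcongr
    exact hC x)

theorem inner_L2_eq (f g : L2 n) : ⟪f, g⟫_ℂ = ∫ x, conj (f x) * g x := by
  rw [L2.inner_def]
  exact integral_congr_ae (Eventually.of_forall fun x => by simp [RCLike.inner_apply, mul_comm])

theorem integrable_conj_mul (f g : L2 n) : Integrable (fun x => conj (f x) * g x) volume :=
  (L2.integrable_inner f g).congr (Eventually.of_forall fun x => by
    simp [RCLike.inner_apply, mul_comm])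

theorem integrable_bdd_mul_conj_mul (c : Rn n →ᵇ ℝ) (f g : L2 n) :
    Integrable (fun x => (c x : ℂ) * (conj (f x) * g x)) volume := by
  refine (integrable_conj_mul f (mulL2 c g)).congr ?_
  filter_upwards [coeFn_mulL2 c g] with x hx
  rw [hx]
  ring

theorem inner_mulL2_right (c : Rn n →ᵇ ℝ) (f g : L2 n) :
    ⟪f, mulL2 c g⟫_ℂ = ∫ x, (c x : ℂ) * (conj (f x) * g x) := by
  rw [inner_L2_eq]
  refine integral_congr_ae ?_
  filter_upwards [coeFn_mulL2 c g] with x hx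
  rw [hx]
  ring

theorem inner_mulL2_left (c : Rn n →ᵇ ℝ) (f g : L2 n) :
    ⟪mulL2 c f, g⟫_ℂ = ∫ x, (c x : ℂ) * (conj (f x) * g x) := by
  rw [inner_L2_eq]
  refine integral_congr_ae ?_
  filter_upwards [coeFn_mulL2 c f] with x hx
  rw [hx]
  simp
  ring

/-- A bounded continuous function as an element of `ℝⁿ →ᵇ ℝ`. -/
noncomputable def toBdd (c : Rn n → ℝ) (hc : Continuous c) (hb : ∃ C, ∀ x, |c x| ≤ C) :
    Rn n →ᵇ ℝ :=
  .ofNormedAddCommGroup c hc hb.choose hb.choose_spec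

@[simp] theorem toBdd_apply (c : Rn n → ℝ) (hc : Continuous c) (hb : ∃ C, ∀ x, |c x| ≤ C)
    (x : Rn n) : toBdd c hc hb x = c x := rfl

/-- A continuous function of compact support as an element of `ℝⁿ →ᵇ ℝ`. -/
noncomputable def toBddOfCompact (c : Rn n → ℝ) (hc : Continuous c) (hs : HasCompactSupport c) :
    Rn n →ᵇ ℝ :=
  toBdd c hc (hc.bounded_above_of_compact_support hs)

@[simp] theorem toBddOfCompact_apply (c : Rn n → ℝ) (hc : Continuous c)
    (hs : HasCompactSupport c) (x : Rn n) : toBddOfCompact c hc hs x = c x := rfl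

end Multiplication

/-! ### The weak magnetic gradient: wider test functions, uniqueness, linearity and the product
rule. -/

section WeakGradient

open Filter Topology BoundedContinuousFunction

variable {n : ℕ} {A : Rn n → Rn n}

/-- `|A|² ∈ L¹_loc`, componentwise. -/
def LocallySquareIntegrable (A : Rn n → Rn n) : Prop :=
  ∀ j : Fin n, ∀ K : Set (Rn n), IsCompact K →
    MemLp (fun x => (A x j : ℂ)) 2 (volume.restrict K)

theorem locallySquareIntegrable_of_contDiffOn (hn : n ≠ 0) (hA : ContDiffOn ℝ 1 A {0}ᶜ)
    (hA2 : LocallyIntegrable (fun x => ‖A x‖ ^ 2) volume) : LocallySquareIntegrable A := by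
  intro j K hK
  have : Nonempty (Fin n) := ⟨⟨0, Nat.pos_of_ne_zero hn⟩⟩
  have hmeas : AEStronglyMeasurable A volume := by
    have h1 := hA.continuousOn.aestronglyMeasurable (μ := (volume : Measure (Rn n)))
      (measurableSet_singleton 0).compl
    rwa [Measure.restrict_eq_self_of_ae_mem] at h1
    exact compl_mem_ae_iff.mpr (measure_singleton 0)
  have hA' : MemLp A 2 (volume.restrict K) :=
    (memLp_two_iff_integrable_sq_norm hmeas.restrict).mpr
      (hA2.integrableOn_isCompact hK)
  refine hA'.of_le ?_ (Eventually.of_forall fun x => ?_)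
  · exact (Complex.continuous_ofReal.comp (EuclideanSpace.proj j).continuous).comp_aestronglyMeasurable
      hmeas.restrict
  · rw [Complex.norm_real]
    exact PiLp.norm_apply_le (A x) j

theorem LocallySquareIntegrable.integrableOn_mul (hA : LocallySquareIntegrable A) (u : L2 n)
    (j : Fin n) {K : Set (Rn n)} (hK : IsCompact K) :
    IntegrableOn (fun x => u x * (A x j : ℂ)) K volume :=
  (Lp.memLp u).restrict K |>.integrable_mul (hA j K hK)

theorem integrableOn_L2 (u : L2 n) {K : Set (Rn n)} (hK : IsCompact K) :
    IntegrableOn (fun x => u x) K volume :=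
  ((Lp.memLp u).locallyIntegrable (by norm_num)).integrableOn_isCompact hK

theorem MeasureTheory.IntegrableOn.integrable_mul_of_eq_zero {F ψ : Rn n → ℂ} {K : Set (Rn n)}
    (hF : IntegrableOn F K volume) (hψ : Continuous ψ) {C : ℝ}
    (hC : ∀ x, ‖ψ x‖ ≤ C) (h0 : ∀ x ∉ K, ψ x = 0) : Integrable (fun x => F x * ψ x) volume := by
  have h1 : IntegrableOn (fun x => F x * ψ x) K volume :=
    Integrable.mul_bdd (c := C) hF hψ.aestronglyMeasurable (Eventually.of_forall hC)
  refine (integrableOn_iff_integrable_of_support_subset ?_).mp h1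
  intro x hx
  by_contra h
  exact hx (by simp [h0 x h])

theorem MeasureTheory.IntegrableOn.integrable_mul_of_compactSupport {F ψ : Rn n → ℂ}
    (hF : IntegrableOn F (tsupport ψ) volume) (hψ : Continuous ψ) (hc : HasCompactSupport ψ) :
    Integrable (fun x => F x * ψ x) volume := by
  obtain ⟨C, hC⟩ := hψ.bounded_above_of_compact_support hc
  exact hF.integrable_mul_of_eq_zero hψ hC
    fun x hx => image_eq_zero_of_notMem_tsupport hx

theorem MeasureTheory.IntegrableOn.tendsto_integral_mul {F : Rn n → ℂ} {K : Set (Rn n)}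
    (hF : IntegrableOn F K volume) {ψ : ℕ → Rn n → ℂ} {φ : Rn n → ℂ}
    (hψ : ∀ k, Continuous (ψ k)) {C : ℝ} (hC : ∀ k x, ‖ψ k x‖ ≤ C)
    (h0 : ∀ k, ∀ x ∉ K, ψ k x = 0) (hlim : ∀ x, Tendsto (fun k => ψ k x) atTop (𝓝 (φ x))) :
    Tendsto (fun k => ∫ x, F x * ψ k x) atTop (𝓝 (∫ x, F x * φ x)) := by
  have hφ0 : ∀ x ∉ K, φ x = 0 := fun x hx =>
    tendsto_nhds_unique (hlim x) (by simp [h0 _ x hx])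
  have hrest : ∀ g : Rn n → ℂ, (∀ x ∉ K, g x = 0) → ∫ x, F x * g x = ∫ x in K, F x * g x := by
    intro g hg
    rw [setIntegral_eq_integral_of_forall_compl_eq_zero]
    intro x hx
    simp [hg x hx]
  rw [hrest φ hφ0]
  simp_rw [hrest _ (h0 _)]
  refine tendsto_integral_of_dominated_convergence (fun x => ‖F x‖ * C)
    (fun k => hF.1.mul (hψ k).aestronglyMeasurable) (hF.norm.mul_const C)
    (fun k => Eventually.of_forall fun x => ?_)
    (Eventually.of_forall fun x => tendsto_const_nhds.mul (hlim x))
  rw [norm_mul]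
  gcongr
  exact hC k x

/-- The defining identity of the weak magnetic gradient holds for `C¹` test functions. -/
theorem HasMagneticGradient.integral_mul_eq {u : L2 n} {G : Fin n → L2 n}
    (hA : LocallySquareIntegrable A) (h : HasMagneticGradient A u G) (j : Fin n)
    {ψ : Rn n → ℂ} (hψ : ContDiff ℝ 1 ψ) (hc : HasCompactSupport ψ) :
    ∫ x, G j x * ψ x = -((∫ x, u x * pderiv j ψ x) + Complex.I * ∫ x, u x * A x j * ψ x) := by
  -- All mollifiers have radius at most `1`, so this single compact set supports every mollification
  -- of `ψ`.
  set K := Metric.cthickening 1 (tsupport ψ) with hKdef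
  have hK : IsCompact K := IsCompact.cthickening hc
  obtain ⟨C, hC⟩ := hψ.continuous.bounded_above_of_compact_support hc
  obtain ⟨C', hC'⟩ := (hψ.continuous_pderiv j).bounded_above_of_compact_support (hc.pderiv j)
  have hsm : ∀ k, ContDiff ℝ ∞ (mollify k ψ) := fun k =>
    contDiff_mollify k hψ.continuous.locallyIntegrable
  have h0 : ∀ k, ∀ x ∉ K, mollify k ψ x = 0 := fun k x hx => mollify_eq_zero hx
  have hcs : ∀ k, HasCompactSupport (mollify k ψ) := fun k =>
    HasCompactSupport.intro hK (h0 k)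
  have hpd : ∀ k, pderiv j (mollify k ψ) = mollify k (pderiv j ψ) := fun k =>
    pderiv_mollify_of_contDiff k hψ hc j
  have hcont' : ∀ k, Continuous (pderiv j (mollify k ψ)) := fun k =>
    ((hsm k).of_le (by simp)).continuous_pderiv j
  have h0' : ∀ k, ∀ x ∉ K, pderiv j (mollify k ψ) x = 0 := fun k x hx => by
    rw [hpd]
    refine mollify_eq_zero fun hx' => hx ?_
    exact Metric.cthickening_subset_of_subset _ (tsupport_pderiv_subset ψ j) hx'
  have huA := hA.integrableOn_mul u j hK
  -- The mollified test function is smooth, so the definition applies. Its values and derivatives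
  -- are uniformly bounded and converge pointwise, so each integral passes to the limit.
  have key : ∀ k, ∫ x, G j x * mollify k ψ x = -((∫ x, u x * pderiv j (mollify k ψ) x) +
      Complex.I * ∫ x, u x * A x j * mollify k ψ x) := by
    intro k
    rw [h j _ (hsm k) (hcs k), ← integral_const_mul, ← integral_add]
    · congr 1
      refine integral_congr_ae (Eventually.of_forall fun x => ?_)
      simp only
      ring
    · exact (integrableOn_L2 u hK).integrable_mul_of_eq_zero (hcont' k) (C := C')
        (fun x => by rw [hpd]; exact norm_mollify_le k hC' x) (h0' k)
    · exact (huA.integrable_mul_of_eq_zero (hsm k).continuous (norm_mollify_le k hC)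
        (h0 k)).const_mul _
  have t1 := (integrableOn_L2 (G j) hK).tendsto_integral_mul (fun k => (hsm k).continuous)
    (fun k => norm_mollify_le k hC) h0 (tendsto_mollify_of_continuous hψ.continuous)
  have t2 := (integrableOn_L2 u hK).tendsto_integral_mul hcont' (C := C')
    (fun k x => by rw [hpd]; exact norm_mollify_le k hC' x) h0' (φ := pderiv j ψ)
    (fun x => by
      simp only [hpd]
      exact tendsto_mollify_of_continuous (hψ.continuous_pderiv j) x)
  have t3 := huA.tendsto_integral_mul (fun k => (hsm k).continuous)
    (fun k => norm_mollify_le k hC) h0 (tendsto_mollify_of_continuous hψ.continuous)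
  refine tendsto_nhds_unique t1 ?_
  simp_rw [key]
  exact (t2.add (t3.const_mul _)).neg

/-- The fundamental lemma of the calculus of variations. It identifies the gradient hidden in the
domain condition with the prescribed one. -/
theorem HasMagneticGradient.unique {u : L2 n} {G G' : Fin n → L2 n}
    (h : HasMagneticGradient A u G) (h' : HasMagneticGradient A u G') : G = G' := by
  ext1 j
  have hloc : ∀ v : L2 n, LocallyIntegrable (fun x => v x) volume := fun v =>
    (Lp.memLp v).locallyIntegrable (by norm_num)
  have h0 := ae_eq_zero_of_integral_contDiff_smul_eq_zero ((hloc (G j)).sub (hloc (G' j)))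
    (fun g hg hc => by
      have hgc : ContDiff ℝ ∞ fun x => (g x : ℂ) := Complex.ofRealCLM.contDiff.comp hg
      have hcc : HasCompactSupport fun x => (g x : ℂ) :=
        hc.comp_left (g := fun r : ℝ => (r : ℂ)) Complex.ofReal_zero
      have hi : ∀ v : L2 n, Integrable (fun x => v x * (g x : ℂ)) volume := fun v =>
        (integrableOn_L2 v hcc).integrable_mul_of_compactSupport hgc.continuous hcc
      have e := (h j _ hgc hcc).trans (h' j _ hgc hcc).symm
      rw [← sub_eq_zero, ← integral_sub (hi _) (hi _)] at e
      rw [← e]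
      refine integral_congr_ae (Eventually.of_forall fun x => ?_)
      simp
      ring)
  refine Lp.ext ?_
  filter_upwards [h0] with x hx
  exact sub_eq_zero.mp hx

/-- Used to test the form with `u(t) - u(s)`. Local square integrability of `A` makes the two
right-hand integrals separately convergent. -/
theorem HasMagneticGradient.sub {u v : L2 n} {G Γ : Fin n → L2 n}
    (hA : LocallySquareIntegrable A)
    (h : HasMagneticGradient A u G) (h' : HasMagneticGradient A v Γ) :
    HasMagneticGradient A (u - v) (fun j => G j - Γ j) := by
  intro j ψ hψ hc
  have hψ1 : ContDiff ℝ 1 ψ := hψ.of_le (by simp)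
  have hi1 : ∀ w : L2 n, Integrable (fun x => w x * ψ x) volume := fun w =>
    (integrableOn_L2 w hc).integrable_mul_of_compactSupport hψ.continuous hc
  have hi2 : ∀ w : L2 n, Integrable (fun x => w x * (pderiv j ψ x + Complex.I * A x j * ψ x))
      volume := fun w => by
    have a := (integrableOn_L2 w (hc.pderiv j)).integrable_mul_of_compactSupport
      (hψ1.continuous_pderiv j) (hc.pderiv j)
    have b := ((hA.integrableOn_mul w j hc).integrable_mul_of_compactSupport
      hψ.continuous hc).const_mul Complex.I
    refine (a.add b).congr (Eventually.of_forall fun x => ?_)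
    simp only [Pi.add_apply]
    ring
  have e1 : ∫ x, (G j - Γ j : L2 n) x * ψ x = (∫ x, G j x * ψ x) - ∫ x, Γ j x * ψ x := by
    rw [← integral_sub (hi1 _) (hi1 _)]
    refine integral_congr_ae ?_
    filter_upwards [Lp.coeFn_sub (G j) (Γ j)] with x hx
    rw [hx, Pi.sub_apply, sub_mul]
  have e2 : ∫ x, (u - v : L2 n) x * (pderiv j ψ x + Complex.I * A x j * ψ x) =
      (∫ x, u x * (pderiv j ψ x + Complex.I * A x j * ψ x)) -
        ∫ x, v x * (pderiv j ψ x + Complex.I * A x j * ψ x) := by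
    rw [← integral_sub (hi2 _) (hi2 _)]
    refine integral_congr_ae ?_
    filter_upwards [Lp.coeFn_sub u v] with x hx
    rw [hx, Pi.sub_apply, sub_mul]
  rw [e1, e2, h j ψ hψ hc, h' j ψ hψ hc]
  ring

/-- The product rule for the weak magnetic gradient. -/
theorem HasMagneticGradient.mulL2 {u : L2 n} {G : Fin n → L2 n}
    (hA : LocallySquareIntegrable A) (h : HasMagneticGradient A u G)
    (c : Rn n →ᵇ ℝ) (hc : ContDiff ℝ 1 c) (d : Fin n → Rn n →ᵇ ℝ)
    (hd : ∀ j x, d j x = pderiv j c x) :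
    HasMagneticGradient A (mulL2 c u) (fun j => mulL2 c (G j) + _root_.mulL2 (d j) u) := by
  intro j ψ hψ hψc
  have hcC : ContDiff ℝ 1 fun x => (c x : ℂ) := Complex.ofRealCLM.contDiff.comp hc
  have hψ1 : ContDiff ℝ 1 ψ := hψ.of_le (by simp)
  -- The test function `cψ` is only `C¹`, which is why the identity was first extended beyond smooth
  -- test functions.
  have key := h.integral_mul_eq hA j (hcC.mul hψ1) (hψc.mul_left (f := fun x => (c x : ℂ)))
  have hpd : ∀ x, pderiv j (fun y => (c y : ℂ) * ψ y) x =
      (d j x : ℂ) * ψ x + (c x : ℂ) * pderiv j ψ x := fun x => by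
    rw [pderiv_mul (hcC.differentiable one_ne_zero x) (hψ1.differentiable one_ne_zero x),
      pderiv_ofReal (hc.differentiable one_ne_zero x), hd]
  have hdc : Continuous fun x => (d j x : ℂ) := Complex.continuous_ofReal.comp (d j).continuous
  have hi0 : ∀ (w : L2 n) {b χ : Rn n → ℂ}, Continuous b → Continuous χ → HasCompactSupport χ →
      Integrable (fun x => w x * (b x * χ x)) volume := fun w b χ hb hχ hχc =>
    (integrableOn_L2 w (hχc.mul_left (f := b))).integrable_mul_of_compactSupport
      (hb.mul hχ) hχc.mul_left
  have i1 := hi0 (G j) hcC.continuous hψ.continuous hψc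
  have i2 := hi0 u hdc hψ.continuous hψc
  have i3 := hi0 u hcC.continuous (hψ1.continuous_pderiv j) (hψc.pderiv j)
  have i4 : Integrable (fun x => u x * A x j * ((c x : ℂ) * ψ x)) volume :=
    (hA.integrableOn_mul u j (hψc.mul_left (f := fun x => (c x : ℂ)))).integrable_mul_of_compactSupport
      (hcC.continuous.mul hψ.continuous) hψc.mul_left
  have e1 : ∫ x, (_root_.mulL2 c (G j) + _root_.mulL2 (d j) u : L2 n) x * ψ x =
      (∫ x, G j x * ((c x : ℂ) * ψ x)) + ∫ x, u x * ((d j x : ℂ) * ψ x) := by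
    rw [← integral_add i1 i2]
    refine integral_congr_ae ?_
    filter_upwards [Lp.coeFn_add (_root_.mulL2 c (G j)) (_root_.mulL2 (d j) u),
      coeFn_mulL2 c (G j), coeFn_mulL2 (d j) u] with x h1 h2 h3
    rw [h1, Pi.add_apply, h2, h3]
    ring
  have e2 : ∫ x, _root_.mulL2 c u x * (pderiv j ψ x + Complex.I * A x j * ψ x) =
      (∫ x, u x * ((c x : ℂ) * pderiv j ψ x)) +
        Complex.I * ∫ x, u x * A x j * ((c x : ℂ) * ψ x) := by
    rw [← integral_const_mul, ← integral_add i3 (i4.const_mul _)]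
    refine integral_congr_ae ?_
    filter_upwards [coeFn_mulL2 c u] with x h2
    rw [h2]
    ring
  have e3 : ∫ x, u x * pderiv j (fun y => (c y : ℂ) * ψ y) x =
      (∫ x, u x * ((d j x : ℂ) * ψ x)) + ∫ x, u x * ((c x : ℂ) * pderiv j ψ x) := by
    rw [← integral_add i2 i3]
    refine integral_congr_ae (Eventually.of_forall fun x => ?_)
    simp only [hpd]
    ring
  rw [e1, e2, key, e3]
  ring

end WeakGradient

/-! ### The distributional Laplacian, and smooth approximation away from the origin. -/

section LocalApproximation

open Filter Topology BoundedContinuousFunction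

variable {n : ℕ} {A : Rn n → Rn n}

/-- `∑ⱼ ⟪∇_A ψ, G⟫ = ⟪ψ, g⟫` for all `ψ` in the form domain. -/
def HasFormValue (A : Rn n → Rn n) (G : Fin n → L2 n) (g : L2 n) : Prop :=
  ∀ (ψ : L2 n) (Ψ : Fin n → L2 n), HasMagneticGradient A ψ Ψ → ∑ j, ⟪Ψ j, G j⟫_ℂ = ⟪ψ, g⟫_ℂ

theorem contDiffAt_component (hA1 : ContDiffOn ℝ 1 A {0}ᶜ) (j : Fin n) {x : Rn n} (hx : x ≠ 0) :
    ContDiffAt ℝ 1 (fun y => A y j) x :=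
  (EuclideanSpace.proj (𝕜 := ℝ) j).contDiff.contDiffAt.comp x
    (hA1.contDiffAt (isOpen_compl_singleton.mem_nhds hx))

theorem continuousAt_pderiv_component (hA1 : ContDiffOn ℝ 1 A {0}ᶜ) (i j : Fin n) {x : Rn n}
    (hx : x ≠ 0) : ContinuousAt (pderiv i (fun y => A y j)) x :=
  ((contDiffAt_component hA1 j hx).contDiffAt_pderiv (m := 0) (by simp) i).continuousAt

theorem memLp_continuousOn_mul {K : Set (Rn n)} (hK : IsCompact K) {b : Rn n → ℂ}
    (hb : ContinuousOn b K) {f : Rn n → ℂ} (hf : MemLp f 2 (volume.restrict K)) :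
    MemLp (fun x => b x * f x) 2 (volume.restrict K) := by
  obtain ⟨C, hC⟩ := hK.exists_bound_of_continuousOn hb
  refine hf.of_le_mul (c := C)
    ((hb.aestronglyMeasurable hK.isClosed.measurableSet).mul hf.1) ?_
  filter_upwards [ae_restrict_mem hK.isClosed.measurableSet] with x hx
  rw [norm_mul]
  gcongr
  exact hC x hx

/-- Since `A` is locally square integrable, `Aη` lies in `L²` even if the support of `η` contains
the origin. This supplies test elements of the form domain. -/
theorem hasMagneticGradient_of_contDiff (hA : LocallySquareIntegrable A) {η : Rn n → ℂ}
    (hη : ContDiff ℝ 1 η) (hc : HasCompactSupport η) :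
    ∃ (v : L2 n) (Γ : Fin n → L2 n), HasMagneticGradient A v Γ ∧ v =ᵐ[volume] η ∧
      ∀ j, Γ j =ᵐ[volume] fun x => pderiv j η x - Complex.I * A x j * η x := by
  have hAη : ∀ j, MemLp (fun x => (A x j : ℂ) * η x) 2 volume := by
    intro j
    obtain ⟨C, hC⟩ := hη.continuous.bounded_above_of_compact_support hc
    have h1 : MemLp (fun x => (A x j : ℂ) * η x) 2 (volume.restrict (tsupport η)) := by
      refine (hA j _ hc).of_le_mul (c := C)
        ((hA j _ hc).1.mul hη.continuous.aestronglyMeasurable) (Eventually.of_forall fun x => ?_)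
      rw [norm_mul, mul_comm]
      gcongr
      exact hC x
    rw [← memLp_indicator_iff_restrict (isClosed_tsupport η).measurableSet] at h1
    have h2 : (tsupport η).indicator (fun x => (A x j : ℂ) * η x) = fun x => (A x j : ℂ) * η x := by
      ext x
      by_cases hx : x ∈ tsupport η
      · simp [hx]
      · simp [hx, image_eq_zero_of_notMem_tsupport hx]
    rwa [h2] at h1
  have hv : MemLp η 2 (volume : Measure (Rn n)) := hη.continuous.memLp_of_hasCompactSupport hc
  have hΓ : ∀ j, MemLp (fun x => pderiv j η x - Complex.I * A x j * η x) 2 volume := fun j => by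
    have := ((hη.continuous_pderiv j).memLp_of_hasCompactSupport (μ := volume) (p := 2)
      (hc.pderiv j)).sub ((hAη j).const_mul Complex.I)
    convert this using 2 with x
    simp [mul_assoc]
  refine ⟨hv.toLp η, fun j => (hΓ j).toLp _, ?_, hv.coeFn_toLp, fun j => (hΓ j).coeFn_toLp⟩
  intro j ψ hψ hψc
  have hψ1 : ContDiff ℝ 1 ψ := hψ.of_le (by simp)
  have e1 : ∫ x, (hΓ j).toLp _ x * ψ x =
      ∫ x, (pderiv j η x - Complex.I * A x j * η x) * ψ x :=
    integral_congr_ae ((hΓ j).coeFn_toLp.mono fun x hx => by simp only [hx])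
  have e2 : ∫ x, hv.toLp η x * (pderiv j ψ x + Complex.I * A x j * ψ x) =
      ∫ x, η x * (pderiv j ψ x + Complex.I * A x j * ψ x) :=
    integral_congr_ae (hv.coeFn_toLp.mono fun x hx => by simp only [hx])
  have hψL : MemLp ψ 2 (volume : Measure (Rn n)) := hψ.continuous.memLp_of_hasCompactSupport hψc
  have i1 : Integrable (fun x => (pderiv j η x - Complex.I * A x j * η x) * ψ x) volume :=
    (hΓ j).integrable_mul hψL
  have i2 : Integrable (fun x => η x * (pderiv j ψ x + Complex.I * A x j * ψ x)) volume := by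
    have a := ((hψ1.continuous_pderiv j).memLp_of_hasCompactSupport (μ := volume) (p := 2)
      (hψc.pderiv j)).integrable_mul hv
    have b := ((hAη j).integrable_mul hψL).const_mul Complex.I
    refine (a.add b).congr (Eventually.of_forall fun x => ?_)
    simp only [Pi.add_apply, Pi.mul_apply]
    ring
  rw [e1, e2, eq_neg_iff_add_eq_zero, ← integral_add i1 i2,
    ← integral_pderiv_eq_zero (hη.mul hψ1) (hc.mul_right (f' := ψ)) j]
  refine integral_congr_ae (Eventually.of_forall fun x => ?_)
  simp only
  rw [pderiv_mul (hη.differentiable one_ne_zero x) (hψ1.differentiable one_ne_zero x)]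
  ring

/-- The expansion of `Δu` in terms of `u`, `G = ∇_A u` and `g = -∇_A² u`. -/
noncomputable def laplacianOf (A : Rn n → Rn n) (u : L2 n) (G : Fin n → L2 n) (g : L2 n)
    (x : Rn n) : ℂ :=
  -g x + ∑ j, (2 * Complex.I * A x j * G j x + Complex.I * pderiv j (fun y => A y j) x * u x
    - A x j * A x j * u x)

theorem continuousOn_component (hA1 : ContDiffOn ℝ 1 A {0}ᶜ) {K : Set (Rn n)} (h0 : (0 : Rn n) ∉ K)
    (j : Fin n) : ContinuousOn (fun x => (A x j : ℂ)) K := fun _ hx =>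
  (Complex.continuous_ofReal.continuousAt.comp (contDiffAt_component hA1 j
    (fun h => h0 (h ▸ hx))).continuousAt).continuousWithinAt

theorem continuousOn_pderiv_component (hA1 : ContDiffOn ℝ 1 A {0}ᶜ) {K : Set (Rn n)}
    (h0 : (0 : Rn n) ∉ K) (i j : Fin n) :
    ContinuousOn (fun x => ((pderiv i (fun y => A y j) x : ℝ) : ℂ)) K := fun _ hx =>
  (Complex.continuous_ofReal.continuousAt.comp (continuousAt_pderiv_component hA1 i j
    (fun h => h0 (h ▸ hx)))).continuousWithinAt

theorem memLp_laplacianOf (hA1 : ContDiffOn ℝ 1 A {0}ᶜ) (u : L2 n) (G : Fin n → L2 n) (g : L2 n)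
    {K : Set (Rn n)} (hK : IsCompact K) (h0 : (0 : Rn n) ∉ K) :
    MemLp (laplacianOf A u G g) 2 (volume.restrict K) := by
  have hL : ∀ v : L2 n, MemLp (fun x => v x) 2 (volume.restrict K) := fun v =>
    (Lp.memLp v).restrict K
  have hAc := continuousOn_component hA1 h0
  suffices hsum : ∀ j, MemLp (fun x => 2 * Complex.I * A x j * G j x +
      Complex.I * pderiv j (fun y => A y j) x * u x - A x j * A x j * u x) 2
      (volume.restrict K) by
    exact (hL g).neg.add (memLp_finsetSum _ fun j _ => hsum j)
  intro j
  refine MemLp.sub (MemLp.add ?_ ?_) ?_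
  · exact memLp_continuousOn_mul hK (continuousOn_const.mul (hAc j)) (hL (G j))
  · exact memLp_continuousOn_mul hK
      (continuousOn_const.mul (continuousOn_pderiv_component hA1 h0 j j)) (hL u)
  · exact memLp_continuousOn_mul hK ((hAc j).mul (hAc j)) (hL u)

/-- Solving `-∇_A² u = g` for `Δu` in the sense of distributions on the punctured space, where `A`
is `C¹` and the lower-order coefficients are locally bounded. -/
theorem HasMagneticGradient.integral_laplacian (hA : LocallySquareIntegrable A)
    (hA1 : ContDiffOn ℝ 1 A {0}ᶜ) {u g : L2 n} {G : Fin n → L2 n}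
    (h : HasMagneticGradient A u G) (hg : HasFormValue A G g) {ψ : Rn n → ℂ}
    (hψ : ContDiff ℝ ∞ ψ) (hc : HasCompactSupport ψ) (h0 : (0 : Rn n) ∉ tsupport ψ) :
    ∑ j, ∫ x, u x * pderiv j (pderiv j ψ) x = ∫ x, laplacianOf A u G g x * ψ x := by
  have hψ1 : ContDiff ℝ 1 ψ := hψ.of_le (by simp)
  have hψ' : ∀ j, ContDiff ℝ 1 (pderiv j ψ) := fun j => hψ.contDiff_pderiv (by norm_cast) j
  have hfin : IsFiniteMeasure ((volume : Measure (Rn n)).restrict (tsupport ψ)) :=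
    isFiniteMeasure_restrict.mpr hc.measure_lt_top.ne
  have hIon : ∀ (w : L2 n) {b : Rn n → ℂ}, ContinuousOn b (tsupport ψ) →
      IntegrableOn (fun x => b x * w x) (tsupport ψ) volume := fun w b hb =>
    MemLp.integrable one_le_two (memLp_continuousOn_mul hc hb ((Lp.memLp w).restrict _))
  have hAc := continuousOn_component hA1 h0
  have hI : ∀ (w : L2 n) {b χ : Rn n → ℂ}, ContinuousOn b (tsupport ψ) → Continuous χ →
      tsupport χ ⊆ tsupport ψ → Integrable (fun x => b x * w x * χ x) volume := fun w b χ hb hχ hs =>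
    ((hIon w hb).mono_set hs).integrable_mul_of_compactSupport hχ
      (hc.of_isClosed_subset (isClosed_tsupport _) hs)
  -- the form identity tested with `conj ψ`
  have eb : ∑ j, ((∫ x, G j x * pderiv j ψ x) + Complex.I * ∫ x, A x j * G j x * ψ x) =
      ∫ x, g x * ψ x := by
    have hη : ContDiff ℝ 1 fun x => conj (ψ x) := Complex.conjCLE.contDiff.comp hψ1
    have hηc : HasCompactSupport fun x => conj (ψ x) :=
      hc.comp_left (g := fun z : ℂ => conj z) (map_zero _)
    obtain ⟨v, Γ, hvΓ, hv, hΓ⟩ := hasMagneticGradient_of_contDiff hA hη hηc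
    have e := hg v Γ hvΓ
    rw [inner_L2_eq] at e
    have e1 : ∫ x, g x * ψ x = ∫ x, conj (v x) * g x :=
      integral_congr_ae (hv.mono fun x hx => by simp only [hx]; simp [mul_comm])
    rw [e1, ← e]
    refine Finset.sum_congr rfl fun j _ => ?_
    rw [inner_L2_eq, ← integral_const_mul, ← integral_add]
    · refine integral_congr_ae ((hΓ j).mono fun x hx => ?_)
      simp only [hx]
      rw [pderiv_conj (hψ1.differentiable one_ne_zero x)]
      simp
      ring
    · simpa using hI (G j) (b := fun _ => 1) continuousOn_const (hψ' j).continuous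
        (tsupport_pderiv_subset ψ j)
    · exact (hI (G j) (hAc j) hψ.continuous subset_rfl).const_mul _
  -- The weak gradient identity with test function `∂ⱼψ`.
  have ec : ∀ j, ∫ x, G j x * pderiv j ψ x = -((∫ x, u x * pderiv j (pderiv j ψ) x) +
      Complex.I * ∫ x, A x j * u x * pderiv j ψ x) := fun j => by
    rw [h.integral_mul_eq hA j (hψ' j) (hc.pderiv j)]
    simp only [mul_comm (u _)]
  -- The weak gradient identity with test function `Aⱼψ`, which is `C¹` because the support of `ψ`
  -- misses the origin.
  have ed : ∀ j, ∫ x, A x j * G j x * ψ x =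
      -((∫ x, ((pderiv j (fun y => A y j) x : ℝ) : ℂ) * u x * ψ x) +
        (∫ x, A x j * u x * pderiv j ψ x) + Complex.I * ∫ x, A x j * A x j * u x * ψ x) := fun j => by
    have hsub : tsupport (fun x => (A x j : ℂ) * ψ x) ⊆ tsupport ψ := tsupport_mul_subset_right
    have hAt : ∀ x ∈ tsupport ψ, ContDiffAt ℝ 1 (fun y => A y j) x := fun x hx =>
      contDiffAt_component hA1 j fun hx0 => h0 (hx0 ▸ hx)
    have hAψ : ContDiff ℝ 1 (fun x => (A x j : ℂ) * ψ x) :=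
      contDiff_of_forall_mem_tsupport fun x hx =>
        (Complex.ofRealCLM.contDiff.contDiffAt.comp x (hAt x (hsub hx))).mul hψ1.contDiffAt
    have hpd : ∀ x, pderiv j (fun y => (A y j : ℂ) * ψ y) x =
        ((pderiv j (fun y => A y j) x : ℝ) : ℂ) * ψ x + (A x j : ℂ) * pderiv j ψ x := fun x => by
      by_cases hx : x ∈ tsupport ψ
      · have hd := (hAt x hx).differentiableAt one_ne_zero
        have hd' : DifferentiableAt ℝ (fun y => (A y j : ℂ)) x :=
          Complex.ofRealCLM.differentiableAt.comp x hd
        rw [pderiv_mul hd' (hψ1.differentiable one_ne_zero x), pderiv_ofReal hd j]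
      · rw [pderiv_of_notMem_tsupport (fun hx' => hx (hsub hx')),
          pderiv_of_notMem_tsupport hx, image_eq_zero_of_notMem_tsupport hx]
        simp
    have e := h.integral_mul_eq hA j hAψ hc.mul_left
    rw [← integral_add]
    · simp only [hpd] at e
      calc _ = ∫ x, G j x * ((A x j : ℂ) * ψ x) := by
            congr 1 with x
            ring
        _ = _ := by
            rw [e]
            congr 3
            · congr 1 with x
              ring
            · congr 1 with x
              ring
    · exact hI u (continuousOn_pderiv_component hA1 h0 j j) hψ.continuous subset_rfl
    · exact hI u (hAc j) (hψ' j).continuous (tsupport_pderiv_subset ψ j)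
  have eR : ∫ x, laplacianOf A u G g x * ψ x = -(∫ x, g x * ψ x) + ∑ j,
      (2 * Complex.I * (∫ x, A x j * G j x * ψ x) +
        Complex.I * (∫ x, ((pderiv j (fun y => A y j) x : ℝ) : ℂ) * u x * ψ x) -
        ∫ x, A x j * A x j * u x * ψ x) := by
    have i1 : Integrable (fun x => -(g x * ψ x)) volume := by
      have := hI g (b := fun _ => -1) continuousOn_const hψ.continuous subset_rfl
      simpa using this
    have i2 := fun j => (hI (G j) (hAc j) hψ.continuous subset_rfl).const_mul (2 * Complex.I)
    have i3 := fun j => (hI u (continuousOn_pderiv_component hA1 h0 j j) hψ.continuous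
      subset_rfl).const_mul Complex.I
    have i4 := fun j => hI u ((hAc j).mul (hAc j)) hψ.continuous subset_rfl
    have i23 := fun j => (i2 j).add (i3 j)
    have i5 : ∀ j, Integrable (fun x => (2 * Complex.I * (A x j * G j x * ψ x) +
        Complex.I * (((pderiv j (fun y => A y j) x : ℝ) : ℂ) * u x * ψ x)) -
        A x j * A x j * u x * ψ x) volume := fun j => (i23 j).sub (i4 j)
    have e5 : ∀ j, 2 * Complex.I * (∫ x, A x j * G j x * ψ x) +
        Complex.I * (∫ x, ((pderiv j (fun y => A y j) x : ℝ) : ℂ) * u x * ψ x) -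
        ∫ x, A x j * A x j * u x * ψ x = ∫ x, (2 * Complex.I * (A x j * G j x * ψ x) +
        Complex.I * (((pderiv j (fun y => A y j) x : ℝ) : ℂ) * u x * ψ x)) -
        A x j * A x j * u x * ψ x := fun j => by
      rw [← integral_const_mul, ← integral_const_mul, ← integral_add (i2 j) (i3 j)]
      exact (integral_sub (i23 j) (i4 j)).symm
    rw [Finset.sum_congr rfl fun j _ => e5 j, ← integral_neg]
    rw [← integral_finsetSum _ fun j _ => i5 j, ← integral_add i1]
    · refine integral_congr_ae (Eventually.of_forall fun x => ?_)
      simp only [laplacianOf, add_mul, Finset.sum_mul, neg_mul]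
      congr 1
      refine Finset.sum_congr rfl fun j _ => ?_
      ring
    · exact integrable_finsetSum _ fun j _ => i5 j
  rw [eR, ← eb, ← Finset.sum_neg_distrib, ← Finset.sum_add_distrib]
  refine Finset.sum_congr rfl fun j _ => ?_
  rw [ec j, ed j]
  linear_combination (∫ x, A x j * A x j * u x * ψ x) * Complex.I_sq

/-- The target is square integrable only near `K`, so it is truncated to `K'` and the global
mollification theorem is applied. The offset `N` starts the sequence at a small enough radius. -/
theorem tendsto_eLpNorm_mollify_indicator {K K' : Set (Rn n)} (hK' : IsCompact K')
    (hKK' : K ⊆ K') (hK : MeasurableSet K) {F : Rn n → ℂ} (hF : MemLp F 2 (volume.restrict K'))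
    {v : ℕ → Rn n → ℂ} (N : ℕ) (hv : ∀ k, ∀ x ∈ K, v k x = mollify (k + N) (K'.indicator F) x) :
    Tendsto (fun k => eLpNorm (fun x => v k x - F x) 2 (volume.restrict K)) atTop (𝓝 0) := by
  have h1 := (memLp_indicator_iff_restrict hK'.isClosed.measurableSet).mpr hF
  have h2 := (tendsto_add_atTop_iff_nat N).mpr (tendsto_eLpNorm_mollify_sub h1)
  refine tendsto_of_tendsto_of_tendsto_of_le_of_le tendsto_const_nhds h2
    (fun _ => zero_le) fun k => ?_
  calc eLpNorm (fun x => v k x - F x) 2 (volume.restrict K)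
      = eLpNorm (fun x => mollify (k + N) (K'.indicator F) x - K'.indicator F x) 2
          (volume.restrict K) := by
        refine eLpNorm_congr_ae ?_
        filter_upwards [ae_restrict_mem hK] with x hx
        rw [hv k x hx, Set.indicator_of_mem (hKK' hx)]
    _ ≤ _ := eLpNorm_restrict_le _ _ _ _

/-- Away from the origin, functions in the form domain are approximated by smooth functions,
together with their derivatives and, in the domain of `H_A`, with their Laplacian. -/
theorem HasMagneticGradient.exists_smooth_approx (hA : LocallySquareIntegrable A)
    (hA1 : ContDiffOn ℝ 1 A {0}ᶜ) {u : L2 n} {G : Fin n → L2 n}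
    (h : HasMagneticGradient A u G) {K : Set (Rn n)} (hK : IsCompact K) (h0 : (0 : Rn n) ∉ K) :
    ∃ w : ℕ → Rn n → ℂ, (∀ k, ContDiff ℝ ∞ (w k)) ∧
      Tendsto (fun k => eLpNorm (fun x => w k x - u x) 2 (volume.restrict K)) atTop (𝓝 0) ∧
      (∀ j, Tendsto (fun k => eLpNorm (fun x => pderiv j (w k) x -
        (G j x + Complex.I * A x j * u x)) 2 (volume.restrict K)) atTop (𝓝 0)) ∧
      ∀ g, HasFormValue A G g → Tendsto (fun k => eLpNorm (fun x =>
        (∑ j, pderiv j (pderiv j (w k)) x) - laplacianOf A u G g x) 2 (volume.restrict K))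
        atTop (𝓝 0) := by
  -- There is room for a neighbourhood of `K` that still avoids the origin.
  obtain ⟨δ, hδ, hδK⟩ := hK.exists_cthickening_subset_open isOpen_compl_singleton
    (Set.subset_compl_singleton_iff.mpr h0)
  set K' := Metric.cthickening δ K with hK'def
  have hK' : IsCompact K' := hK.cthickening
  have h0' : (0 : Rn n) ∉ K' := fun h => hδK h rfl
  have hKK' : K ⊆ K' := Metric.self_subset_cthickening K
  have hKm := hK.isClosed.measurableSet
  have hK'm := hK'.isClosed.measurableSet
  obtain ⟨N, hN⟩ := exists_nat_one_div_lt hδ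
  have hNk : ∀ k : ℕ, 1 / (((k + N : ℕ) : ℝ) + 1) ≤ δ := fun k => by
    refine le_trans ?_ hN.le
    gcongr
    simp
  have hLp : ∀ v : L2 n, MemLp (fun x => v x) 2 (volume.restrict K') := fun v =>
    (Lp.memLp v).restrict K'
  have hloc : LocallyIntegrable (K'.indicator (fun x => u x)) volume :=
    ((memLp_indicator_iff_restrict hK'm).mpr (hLp u)).locallyIntegrable (by norm_num)
  have hsupp : ∀ k, ∀ x ∈ K, ∀ t ∉ K', x - t ∉ tsupport (mollifier n (k + N)) := by
    intro k x hx t ht hm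
    rw [tsupport_mollifier, mem_closedBall_zero_iff, ← dist_eq_norm, dist_comm] at hm
    exact ht (Metric.mem_cthickening_of_dist_le t x δ K hx (hm.trans (hNk k)))
  -- From a point of `K` the mollifier, of radius at most `δ`, sees only `K'`, so the truncation is
  -- invisible there.
  have hind : ∀ k, ∀ x ∈ K, ∀ (F η : Rn n → ℂ), tsupport η ⊆ tsupport (mollifier n (k + N)) →
      ∫ t, K'.indicator F t * η (x - t) = ∫ t, F t * η (x - t) := by
    intro k x hx F η hη
    congr 1 with t
    by_cases ht : t ∈ K'
    · rw [Set.indicator_of_mem ht]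
    · rw [image_eq_zero_of_notMem_tsupport fun hm => hsupp k x hx t ht (hη hm), mul_zero, mul_zero]
  have hsmooth : ∀ k (x : Rn n), ContDiff ℝ ∞ fun t => mollifier n (k + N) (x - t) := fun k x =>
    (contDiff_mollifier _).comp (contDiff_const.sub contDiff_id)
  have hcomp : ∀ k (x : Rn n), HasCompactSupport fun t => mollifier n (k + N) (x - t) := fun k x =>
    (hasCompactSupport_mollifier _).comp_homeomorph (Homeomorph.subLeft x)
  have hpd : ∀ (η : Rn n → ℂ) (hη : ContDiff ℝ 1 η) (x t : Rn n) (j : Fin n),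
      pderiv j (fun t => η (x - t)) t = -pderiv j η (x - t) := by
    intro η hη x t j
    have h1 := (hη.differentiable one_ne_zero (x - t)).hasFDerivAt.comp t
      ((hasFDerivAt_const x t).sub (hasFDerivAt_id t))
    simp only [pderiv]
    have h2 : fderiv ℝ (fun t => η (x - t)) t = _ := h1.fderiv
    rw [h2]
    simp
  have hη1 : ∀ k, ContDiff ℝ 1 (mollifier n k) := fun k => (contDiff_mollifier k).of_le (by simp)
  refine ⟨fun k => mollify (k + N) (K'.indicator fun x => u x), fun k => contDiff_mollify _ hloc,
    ?_, fun j => ?_, fun g hg => ?_⟩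
  · exact tendsto_eLpNorm_mollify_indicator hK' hKK' hKm (hLp u) N fun k x hx => rfl
  · refine tendsto_eLpNorm_mollify_indicator hK' hKK' hKm
      (F := fun x => G j x + Complex.I * A x j * u x) ?_ N fun k x hx => ?_
    · exact (hLp _).add (memLp_continuousOn_mul hK'
        (continuousOn_const.mul (continuousOn_component hA1 h0' j)) (hLp u))
    · rw [pderiv_mollify _ hloc, mollify_apply, hind k x hx _ _ subset_rfl,
        hind k x hx _ _ (tsupport_pderiv_subset _ j)]
      -- The test function is `t ↦ η(x - t)`. The reflection contributes the sign that turns the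
      -- weak derivative into a derivative in `x`.
      have e := h.integral_mul_eq hA j ((hsmooth k x).of_le (by simp)) (hcomp k x)
      simp only [hpd _ (hη1 _), mul_neg, integral_neg] at e
      have i1 := (integrableOn_L2 (G j) (hcomp k x)).integrable_mul_of_compactSupport
        (hsmooth k x).continuous (hcomp k x)
      have i2 := (hA.integrableOn_mul u j (hcomp k x)).integrable_mul_of_compactSupport
        (hsmooth k x).continuous (hcomp k x)
      have e2 : ∫ t, (G j t + Complex.I * A t j * u t) * mollifier n (k + N) (x - t) =
          (∫ t, G j t * mollifier n (k + N) (x - t)) +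
            Complex.I * ∫ t, u t * A t j * mollifier n (k + N) (x - t) := by
        rw [← integral_const_mul, ← integral_add i1 (i2.const_mul _)]
        congr 1 with t
        ring
      rw [e2, e]
      ring
  · refine tendsto_eLpNorm_mollify_indicator hK' hKK' hKm
      (memLp_laplacianOf hA1 u G g hK' h0') N fun k x hx => ?_
    rw [mollify_apply, hind k x hx _ _ subset_rfl]
    have hts : (0 : Rn n) ∉ tsupport fun t => mollifier n (k + N) (x - t) := by
      intro hm
      have := tsupport_comp_subset_preimage (mollifier n (k + N))
        (continuous_const.sub continuous_id : Continuous fun t : Rn n => x - t) hm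
      exact hsupp k x hx 0 h0' this
    rw [← h.integral_laplacian hA hA1 hg (hsmooth k x) (hcomp k x) hts]
    refine Finset.sum_congr rfl fun j _ => ?_
    rw [pderiv_pderiv_mollify _ hloc, hind k x hx _ _
      ((tsupport_pderiv_subset _ j).trans (tsupport_pderiv_subset _ j))]
    congr 1 with t
    have h1 : pderiv j (fun t => mollifier n (k + N) (x - t)) =
        fun t => -pderiv j (mollifier n (k + N)) (x - t) := by
      ext t
      exact hpd _ (hη1 _) x t j
    have h2 : ContDiff ℝ 1 fun y => -pderiv j (mollifier n (k + N)) y :=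
      ((contDiff_mollifier _).contDiff_pderiv (by norm_cast) j).neg
    rw [h1, hpd _ h2 x t j]
    change _ = _ * -(fderiv ℝ (fun y => -pderiv j (mollifier n (k + N)) y) (x - t)
      (EuclideanSpace.single j 1))
    rw [fderiv_fun_neg, _root_.neg_apply, neg_neg]
    rfl

end LocalApproximation

/-! ### Convergence in `L²` on compact sets and its stability. -/

section L2Convergence

open Filter Topology

variable {n : ℕ}

/-- Convergence in `L²(μ)` of a sequence of functions. -/
structure TendstoL2 (μ : Measure (Rn n)) (f : ℕ → Rn n → ℂ) (g : Rn n → ℂ) : Prop where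
  memLp : ∀ k, MemLp (f k) 2 μ
  memLp_lim : MemLp g 2 μ
  tendsto : Tendsto (fun k => eLpNorm (fun x => f k x - g x) 2 μ) atTop (𝓝 0)

namespace TendstoL2

variable {μ : Measure (Rn n)} {f f' : ℕ → Rn n → ℂ} {g g' : Rn n → ℂ}

theorem const (h : MemLp g 2 μ) : TendstoL2 μ (fun _ => g) g :=
  ⟨fun _ => h, h, by simp⟩

theorem add (h : TendstoL2 μ f g) (h' : TendstoL2 μ f' g') :
    TendstoL2 μ (fun k x => f k x + f' k x) (fun x => g x + g' x) := by
  refine ⟨fun k => (h.memLp k).add (h'.memLp k), h.memLp_lim.add h'.memLp_lim, ?_⟩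
  refine tendsto_of_tendsto_of_tendsto_of_le_of_le tendsto_const_nhds
    (by simpa using h.tendsto.add h'.tendsto) (fun _ => zero_le) fun k => ?_
  have e := eLpNorm_add_le (p := 2) ((h.memLp k).sub h.memLp_lim).1
    ((h'.memLp k).sub h'.memLp_lim).1 (by norm_num)
  refine le_trans (le_of_eq ?_) e
  congr 1
  ext x
  simp only [Pi.add_apply, Pi.sub_apply]
  ring

theorem sum {ι : Type*} {s : Finset ι} {f : ι → ℕ → Rn n → ℂ} {g : ι → Rn n → ℂ}
    (h : ∀ i ∈ s, TendstoL2 μ (f i) (g i)) :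
    TendstoL2 μ (fun k x => ∑ i ∈ s, f i k x) (fun x => ∑ i ∈ s, g i x) := by
  classical
  induction s using Finset.induction_on with
  | empty => simpa using TendstoL2.const (μ := μ) (g := fun _ => 0) MemLp.zero
  | insert a s ha ih =>
    simp only [Finset.sum_insert ha]
    exact (h a (Finset.mem_insert_self a s)).add
      (ih fun i hi => h i (Finset.mem_insert_of_mem hi))

theorem mul_left {K : Set (Rn n)} (hK : IsCompact K) {b : Rn n → ℂ} (hb : ContinuousOn b K)
    (h : TendstoL2 (volume.restrict K) f g) :
    TendstoL2 (volume.restrict K) (fun k x => b x * f k x) (fun x => b x * g x) := by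
  refine ⟨fun k => memLp_continuousOn_mul hK hb (h.memLp k),
    memLp_continuousOn_mul hK hb h.memLp_lim, ?_⟩
  obtain ⟨C, hC⟩ := hK.exists_bound_of_continuousOn hb
  refine tendsto_of_tendsto_of_tendsto_of_le_of_le tendsto_const_nhds
    (by simpa using ENNReal.Tendsto.const_mul (a := ENNReal.ofReal C) h.tendsto (by simp))
    (fun _ => zero_le) fun k => ?_
  refine eLpNorm_le_mul_eLpNorm_of_ae_le_mul ?_ 2
  filter_upwards [ae_restrict_mem hK.isClosed.measurableSet] with x hx
  rw [← mul_sub, norm_mul]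
  gcongr
  exact hC x hx

/-- Continuity of the inner product of `L²(μ)`. Through it, quadratic identities for smooth
functions pass to the limit. -/
theorem tendsto_integral_conj_mul (h : TendstoL2 μ f g) (h' : TendstoL2 μ f' g') :
    Tendsto (fun k => ∫ x, conj (f k x) * f' k x ∂μ) atTop (𝓝 (∫ x, conj (g x) * g' x ∂μ)) := by
  have hi : ∀ {a b : Rn n → ℂ} (ha : MemLp a 2 μ) (hb : MemLp b 2 μ),
      ∫ x, conj (a x) * b x ∂μ = ⟪ha.toLp a, hb.toLp b⟫_ℂ := by
    intro a b ha hb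
    rw [L2.inner_def]
    refine integral_congr_ae ?_
    filter_upwards [ha.coeFn_toLp, hb.coeFn_toLp] with x hx hx'
    rw [hx, hx', RCLike.inner_apply, mul_comm]
  have ht : ∀ {a : ℕ → Rn n → ℂ} {b : Rn n → ℂ} (hab : TendstoL2 μ a b),
      Tendsto (fun k => (hab.memLp k).toLp (a k)) atTop (𝓝 (hab.memLp_lim.toLp b)) :=
    fun hab => (Lp.tendsto_Lp_iff_tendsto_eLpNorm'' _ hab.memLp _ hab.memLp_lim).mpr hab.tendsto
  rw [hi h.memLp_lim h'.memLp_lim]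
  simp_rw [fun k => hi (h.memLp k) (h'.memLp k)]
  exact (ht h).inner (ht h')

end TendstoL2

end L2Convergence

/-! ### Packaged approximation, and integration by parts away from the origin. -/

section SmoothApproximation

open Filter Topology

variable {n : ℕ} {A : Rn n → Rn n}

theorem memLp_of_continuousOn {K : Set (Rn n)} (hK : IsCompact K) {f : Rn n → ℂ}
    (hf : ContinuousOn f K) : MemLp f 2 (volume.restrict K) := by
  have : IsFiniteMeasure ((volume : Measure (Rn n)).restrict K) :=
    isFiniteMeasure_restrict.mpr hK.measure_lt_top.ne
  simpa using memLp_continuousOn_mul hK hf (memLp_const (1 : ℂ))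

/-- Smooth approximations in `L²(K)` of a function, its derivatives and its Laplacian. -/
theorem HasMagneticGradient.exists_tendstoL2 (hA : LocallySquareIntegrable A)
    (hA1 : ContDiffOn ℝ 1 A {0}ᶜ) {u : L2 n} {G : Fin n → L2 n}
    (h : HasMagneticGradient A u G) {K : Set (Rn n)} (hK : IsCompact K) (h0 : (0 : Rn n) ∉ K) :
    ∃ w : ℕ → Rn n → ℂ, (∀ k, ContDiff ℝ ∞ (w k)) ∧
      TendstoL2 (volume.restrict K) w (fun x => u x) ∧
      (∀ j, TendstoL2 (volume.restrict K) (fun k => pderiv j (w k))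
        (fun x => G j x + Complex.I * A x j * u x)) ∧
      ∀ g, HasFormValue A G g → TendstoL2 (volume.restrict K)
        (fun k x => ∑ j, pderiv j (pderiv j (w k)) x) (laplacianOf A u G g) := by
  obtain ⟨w, hw, h1, h2, h3⟩ := h.exists_smooth_approx hA hA1 hK h0
  have hL : ∀ v : L2 n, MemLp (fun x => v x) 2 (volume.restrict K) := fun v =>
    (Lp.memLp v).restrict K
  refine ⟨w, hw, ⟨fun k => memLp_of_continuousOn hK (hw k).continuous.continuousOn, hL u, h1⟩,
    fun j => ⟨fun k => memLp_of_continuousOn hK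
      (((hw k).of_le (by simp)).continuous_pderiv j).continuousOn, ?_, h2 j⟩,
    fun g hg => ⟨fun k => memLp_of_continuousOn hK ?_, memLp_laplacianOf hA1 u G g hK h0, h3 g hg⟩⟩
  · exact (hL _).add (memLp_continuousOn_mul hK
      (continuousOn_const.mul (continuousOn_component hA1 h0 j)) (hL u))
  · exact (continuous_finsetSum _ fun j _ =>
      ((hw k).contDiff_pderiv (m := 1) (by norm_cast) j).continuous_pderiv j).continuousOn

theorem integral_eq_setIntegral_of_eqOn {K : Set (Rn n)} (hK : MeasurableSet K) {F F' : Rn n → ℂ}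
    (h0 : ∀ x ∉ K, F x = 0) (h : ∀ x ∈ K, F x = F' x) : ∫ x, F x = ∫ x in K, F' x := by
  rw [← setIntegral_congr_fun hK h, setIntegral_eq_integral_of_forall_compl_eq_zero h0]

/-- Integration by parts against a multiplier supported away from the origin. -/
theorem HasMagneticGradient.integral_parts_of_notMem (hA : LocallySquareIntegrable A)
    (hA1 : ContDiffOn ℝ 1 A {0}ᶜ) {u v : L2 n} {G Γ : Fin n → L2 n}
    (hu : HasMagneticGradient A u G) (hv : HasMagneticGradient A v Γ) (j : Fin n)
    {Z : Rn n → ℝ} (hZ : ContDiff ℝ 1 Z) (hc : HasCompactSupport Z) (h0 : (0 : Rn n) ∉ tsupport Z) :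
    (∫ x, (Z x : ℂ) * (conj (v x) * G j x)) + ∫ x, (Z x : ℂ) * (conj (Γ j x) * u x) =
      -∫ x, ((pderiv j Z x : ℝ) : ℂ) * (conj (v x) * u x) := by
  obtain ⟨w, hw, hw1, hw2, -⟩ := hv.exists_tendstoL2 hA hA1 hc h0
  set K := tsupport Z with hKdef
  have hL : ∀ v : L2 n, MemLp (fun x => v x) 2 (volume.restrict K) := fun v =>
    (Lp.memLp v).restrict K
  have hZC : ContDiff ℝ 1 fun x => (Z x : ℂ) := Complex.ofRealCLM.contDiff.comp hZ
  have hdZ : Continuous fun x => ((pderiv j Z x : ℝ) : ℂ) :=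
    Complex.continuous_ofReal.comp (hZ.continuous_pderiv j)
  have hAc := continuousOn_component hA1 h0 j
  have mG := memLp_continuousOn_mul hc hZC.continuous.continuousOn (hL (G j))
  have mu := memLp_continuousOn_mul hc hZC.continuous.continuousOn (hL u)
  have mdu := memLp_continuousOn_mul hc hdZ.continuousOn (hL u)
  have mAu := memLp_continuousOn_mul hc hAc mu
  have hcp : IsCompact K := hc
  have hKm : MeasurableSet K := hcp.isClosed.measurableSet
  have hZ0 : ∀ x ∉ K, Z x = 0 := fun x hx => image_eq_zero_of_notMem_tsupport hx
  have hdZ0 : ∀ x ∉ K, pderiv j Z x = 0 := fun x hx => pderiv_of_notMem_tsupport hx j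
  have key : ∀ k, ∫ x in K, conj (w k x) * ((Z x : ℂ) * G j x) =
      -(((∫ x in K, conj (w k x) * (((pderiv j Z x : ℝ) : ℂ) * u x)) +
        ∫ x in K, conj (pderiv j (w k) x) * ((Z x : ℂ) * u x)) +
        Complex.I * ∫ x in K, conj (w k x) * ((A x j : ℂ) * ((Z x : ℂ) * u x))) := by
    intro k
    have hw1k : ContDiff ℝ 1 (w k) := (hw k).of_le (by simp)
    have hcw : ContDiff ℝ 1 fun x => conj (w k x) := Complex.conjCLE.contDiff.comp hw1k
    have hψ : ContDiff ℝ 1 fun x => (Z x : ℂ) * conj (w k x) := hZC.mul hcw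
    have hZcc : HasCompactSupport fun x => (Z x : ℂ) :=
      hc.comp_left (g := fun r : ℝ => (r : ℂ)) Complex.ofReal_zero
    have e := hu.integral_mul_eq hA j hψ hZcc.mul_right
    have hpd : ∀ x, pderiv j (fun y => (Z y : ℂ) * conj (w k y)) x =
        ((pderiv j Z x : ℝ) : ℂ) * conj (w k x) + (Z x : ℂ) * conj (pderiv j (w k) x) := fun x => by
      rw [pderiv_mul (hZC.differentiable one_ne_zero x) (hcw.differentiable one_ne_zero x),
        pderiv_ofReal (hZ.differentiable one_ne_zero x),
        pderiv_conj (hw1k.differentiable one_ne_zero x)]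
    simp only [hpd] at e
    have mw := (memLp_of_continuousOn hcp hcw.continuous.continuousOn)
    have mdw := (memLp_of_continuousOn hcp
      (Complex.continuous_conj.comp (hw1k.continuous_pderiv j)).continuousOn)
    have i1 : IntegrableOn (fun x => conj (w k x) * (((pderiv j Z x : ℝ) : ℂ) * u x)) K volume :=
      mw.integrable_mul mdu
    have i2 : IntegrableOn (fun x => conj (pderiv j (w k) x) * ((Z x : ℂ) * u x)) K volume :=
      mdw.integrable_mul mu
    rw [← integral_add i1 i2, ← integral_eq_setIntegral_of_eqOn hKm
        (F := fun x => G j x * ((Z x : ℂ) * conj (w k x)))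
        (fun x hx => by simp [hZ0 x hx]) (fun x _ => by ring), e]
    congr 2
    · exact integral_eq_setIntegral_of_eqOn hKm (fun x hx => by simp [hZ0 x hx, hdZ0 x hx])
        (fun x _ => by ring)
    · congr 1
      exact integral_eq_setIntegral_of_eqOn hKm (fun x hx => by simp [hZ0 x hx])
        (fun x _ => by ring)
  have t1 := hw1.tendsto_integral_conj_mul (.const mG)
  have t2 := hw1.tendsto_integral_conj_mul (.const mdu)
  have t3 := (hw2 j).tendsto_integral_conj_mul (.const mu)
  have t4 := hw1.tendsto_integral_conj_mul (.const mAu)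
  simp_rw [key] at t1
  have e := tendsto_nhds_unique t1 ((t2.add t3).add (t4.const_mul Complex.I)).neg
  have i3 : IntegrableOn (fun x => conj (Γ j x) * ((Z x : ℂ) * u x)) K volume :=
    (hL (Γ j)).star.integrable_mul mu
  have i4 : IntegrableOn (fun x => Complex.I * (conj (v x) * ((A x j : ℂ) * ((Z x : ℂ) * u x)))) K
      volume := ((hL v).star.integrable_mul mAu).const_mul _
  -- The ordinary derivatives converge to `Γⱼ + iAⱼv`. Conjugation reverses the sign of `i`, so the
  -- two contributions of `A` cancel.
  have e3 : ∫ x in K, conj (Γ j x + Complex.I * A x j * v x) * ((Z x : ℂ) * u x) =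
      (∫ x in K, conj (Γ j x) * ((Z x : ℂ) * u x)) -
        Complex.I * ∫ x in K, conj (v x) * ((A x j : ℂ) * ((Z x : ℂ) * u x)) := by
    rw [← integral_const_mul, ← integral_sub i3 i4]
    congr 1 with x
    simp
    ring
  rw [e3] at e
  rw [integral_eq_setIntegral_of_eqOn hKm (F := fun x => (Z x : ℂ) * (conj (v x) * G j x))
      (fun x hx => by simp [hZ0 x hx]) (fun x _ => mul_left_comm _ _ _), e,
    integral_eq_setIntegral_of_eqOn hKm (F := fun x => (Z x : ℂ) * (conj (Γ j x) * u x))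
      (fun x hx => by simp [hZ0 x hx]) (fun x _ => mul_left_comm _ _ _),
    integral_eq_setIntegral_of_eqOn hKm
      (F := fun x => ((pderiv j Z x : ℝ) : ℂ) * (conj (v x) * u x))
      (fun x hx => by simp [hdZ0 x hx]) (fun x _ => mul_left_comm _ _ _)]
  ring

end SmoothApproximation

/-! ### Scaled cut-off functions, at infinity and at the origin. -/

section Cutoff

open Filter Topology

variable {n : ℕ}

/-- A smooth bump function equal to `1` on the unit ball and supported in the ball of radius `2`. -/
noncomputable def unitBump (n : ℕ) : ContDiffBump (0 : Rn n) where
  rIn := 1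
  rOut := 2
  rIn_pos := one_pos
  rIn_lt_rOut := one_lt_two

/-- The bump function at scale `s⁻¹`. -/
noncomputable def scaledBump (n : ℕ) (s : ℝ) (x : Rn n) : ℝ := unitBump n (s • x)

theorem contDiff_scaledBump (s : ℝ) : ContDiff ℝ ∞ (scaledBump n s) :=
  (unitBump n).contDiff.comp (contDiff_const_smul s)

theorem scaledBump_nonneg (s : ℝ) (x : Rn n) : 0 ≤ scaledBump n s x := (unitBump n).nonneg

theorem scaledBump_le_one (s : ℝ) (x : Rn n) : scaledBump n s x ≤ 1 := (unitBump n).le_one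

theorem abs_scaledBump_le_one (s : ℝ) (x : Rn n) : |scaledBump n s x| ≤ 1 :=
  abs_le.mpr ⟨by linarith [scaledBump_nonneg s x], scaledBump_le_one s x⟩

theorem scaledBump_eq_one {s : ℝ} {x : Rn n} (h : |s| * ‖x‖ ≤ 1) : scaledBump n s x = 1 :=
  (unitBump n).one_of_mem_closedBall (by simpa [norm_smul, unitBump] using h)

theorem scaledBump_eq_zero {s : ℝ} {x : Rn n} (h : 2 ≤ |s| * ‖x‖) : scaledBump n s x = 0 :=
  (unitBump n).zero_of_le_dist (by simpa [norm_smul, unitBump] using h)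

theorem scaledBump_eventuallyEq_one {s : ℝ} {x : Rn n} (h : |s| * ‖x‖ < 1) :
    scaledBump n s =ᶠ[𝓝 x] fun _ => 1 := by
  have : ∀ᶠ y in 𝓝 x, |s| * ‖y‖ < 1 :=
    (continuous_const.mul continuous_norm).continuousAt.eventually_lt continuousAt_const h
  exact this.mono fun y hy => scaledBump_eq_one hy.le

theorem scaledBump_eventuallyEq_zero {s : ℝ} {x : Rn n} (h : 2 < |s| * ‖x‖) :
    scaledBump n s =ᶠ[𝓝 x] fun _ => 0 := by
  have : ∀ᶠ y in 𝓝 x, 2 < |s| * ‖y‖ :=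
    continuousAt_const.eventually_lt (continuous_const.mul continuous_norm).continuousAt h
  exact this.mono fun y hy => scaledBump_eq_zero hy.le

theorem hasCompactSupport_scaledBump {s : ℝ} (hs : s ≠ 0) : HasCompactSupport (scaledBump n s) :=
  HasCompactSupport.intro (isCompact_closedBall (0 : Rn n) (2 / |s|)) fun x hx => by
    refine scaledBump_eq_zero ?_
    simp only [mem_closedBall_zero_iff, not_le, div_lt_iff₀ (abs_pos.mpr hs)] at hx
    linarith

theorem pderiv_comp_smul {f : Rn n → ℝ} (hf : ContDiff ℝ 1 f) (s : ℝ) (j : Fin n) (x : Rn n) :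
    pderiv j (fun y => f (s • y)) x = s * pderiv j f (s • x) := by
  have h1 := (hf.differentiable one_ne_zero (s • x)).hasFDerivAt.comp x
    ((hasFDerivAt_id x).const_smul s)
  have h2 : fderiv ℝ (fun y => f (s • y)) x = _ := h1.fderiv
  simp only [pderiv]
  rw [h2]
  simp

theorem pderiv_scaledBump (s : ℝ) (j : Fin n) (x : Rn n) :
    pderiv j (scaledBump n s) x = s * pderiv j (unitBump n) (s • x) :=
  pderiv_comp_smul ((unitBump n).contDiff) s j x

theorem pderiv_pderiv_scaledBump (s : ℝ) (i j : Fin n) (x : Rn n) :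
    pderiv i (pderiv j (scaledBump n s)) x = s * (s * pderiv i (pderiv j (unitBump n)) (s • x)) := by
  have h : pderiv j (scaledBump n s) = fun x => s * pderiv j (unitBump n) (s • x) := by
    ext y
    exact pderiv_scaledBump s j y
  have hb : ContDiff ℝ 1 (pderiv j (unitBump n)) :=
    ((unitBump n).contDiff (n := ⊤)).contDiff_pderiv (by norm_cast) j
  rw [h, pderiv_const_mul, pderiv_comp_smul hb]
  exact (hb.comp (contDiff_const_smul s)).differentiable one_ne_zero x

/-- Scale-invariant bounds on the derivatives of the bump functions. -/
theorem exists_scaledBump_bound (n : ℕ) : ∃ C : ℝ, 0 ≤ C ∧ ∀ (s : ℝ) (x : Rn n) (i j : Fin n),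
    |pderiv j (scaledBump n s) x| ≤ C * |s| ∧ |pderiv j (scaledBump n s) x| * ‖x‖ ≤ C ∧
    |pderiv i (pderiv j (scaledBump n s)) x| ≤ C * |s| ^ 2 ∧
    |pderiv i (pderiv j (scaledBump n s)) x| * ‖x‖ ≤ C * |s| := by
  have hb : ContDiff ℝ ∞ (unitBump n) := (unitBump n).contDiff
  have hbc : HasCompactSupport (unitBump n) := (unitBump n).hasCompactSupport
  have h1 : ∀ j, Continuous (pderiv j (unitBump n)) := fun j =>
    (hb.of_le (by simp)).continuous_pderiv j
  have h2 : ∀ i j, Continuous (pderiv i (pderiv j (unitBump n))) := fun i j =>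
    (hb.contDiff_pderiv (m := 1) (by norm_cast) j).continuous_pderiv i
  -- One compactly supported function dominates all first and second derivatives. The weight `1 +
  -- ‖y‖` at `y = s • x` yields the bounds both with and without the factor `‖x‖`.
  let f : Rn n → ℝ := fun y => ∑ i, ∑ j, (|pderiv j (unitBump n) y| * (1 + ‖y‖) +
    |pderiv i (pderiv j (unitBump n)) y| * (1 + ‖y‖))
  have hf : Continuous f := continuous_finsetSum _ fun i _ => continuous_finsetSum _ fun j _ =>
    ((h1 j).abs.mul (continuous_const.add continuous_norm)).add
      ((h2 i j).abs.mul (continuous_const.add continuous_norm))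
  have hfc : HasCompactSupport f := HasCompactSupport.intro hbc fun y hy => by
    refine Finset.sum_eq_zero fun i _ => Finset.sum_eq_zero fun j _ => ?_
    rw [pderiv_of_notMem_tsupport hy,
      pderiv_of_notMem_tsupport fun h => hy (tsupport_pderiv_subset _ j h)]
    simp
  obtain ⟨C, hC⟩ := hf.bounded_above_of_compact_support hfc
  refine ⟨C, (norm_nonneg _).trans (hC 0), fun s x i j => ?_⟩
  have hCy : ∀ y, |pderiv j (unitBump n) y| * (1 + ‖y‖) +
      |pderiv i (pderiv j (unitBump n)) y| * (1 + ‖y‖) ≤ C := fun y => by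
    refine le_trans ?_ ((le_abs_self _).trans (hC y))
    refine le_trans ?_ (Finset.single_le_sum (f := fun i => ∑ j,
      (|pderiv j (unitBump n) y| * (1 + ‖y‖) + |pderiv i (pderiv j (unitBump n)) y| * (1 + ‖y‖)))
      (fun i _ => Finset.sum_nonneg fun j _ => by positivity) (Finset.mem_univ i))
    exact Finset.single_le_sum (f := fun j => |pderiv j (unitBump n) y| * (1 + ‖y‖) +
      |pderiv i (pderiv j (unitBump n)) y| * (1 + ‖y‖))
      (fun j _ => by positivity) (Finset.mem_univ j)
  have hC' := hCy (s • x)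
  rw [pderiv_scaledBump, pderiv_pderiv_scaledBump]
  simp only [abs_mul]
  rw [norm_smul, Real.norm_eq_abs] at hC'
  set p := |pderiv j (unitBump n) (s • x)|
  set q := |pderiv i (pderiv j (unitBump n)) (s • x)|
  have hp : 0 ≤ p := abs_nonneg _
  have hq : 0 ≤ q := abs_nonneg _
  have hs : 0 ≤ |s| := abs_nonneg s
  have hx : 0 ≤ ‖x‖ := norm_nonneg x
  have e1 : 0 ≤ p * (|s| * ‖x‖) := by positivity
  have e2 : 0 ≤ q * (|s| * ‖x‖) := by positivity
  refine ⟨?_, ?_, ?_, ?_⟩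
  · have : p ≤ C := by nlinarith
    nlinarith
  · nlinarith
  · have : q ≤ C := by nlinarith
    have h3 : |s| ^ 2 * q ≤ |s| ^ 2 * C := by gcongr
    nlinarith
  · have : q * (|s| * ‖x‖) ≤ C := by nlinarith
    have h3 : |s| * (q * (|s| * ‖x‖)) ≤ |s| * C := by gcongr
    nlinarith

/-- Dominated convergence. The origin is a null set in positive dimension, so convergence of the
coefficients off the origin is enough. -/
theorem tendsto_integral_coeff (hn : n ≠ 0) {F : Rn n → ℂ} (hF : Integrable F volume)
    {c : ℕ → Rn n → ℝ} {d : Rn n → ℝ} (hc : ∀ k, Continuous (c k)) {C : ℝ}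
    (hC : ∀ k x, |c k x| ≤ C) (hlim : ∀ x ≠ 0, Tendsto (fun k => c k x) atTop (𝓝 (d x))) :
    Tendsto (fun k => ∫ x, (c k x : ℂ) * F x) atTop (𝓝 (∫ x, (d x : ℂ) * F x)) := by
  have : Nonempty (Fin n) := ⟨⟨0, Nat.pos_of_ne_zero hn⟩⟩
  refine tendsto_integral_of_dominated_convergence (fun x => C * ‖F x‖)
    (fun k => (Complex.continuous_ofReal.comp (hc k)).aestronglyMeasurable.mul hF.1)
    (hF.norm.const_mul C) (fun k => Eventually.of_forall fun x => ?_) ?_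
  · rw [norm_mul, Complex.norm_real]
    gcongr
    exact hC k x
  · have : ∀ᵐ x ∂(volume : Measure (Rn n)), x ≠ 0 := compl_mem_ae_iff.mpr (measure_singleton 0)
    filter_upwards [this] with x hx
    exact ((Complex.continuous_ofReal.tendsto _).comp (hlim x hx)).mul tendsto_const_nhds

/-- Cutting off a neighbourhood of the origin of radius `~ 1/k`. -/
noncomputable def cutOrigin (k : ℕ) (Z : Rn n → ℝ) (x : Rn n) : ℝ :=
  (1 - scaledBump n (k + 1) x) * Z x

theorem contDiff_cutOrigin (k : ℕ) {Z : Rn n → ℝ} (hZ : ContDiff ℝ 1 Z) :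
    ContDiff ℝ 1 (cutOrigin k Z) :=
  (contDiff_const.sub ((contDiff_scaledBump _).of_le (by simp))).mul hZ

theorem HasCompactSupport.cutOrigin {Z : Rn n → ℝ} (hc : HasCompactSupport Z) (k : ℕ) :
    HasCompactSupport (cutOrigin k Z) := hc.mul_left

theorem zero_notMem_tsupport_cutOrigin (k : ℕ) (Z : Rn n → ℝ) :
    (0 : Rn n) ∉ tsupport (cutOrigin k Z) := by
  rw [notMem_tsupport_iff_eventuallyEq]
  have h := scaledBump_eventuallyEq_one (n := n) (s := (k + 1 : ℝ)) (x := 0) (by simp)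
  filter_upwards [h] with y hy
  simp [_root_.cutOrigin, hy]

theorem abs_cutOrigin_le (k : ℕ) (Z : Rn n → ℝ) (x : Rn n) : |cutOrigin k Z x| ≤ |Z x| := by
  rw [cutOrigin, abs_mul]
  have h1 := scaledBump_nonneg (n := n) (k + 1) x
  have h2 := scaledBump_le_one (n := n) (k + 1) x
  have : |1 - scaledBump n (k + 1) x| ≤ 1 := by
    rw [abs_le]
    constructor <;> linarith
  nlinarith [abs_nonneg (Z x)]

theorem eventually_scaledBump_eq_zero {x : Rn n} (hx : x ≠ 0) :
    ∀ᶠ k : ℕ in atTop, scaledBump n (k + 1) =ᶠ[𝓝 x] fun _ => 0 := by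
  have hx' : 0 < ‖x‖ := norm_pos_iff.mpr hx
  have : ∀ᶠ k : ℕ in atTop, 2 / ‖x‖ < k := tendsto_natCast_atTop_atTop.eventually_gt_atTop _
  filter_upwards [this] with k hk
  refine scaledBump_eventuallyEq_zero ?_
  rw [div_lt_iff₀ hx'] at hk
  rw [abs_of_nonneg (by positivity)]
  nlinarith

theorem tendsto_cutOrigin (Z : Rn n → ℝ) {x : Rn n} (hx : x ≠ 0) :
    Tendsto (fun k => cutOrigin k Z x) atTop (𝓝 (Z x)) := by
  refine tendsto_const_nhds.congr' ?_
  filter_upwards [eventually_scaledBump_eq_zero hx] with k hk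
  simp [cutOrigin, hk.eq_of_nhds]

theorem tendsto_pderiv_cutOrigin (Z : Rn n → ℝ) (j : Fin n) {x : Rn n} (hx : x ≠ 0) :
    Tendsto (fun k => pderiv j (cutOrigin k Z) x) atTop (𝓝 (pderiv j Z x)) := by
  refine tendsto_const_nhds.congr' ?_
  filter_upwards [eventually_scaledBump_eq_zero hx] with k hk
  refine (Filter.EventuallyEq.pderiv_eq ?_ j).symm
  filter_upwards [hk] with y hy
  simp [cutOrigin, hy]

/-- The derivative of the cut-off is of size `1/‖x‖`, while `Z` is Lipschitz and vanishes at the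
origin, so `|Z| ≤ L‖x‖` compensates for it uniformly in `k`. -/
theorem exists_bound_pderiv_cutOrigin {Z : Rn n → ℝ} (hZ : ContDiff ℝ 1 Z)
    (hc : HasCompactSupport Z) (h0 : Z 0 = 0) (j : Fin n) :
    ∃ C, ∀ k x, |pderiv j (cutOrigin k Z) x| ≤ C := by
  obtain ⟨L, hL⟩ := hZ.lipschitzWith_of_hasCompactSupport hc one_ne_zero
  obtain ⟨C, hC0, hC⟩ := exists_scaledBump_bound n
  obtain ⟨D, hD⟩ := (hZ.continuous_pderiv j).bounded_above_of_compact_support (hc.pderiv j)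
  have hZx : ∀ x, |Z x| ≤ L * ‖x‖ := fun x => by
    have := hL.dist_le_mul x 0
    simpa [h0, Real.dist_eq] using this
  refine ⟨C * L + D, fun k x => ?_⟩
  have hs := (contDiff_scaledBump (n := n) (k + 1)).differentiable (by simp) x
  have e : pderiv j (cutOrigin k Z) x =
      -pderiv j (scaledBump n (k + 1)) x * Z x + (1 - scaledBump n (k + 1) x) * pderiv j Z x := by
    unfold cutOrigin
    have hd : DifferentiableAt ℝ (fun y => 1 - scaledBump n (k + 1) y) x :=
      (differentiableAt_const _).sub hs
    rw [pderiv_mul hd (hZ.differentiable one_ne_zero x),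
      pderiv_sub (differentiableAt_const _) hs]
    simp [pderiv]
  rw [e]
  refine (abs_add_le _ _).trans (add_le_add ?_ ?_)
  · rw [abs_mul, abs_neg]
    calc _ ≤ |pderiv j (scaledBump n (k + 1)) x| * (L * ‖x‖) := by gcongr; exact hZx x
      _ = (|pderiv j (scaledBump n (k + 1)) x| * ‖x‖) * L := by ring
      _ ≤ C * L := by gcongr; exact (hC _ x j j).2.1
  · refine (abs_cutOrigin_le k (pderiv j Z) x).trans (hD x)

end Cutoff

/-! ### Integration by parts across the origin. -/

section IntegrationByParts

open Filter Topology

variable {n : ℕ} {A : Rn n → Rn n}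

/-- Integration by parts in the form domain against a multiplier vanishing at the origin. -/
theorem HasMagneticGradient.integral_parts (hn : n ≠ 0) (hA : LocallySquareIntegrable A)
    (hA1 : ContDiffOn ℝ 1 A {0}ᶜ) {u v : L2 n} {G Γ : Fin n → L2 n}
    (hu : HasMagneticGradient A u G) (hv : HasMagneticGradient A v Γ) (j : Fin n)
    {Z : Rn n → ℝ} (hZ : ContDiff ℝ 1 Z) (hc : HasCompactSupport Z) (h0 : Z 0 = 0) :
    (∫ x, (Z x : ℂ) * (conj (v x) * G j x)) + ∫ x, (Z x : ℂ) * (conj (Γ j x) * u x) =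
      -∫ x, ((pderiv j Z x : ℝ) : ℂ) * (conj (v x) * u x) := by
  obtain ⟨C, hC⟩ := hZ.continuous.bounded_above_of_compact_support hc
  obtain ⟨D, hD⟩ := exists_bound_pderiv_cutOrigin hZ hc h0 j
  have hcont := fun k => (contDiff_cutOrigin k hZ).continuous
  have hb : ∀ k x, |cutOrigin k Z x| ≤ C := fun k x => (abs_cutOrigin_le k Z x).trans (hC x)
  have t1 := tendsto_integral_coeff hn (integrable_conj_mul v (G j)) hcont hb
    (fun x hx => tendsto_cutOrigin Z hx)
  have t2 := tendsto_integral_coeff hn (integrable_conj_mul (Γ j) u) hcont hb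
    (fun x hx => tendsto_cutOrigin Z hx)
  have t3 := tendsto_integral_coeff hn (integrable_conj_mul v u)
    (fun k => (contDiff_cutOrigin k hZ).continuous_pderiv j) hD
    (fun x hx => tendsto_pderiv_cutOrigin Z j hx)
  refine tendsto_nhds_unique (t1.add t2) (t3.neg.congr fun k => ?_)
  exact (hu.integral_parts_of_notMem hA hA1 hv j (contDiff_cutOrigin k hZ) (hc.cutOrigin k)
    (zero_notMem_tsupport_cutOrigin k Z)).symm

end IntegrationByParts

/-! ### The virial identity for smooth functions. -/

section VirialIdentity

open Filter Topology

variable {n : ℕ} {A : Rn n → Rn n}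

/-- The classical magnetic derivative `∂ⱼ w - i Aⱼ w`. -/
noncomputable def magDeriv (A : Rn n → Rn n) (w : Rn n → ℂ) (j : Fin n) (x : Rn n) : ℂ :=
  pderiv j w x - Complex.I * A x j * w x

/-- The `j`-th term of the classical expression `-∇_A² w`, expanded. -/
noncomputable def magLaplaceTerm (A : Rn n → Rn n) (w : Rn n → ℂ) (j : Fin n) (x : Rn n) : ℂ :=
  -pderiv j (pderiv j w) x + 2 * Complex.I * A x j * pderiv j w x +
    Complex.I * pderiv j (fun y => A y j) x * w x + A x j * A x j * w x

theorem contDiffAt_magDeriv (hA1 : ContDiffOn ℝ 1 A {0}ᶜ) {w : Rn n → ℂ} (hw : ContDiff ℝ ∞ w)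
    (j : Fin n) {x : Rn n} (hx : x ≠ 0) : ContDiffAt ℝ 1 (magDeriv A w j) x :=
  ((hw.contDiff_pderiv (by norm_cast) j).contDiffAt).sub
    ((contDiffAt_const.mul (Complex.ofRealCLM.contDiff.contDiffAt.comp x
      (contDiffAt_component hA1 j hx))).mul (hw.of_le (by simp)).contDiffAt)

theorem pderiv_magDeriv (hA1 : ContDiffOn ℝ 1 A {0}ᶜ) {w : Rn n → ℂ} (hw : ContDiff ℝ ∞ w)
    (i j : Fin n) {x : Rn n} (hx : x ≠ 0) : pderiv i (magDeriv A w j) x =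
      pderiv i (pderiv j w) x - Complex.I * (pderiv i (fun y => A y j) x * w x +
        A x j * pderiv i w x) := by
  have hd := (contDiffAt_component hA1 j hx).differentiableAt one_ne_zero
  have hd' : DifferentiableAt ℝ (fun y => (A y j : ℂ)) x :=
    Complex.ofRealCLM.differentiableAt.comp x hd
  have hwd := hw.differentiable (by simp) x
  have h2 : DifferentiableAt ℝ (pderiv j w) x :=
    (hw.contDiff_pderiv (m := 1) (by norm_cast) j).differentiable one_ne_zero x
  have e : magDeriv A w j = fun y => pderiv j w y - Complex.I * ((A y j : ℂ) * w y) := by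
    ext y
    rw [magDeriv, mul_assoc]
  have hm : DifferentiableAt ℝ (fun y => (A y j : ℂ) * w y) x := hd'.mul hwd
  rw [e, pderiv_sub h2 (hm.const_mul _), pderiv_const_mul _ hm, pderiv_mul hd' hwd,
    pderiv_ofReal hd]

/-- The pointwise core of the virial identity. Here `p = Dⱼw`, `q = Dₖw`, `y = Yₖ`, `α = Aⱼ`, `β =
Aₖ` and `b = Bₖⱼ`; the other letters are derivatives of these. The hypothesis is the commutator
relation `DⱼDₖw = DₖDⱼw - i Bₖⱼ w`. -/
theorem virial_algebra (y yj yk α β b : ℝ) (p q pj pk qj w : ℂ)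
    (h : qj = pk - Complex.I * b * w - Complex.I * β * p + Complex.I * α * q) :
    (2 * (conj (-(pj - Complex.I * α * p)) * (y * q))
      - (-2 * (yj * (conj p * q) + y * (conj pj * q + conj p * qj))
        + (yk * (conj p * p) + y * (conj pk * p + conj p * pk)))
      + conj p * (yk * p) - 2 * (conj p * (yj * q))
      + 2 * Complex.I * (conj p * (y * b * w))).re = 0 := by
  subst h
  simp only [map_neg, map_sub, map_mul, Complex.conj_I, Complex.conj_ofReal, Complex.add_re,
    Complex.sub_re, Complex.mul_re, Complex.neg_re, Complex.add_im, Complex.sub_im, Complex.mul_im,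
    Complex.neg_im, Complex.conj_re, Complex.conj_im, Complex.I_re, Complex.I_im,
    Complex.ofReal_re, Complex.ofReal_im, Complex.re_ofNat, Complex.im_ofNat]
  ring

/-- One `Dⱼ` of `-Dⱼ²w` is moved onto `Y Dₖw` and commuted past `Dₖ`, which produces the field. The
remaining `2 Re (conj(Dⱼw) DₖDⱼw)` is `∂ₖ|Dⱼw|²`, integrated by parts once more. -/
theorem virial_smooth_component (hA1 : ContDiffOn ℝ 1 A {0}ᶜ) {w : Rn n → ℂ}
    (hw : ContDiff ℝ ∞ w) (j k : Fin n) {Y : Rn n → ℝ} (hY : ContDiff ℝ 1 Y)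
    {K : Set (Rn n)} (hK : IsCompact K) (h0 : (0 : Rn n) ∉ K) (hYK : tsupport Y ⊆ K) :
    2 * (∫ x in K, conj (magLaplaceTerm A w j x) * (Y x * magDeriv A w k x)).re =
      -(∫ x in K, conj (magDeriv A w j x) *
          (((pderiv k Y x : ℝ) : ℂ) * magDeriv A w j x)).re +
      2 * (∫ x in K, conj (magDeriv A w j x) *
          (((pderiv j Y x : ℝ) : ℂ) * magDeriv A w k x)).re +
      2 * (∫ x in K, conj (magDeriv A w j x) *
          (Y x * ((magneticField A x k j : ℝ) : ℂ) * w x)).im := by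
  have hKm := hK.isClosed.measurableSet
  have hne : ∀ x ∈ K, x ≠ 0 := fun x hx h => h0 (h ▸ hx)
  have hYC : ContDiff ℝ 1 fun x => (Y x : ℂ) := Complex.ofRealCLM.contDiff.comp hY
  have hw1 : ContDiff ℝ 1 w := hw.of_le (by simp)
  have hac : ∀ i, ContinuousOn (magDeriv A w i) K := fun i x hx =>
    (contDiffAt_magDeriv hA1 hw i (hne x hx)).continuousAt.continuousWithinAt
  have hcac : ∀ i, ContinuousOn (fun x => conj (magDeriv A w i x)) K := fun i =>
    Complex.continuous_conj.comp_continuousOn (hac i)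
  have hAc := continuousOn_component hA1 h0
  have hdAc := continuousOn_pderiv_component hA1 h0
  have hHc : ContinuousOn (fun x => conj (magLaplaceTerm A w j x)) K := by
    refine Complex.continuous_conj.comp_continuousOn ?_
    have c2 := ((hw.contDiff_pderiv (m := 1) (by norm_cast) j).continuous_pderiv j)
    exact ((c2.neg.continuousOn.add ((continuousOn_const.mul (hAc j)).mul
      (hw1.continuous_pderiv j).continuousOn)).add ((continuousOn_const.mul (hdAc j j)).mul
        hw.continuous.continuousOn)).add (((hAc j).mul (hAc j)).mul hw.continuous.continuousOn)
  have hBc : ContinuousOn (fun x => ((magneticField A x k j : ℝ) : ℂ)) K := by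
    have := (hdAc j k).sub (hdAc k j)
    refine this.congr fun x _ => ?_
    simp [magneticField]
  have hdY : ∀ i, Continuous fun x => ((pderiv i Y x : ℝ) : ℂ) := fun i =>
    Complex.continuous_ofReal.comp (hY.continuous_pderiv i)
  have hprod : ∀ i, ContDiff ℝ 1 fun x => (Y x : ℂ) * (conj (magDeriv A w j x) * magDeriv A w i x) :=
    fun i => contDiff_of_forall_mem_tsupport fun x hx => by
      have hx0 := hne x (hYK (closure_mono (fun y hy => by
        simp only [Function.mem_support] at hy ⊢
        intro h
        exact hy (by simp [h])) hx))
      exact hYC.contDiffAt.mul ((Complex.conjCLE.contDiff.contDiffAt.comp x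
        (contDiffAt_magDeriv hA1 hw j hx0)).mul (contDiffAt_magDeriv hA1 hw i hx0))
  have hYcs : HasCompactSupport Y := hK.of_isClosed_subset (isClosed_tsupport _) hYK
  have hYCcs : HasCompactSupport fun x => (Y x : ℂ) :=
    hYcs.comp_left (g := fun r : ℝ => (r : ℂ)) Complex.ofReal_zero
  -- The boundary terms are exact derivatives of compactly supported functions, smooth because `Y`
  -- is supported away from the origin.
  have hzero : ∀ i l, ∫ x in K, pderiv l
      (fun y => (Y y : ℂ) * (conj (magDeriv A w j y) * magDeriv A w i y)) x = 0 := by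
    intro i l
    rw [setIntegral_eq_integral_of_forall_compl_eq_zero,
      integral_pderiv_eq_zero (hprod i) hYCcs.mul_right]
    intro x hx
    refine pderiv_of_notMem_tsupport (fun h => hx (hYK ?_)) l
    refine closure_mono (fun y hy => ?_) h
    simp only [Function.mem_support] at hy ⊢
    intro h
    exact hy (by simp [h])
  have hpd : ∀ i l, ∀ x ∈ K, pderiv l
      (fun y => (Y y : ℂ) * (conj (magDeriv A w j y) * magDeriv A w i y)) x =
      ((pderiv l Y x : ℝ) : ℂ) * (conj (magDeriv A w j x) * magDeriv A w i x) +
        Y x * (conj (pderiv l (magDeriv A w j) x) * magDeriv A w i x +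
          conj (magDeriv A w j x) * pderiv l (magDeriv A w i) x) := by
    intro i l x hx
    have da := fun i => (contDiffAt_magDeriv hA1 hw i (hne x hx)).differentiableAt one_ne_zero
    have dc : DifferentiableAt ℝ (fun y => conj (magDeriv A w j y)) x :=
      Complex.conjCLE.differentiableAt.comp x (da j)
    have dm : DifferentiableAt ℝ (fun y => conj (magDeriv A w j y) * magDeriv A w i y) x :=
      dc.mul (da i)
    rw [pderiv_mul (hYC.differentiable one_ne_zero x) dm,
      pderiv_ofReal (hY.differentiable one_ne_zero x), pderiv_mul dc (da i), pderiv_conj (da j)]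
  -- integrability of the terms
  have hint : ∀ {F : Rn n → ℂ}, ContinuousOn F K → IntegrableOn F K volume := fun hF =>
    hF.integrableOn_compact hK
  let f1 : Rn n → ℂ := fun x => 2 * (conj (magLaplaceTerm A w j x) * (Y x * magDeriv A w k x))
  let f2 : Rn n → ℂ := fun x =>
    conj (magDeriv A w j x) * (((pderiv k Y x : ℝ) : ℂ) * magDeriv A w j x)
  let f3 : Rn n → ℂ := fun x =>
    2 * (conj (magDeriv A w j x) * (((pderiv j Y x : ℝ) : ℂ) * magDeriv A w k x))
  let f4 : Rn n → ℂ := fun x => 2 * Complex.I * (conj (magDeriv A w j x) *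
    (Y x * ((magneticField A x k j : ℝ) : ℂ) * w x))
  let f5 : Rn n → ℂ := fun x =>
    -2 * pderiv j (fun y => (Y y : ℂ) * (conj (magDeriv A w j y) * magDeriv A w k y)) x
  let f6 : Rn n → ℂ :=
    pderiv k (fun y => (Y y : ℂ) * (conj (magDeriv A w j y) * magDeriv A w j y))
  have i1 : Integrable f1 (volume.restrict K) :=
    (hint (hHc.mul (hYC.continuous.continuousOn.mul (hac k)))).const_mul 2
  have i2 : Integrable f2 (volume.restrict K) :=
    hint ((hcac j).mul ((hdY k).continuousOn.mul (hac j)))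
  have i3 : Integrable f3 (volume.restrict K) :=
    (hint ((hcac j).mul ((hdY j).continuousOn.mul (hac k)))).const_mul 2
  have i4 : Integrable f4 (volume.restrict K) :=
    (hint ((hcac j).mul ((hYC.continuous.continuousOn.mul hBc).mul
      hw.continuous.continuousOn))).const_mul (2 * Complex.I)
  have i5 : Integrable f5 (volume.restrict K) :=
    ((hint ((hprod k).continuous_pderiv j).continuousOn)).const_mul (-2)
  have i6 : Integrable f6 (volume.restrict K) :=
    hint ((hprod j).continuous_pderiv k).continuousOn
  have hpt : ∀ x ∈ K, ((f1 - (f5 + f6) + f2 - f3 + f4) x).re = 0 := by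
    intro x hx
    have hx0 := hne x hx
    simp only [Pi.add_apply, Pi.sub_apply, f1, f2, f3, f4, f5, f6]
    rw [hpd k j x hx, hpd j k x hx]
    -- Recognizes the expanded expression as `-Dⱼ(Dⱼw)`.
    have hH : magLaplaceTerm A w j x =
        -(pderiv j (magDeriv A w j) x - Complex.I * A x j * magDeriv A w j x) := by
      rw [pderiv_magDeriv hA1 hw j j hx0, magLaplaceTerm, magDeriv]
      linear_combination (A x j * A x j * w x) * Complex.I_sq
    rw [hH]
    -- What remains is the commutator relation, a consequence of the symmetry of second partials and
    -- the definition of `B`.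
    refine virial_algebra _ _ _ (A x j) (A x k) _ _ _ _ _ _ _ ?_
    rw [pderiv_magDeriv hA1 hw j k hx0, pderiv_magDeriv hA1 hw k j hx0,
      pderiv_comm (hw.of_le (by norm_cast)) j k]
    simp only [magneticField, Matrix.of_apply, magDeriv]
    push_cast
    ring
  have hI : ∫ x in K, ((f1 - (f5 + f6) + f2 - f3 + f4) x).re = 0 := by
    rw [setIntegral_congr_fun hKm hpt, integral_zero]
  have hre : (∫ x in K, (f1 - (f5 + f6) + f2 - f3 + f4) x).re = 0 := by
    rw [← hI]
    exact (integral_re ((((i1.sub (i5.add i6)).add i2).sub i3).add i4)).symm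
  rw [integral_add' (((i1.sub (i5.add i6)).add i2).sub i3) i4,
    integral_sub' ((i1.sub (i5.add i6)).add i2) i3, integral_add' (i1.sub (i5.add i6)) i2,
    integral_sub' i1 (i5.add i6), integral_add' i5 i6] at hre
  simp only [f1, f3, f4, f5, f6] at hre
  rw [integral_const_mul, integral_const_mul, integral_const_mul, integral_const_mul, hzero,
    hzero] at hre
  simp only [mul_zero, add_zero, sub_zero, Complex.add_re, Complex.sub_re, Complex.mul_re,
    Complex.re_ofNat, Complex.im_ofNat, zero_mul, Complex.I_re, Complex.I_im, Complex.mul_im,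
    mul_one, zero_sub, f2] at hre
  linarith

end VirialIdentity

/-! ### The virial identity on the domain of `H_A`, and the contribution of `V`. -/

section WeakVirialIdentity

open Filter Topology BoundedContinuousFunction

variable {n : ℕ} {A : Rn n → Rn n}

/-- The density `∑ⱼₖ Yₖ Bₖⱼ conj (∇_A u)ⱼ u`. -/
noncomputable def magneticDensity (A : Rn n → Rn n) (Y : Fin n → Rn n → ℝ) (u : L2 n)
    (G : Fin n → L2 n) (x : Rn n) : ℂ :=
  ∑ j, ∑ k, (Y k x : ℂ) * ((magneticField A x k j : ℝ) : ℂ) * (conj (G j x) * u x)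

/-- The density `(Y · ∇V) |u|²`. -/
noncomputable def electricDensity (V : Rn n → ℝ) (Y : Fin n → Rn n → ℝ) (u : L2 n)
    (x : Rn n) : ℂ :=
  ((∑ k, Y k x * pderiv k V x : ℝ) : ℂ) * (conj (u x) * u x)

/-- Every term of the classical identity is a pairing of `w`, its magnetic derivatives and its
magnetic Laplacian with coefficients continuous on a compact set off the origin, so it survives `L²`
limits. -/
theorem HasMagneticGradient.virial_of_notMem (hA : LocallySquareIntegrable A)
    (hA1 : ContDiffOn ℝ 1 A {0}ᶜ) {u g : L2 n} {G : Fin n → L2 n}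
    (h : HasMagneticGradient A u G) (hg : HasFormValue A G g) {Y : Fin n → Rn n → ℝ}
    (hY : ∀ k, ContDiff ℝ 1 (Y k)) (hc : ∀ k, HasCompactSupport (Y k))
    (h0 : ∀ k, (0 : Rn n) ∉ tsupport (Y k)) :
    2 * ∑ k, (∫ x, (Y k x : ℂ) * (conj (g x) * G k x)).re =
      (∑ j, ∑ k, (-(∫ x, ((pderiv k (Y k) x : ℝ) : ℂ) * (conj (G j x) * G j x)).re +
        2 * (∫ x, ((pderiv j (Y k) x : ℝ) : ℂ) * (conj (G j x) * G k x)).re)) +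
      2 * (∫ x, magneticDensity A Y u G x).im := by
  set K : Set (Rn n) := ⋃ k, tsupport (Y k) with hKdef
  have hK : IsCompact K := isCompact_iUnion fun k => hc k
  have h0K : (0 : Rn n) ∉ K := by simpa [hKdef] using h0
  have hYK : ∀ k, tsupport (Y k) ⊆ K := fun k => Set.subset_iUnion (fun k => tsupport (Y k)) k
  have hKm := hK.isClosed.measurableSet
  have hAc := continuousOn_component hA1 h0K
  have hdAc := continuousOn_pderiv_component hA1 h0K
  have hL : ∀ v : L2 n, MemLp (fun x => v x) 2 (volume.restrict K) := fun v =>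
    (Lp.memLp v).restrict K
  obtain ⟨w, hw, hw0, hw1, hw2⟩ := h.exists_tendstoL2 hA hA1 hK h0K
  have ta : ∀ j, TendstoL2 (volume.restrict K) (fun m => magDeriv A (w m) j) (fun x => G j x) := by
    intro j
    have := (hw1 j).add (hw0.mul_left hK (b := fun x => -(Complex.I * A x j))
      (continuousOn_const.mul (hAc j)).neg)
    convert this using 1
    · ext m x
      simp only [magDeriv]
      ring
    · ext x
      ring
  -- The approximation controls the Laplacian but not the individual second derivatives, so the
  -- classical identities are summed over `j` before the limit is taken.
  have tH : TendstoL2 (volume.restrict K) (fun m x => ∑ j, magLaplaceTerm A (w m) j x)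
      (fun x => g x) := by
    have t1 := (hw2 g hg).mul_left hK (b := fun _ => -1) continuousOn_const
    have t2 : ∀ j ∈ Finset.univ, _ := fun (j : Fin n) _ =>
      (((hw1 j).mul_left hK (b := fun x => 2 * Complex.I * A x j)
      (continuousOn_const.mul (hAc j))).add (hw0.mul_left hK
        (b := fun x => Complex.I * pderiv j (fun y => A y j) x)
        (continuousOn_const.mul (hdAc j j)))).add
      (hw0.mul_left hK (b := fun x => A x j * A x j) ((hAc j).mul (hAc j)))
    have := t1.add (TendstoL2.sum t2)
    convert this using 1
    · ext m x
      simp only [magLaplaceTerm, neg_one_mul, ← Finset.sum_neg_distrib, ← Finset.sum_add_distrib]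
      refine Finset.sum_congr rfl fun j _ => ?_
      ring
    · ext x
      simp only [laplacianOf, neg_one_mul, neg_add, neg_neg, ← Finset.sum_neg_distrib, add_assoc,
        ← Finset.sum_add_distrib]
      rw [left_eq_add]
      refine Finset.sum_eq_zero fun j _ => ?_
      linear_combination (2 * A x j * A x j * u x) * Complex.I_sq
  have hYc : ∀ k, ContinuousOn (fun x => (Y k x : ℂ)) K := fun k =>
    (Complex.continuous_ofReal.comp (hY k).continuous).continuousOn
  have hdYc : ∀ j k, ContinuousOn (fun x => ((pderiv j (Y k) x : ℝ) : ℂ)) K := fun j k =>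
    (Complex.continuous_ofReal.comp ((hY k).continuous_pderiv j)).continuousOn
  have hBc : ∀ k j, ContinuousOn (fun x => ((magneticField A x k j : ℝ) : ℂ)) K := fun k j => by
    refine ((hdAc j k).sub (hdAc k j)).congr fun x _ => ?_
    simp [magneticField]
  -- the classical identity for the approximations
  have key : ∀ m, 2 * ∑ k, (∫ x in K, conj (∑ j, magLaplaceTerm A (w m) j x) *
      (Y k x * magDeriv A (w m) k x)).re =
      ∑ j, ∑ k, (-(∫ x in K, conj (magDeriv A (w m) j x) *
          (((pderiv k (Y k) x : ℝ) : ℂ) * magDeriv A (w m) j x)).re +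
        2 * (∫ x in K, conj (magDeriv A (w m) j x) *
          (((pderiv j (Y k) x : ℝ) : ℂ) * magDeriv A (w m) k x)).re +
        2 * (∫ x in K, conj (magDeriv A (w m) j x) *
          (Y k x * ((magneticField A x k j : ℝ) : ℂ) * w m x)).im) := by
    intro m
    have hHc : ∀ j, MemLp (magLaplaceTerm A (w m) j) 2 (volume.restrict K) := fun j => by
      refine memLp_of_continuousOn hK ?_
      have c2 := (((hw m).contDiff_pderiv (m := 1) (by norm_cast) j).continuous_pderiv j)
      have c1 := ((hw m).of_le (m := 1) (by simp)).continuous_pderiv j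
      have c0 := (hw m).continuous
      exact ((c2.neg.continuousOn.add ((continuousOn_const.mul (hAc j)).mul
        c1.continuousOn)).add ((continuousOn_const.mul (hdAc j j)).mul
          c0.continuousOn)).add (((hAc j).mul (hAc j)).mul c0.continuousOn)
    have e : ∀ k, ∫ x in K, conj (∑ j, magLaplaceTerm A (w m) j x) *
        (Y k x * magDeriv A (w m) k x) = ∑ j, ∫ x in K, conj (magLaplaceTerm A (w m) j x) *
        (Y k x * magDeriv A (w m) k x) := fun k => by
      rw [← integral_finsetSum]
      · congr 1 with x
        rw [map_sum, Finset.sum_mul]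
      · exact fun j _ => (hHc j).star.integrable_mul
          (memLp_continuousOn_mul hK (hYc k) ((ta k).memLp m))
    simp only [e, Complex.re_sum]
    rw [Finset.sum_comm, Finset.mul_sum]
    refine Finset.sum_congr rfl fun j _ => ?_
    rw [Finset.mul_sum]
    exact Finset.sum_congr rfl fun k _ =>
      virial_smooth_component hA1 (hw m) j k (hY k) hK h0K (hYK k)
  have hre : ∀ {a : ℕ → ℂ} {b : ℂ}, Tendsto a atTop (𝓝 b) →
      Tendsto (fun m => (a m).re) atTop (𝓝 b.re) := fun h => (Complex.continuous_re.tendsto _).comp h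
  have him : ∀ {a : ℕ → ℂ} {b : ℂ}, Tendsto a atTop (𝓝 b) →
      Tendsto (fun m => (a m).im) atTop (𝓝 b.im) := fun h => (Complex.continuous_im.tendsto _).comp h
  have tL := (tendsto_finsetSum Finset.univ fun k _ =>
    hre (tH.tendsto_integral_conj_mul ((ta k).mul_left hK (hYc k)))).const_mul 2
  have tR := tendsto_finsetSum Finset.univ fun j _ => tendsto_finsetSum Finset.univ fun k _ =>
    ((hre ((ta j).tendsto_integral_conj_mul ((ta j).mul_left hK (hdYc k k)))).neg.add
      ((hre ((ta j).tendsto_integral_conj_mul ((ta k).mul_left hK (hdYc j k)))).const_mul 2)).add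
      ((him ((ta j).tendsto_integral_conj_mul (hw0.mul_left hK
        ((hYc k).mul (hBc k j))))).const_mul 2)
  have e := tendsto_nhds_unique (tL.congr key) tR
  have hz : ∀ k, ∀ x ∉ K, Y k x = 0 := fun k x hx =>
    image_eq_zero_of_notMem_tsupport fun h => hx (hYK k h)
  have hdz : ∀ j k, ∀ x ∉ K, pderiv j (Y k) x = 0 := fun j k x hx =>
    pderiv_of_notMem_tsupport (fun h => hx (hYK k h)) j
  have r1 : ∀ k, ∫ x, (Y k x : ℂ) * (conj (g x) * G k x) =
      ∫ x in K, conj (g x) * (Y k x * G k x) := fun k =>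
    integral_eq_setIntegral_of_eqOn hKm (fun x hx => by simp [hz k x hx])
      (fun x _ => mul_left_comm _ _ _)
  have r2 : ∀ i j k l, ∫ x, ((pderiv i (Y k) x : ℝ) : ℂ) * (conj (G j x) * G l x) =
      ∫ x in K, conj (G j x) * (((pderiv i (Y k) x : ℝ) : ℂ) * G l x) := fun i j k l =>
    integral_eq_setIntegral_of_eqOn hKm (fun x hx => by simp [hdz i k x hx])
      (fun x _ => mul_left_comm _ _ _)
  have r3 : ∫ x, magneticDensity A Y u G x = ∑ j, ∑ k, ∫ x in K, conj (G j x) *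
      (Y k x * ((magneticField A x k j : ℝ) : ℂ) * u x) := by
    have hi : ∀ j k, Integrable (fun x => conj (G j x) *
        (Y k x * ((magneticField A x k j : ℝ) : ℂ) * u x)) (volume.restrict K) := fun j k =>
      (hL (G j)).star.integrable_mul (memLp_continuousOn_mul hK ((hYc k).mul (hBc k j)) (hL u))
    simp_rw [← integral_finsetSum _ fun k _ => hi _ k]
    rw [← integral_finsetSum _ fun j _ => integrable_finsetSum _ fun k _ => hi j k]
    refine integral_eq_setIntegral_of_eqOn hKm (fun x hx => ?_) (fun x _ => ?_)
    · exact Finset.sum_eq_zero fun j _ => Finset.sum_eq_zero fun k _ => by simp [hz k x hx]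
    · exact Finset.sum_congr rfl fun j _ => Finset.sum_congr rfl fun k _ => by ring
  simp only [r1, r2, r3, Complex.im_sum, Finset.mul_sum, ← Finset.sum_add_distrib]
  rw [Finset.mul_sum] at e
  exact e

/-- The virial identity for a vector field vanishing at the origin. -/
theorem HasMagneticGradient.virial (hn : n ≠ 0) (hA : LocallySquareIntegrable A)
    (hA1 : ContDiffOn ℝ 1 A {0}ᶜ) {u g : L2 n} {G : Fin n → L2 n}
    (h : HasMagneticGradient A u G) (hg : HasFormValue A G g) {Y : Fin n → Rn n → ℝ}
    (hY : ∀ k, ContDiff ℝ 1 (Y k)) (hc : ∀ k, HasCompactSupport (Y k))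
    (h0 : ∀ k, Y k 0 = 0) (hmag : Integrable (magneticDensity A Y u G) volume) :
    2 * ∑ k, (∫ x, (Y k x : ℂ) * (conj (g x) * G k x)).re =
      (∑ j, ∑ k, (-(∫ x, ((pderiv k (Y k) x : ℝ) : ℂ) * (conj (G j x) * G j x)).re +
        2 * (∫ x, ((pderiv j (Y k) x : ℝ) : ℂ) * (conj (G j x) * G k x)).re)) +
      2 * (∫ x, magneticDensity A Y u G x).im := by
  have hre : ∀ {a : ℕ → ℂ} {b : ℂ}, Tendsto a atTop (𝓝 b) →
      Tendsto (fun m => (a m).re) atTop (𝓝 b.re) := fun h => (Complex.continuous_re.tendsto _).comp h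
  have him : ∀ {a : ℕ → ℂ} {b : ℂ}, Tendsto a atTop (𝓝 b) →
      Tendsto (fun m => (a m).im) atTop (𝓝 b.im) := fun h => (Complex.continuous_im.tendsto _).comp h
  have hY' := fun m k => contDiff_cutOrigin m (hY k)
  have tY : ∀ k {F : Rn n → ℂ}, Integrable F volume →
      Tendsto (fun m => ∫ x, (cutOrigin m (Y k) x : ℂ) * F x) atTop
        (𝓝 (∫ x, (Y k x : ℂ) * F x)) := fun k F hF => by
    obtain ⟨C, hC⟩ := (hY k).continuous.bounded_above_of_compact_support (hc k)
    exact tendsto_integral_coeff hn hF (fun m => (hY' m k).continuous)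
      (fun m x => (abs_cutOrigin_le m (Y k) x).trans (hC x)) (fun x hx => tendsto_cutOrigin _ hx)
  have tdY : ∀ j k {F : Rn n → ℂ}, Integrable F volume →
      Tendsto (fun m => ∫ x, ((pderiv j (cutOrigin m (Y k)) x : ℝ) : ℂ) * F x) atTop
        (𝓝 (∫ x, ((pderiv j (Y k) x : ℝ) : ℂ) * F x)) := fun j k F hF => by
    obtain ⟨D, hD⟩ := exists_bound_pderiv_cutOrigin (hY k) (hc k) (h0 k) j
    exact tendsto_integral_coeff hn hF (fun m => (hY' m k).continuous_pderiv j) hD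
      (fun x hx => tendsto_pderiv_cutOrigin _ j hx)
  -- The density is linear in the field, so the cut-off multiplies the whole density and its assumed
  -- integrability is the dominating bound.
  have tmag : Tendsto (fun m => ∫ x, magneticDensity A (fun k => cutOrigin m (Y k)) u G x) atTop
      (𝓝 (∫ x, magneticDensity A Y u G x)) := by
    have t := tendsto_integral_coeff hn hmag (c := fun m x => cutOrigin m (fun _ => (1 : ℝ)) x)
      (d := fun _ => 1) (C := 1) (fun m => (contDiff_cutOrigin m contDiff_const).continuous)
      (fun m x => (abs_cutOrigin_le m _ x).trans (by simp))
      (fun x hx => tendsto_cutOrigin (fun _ => (1 : ℝ)) hx)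
    simp only [Complex.ofReal_one, one_mul] at t
    refine t.congr fun m => ?_
    congr 1 with x
    simp only [magneticDensity, Finset.mul_sum, cutOrigin, mul_one]
    refine Finset.sum_congr rfl fun j _ => Finset.sum_congr rfl fun k _ => ?_
    push_cast
    ring
  have tL := (tendsto_finsetSum Finset.univ fun k _ =>
    hre (tY k (integrable_conj_mul g (G k)))).const_mul 2
  have tR := (tendsto_finsetSum Finset.univ fun j _ => tendsto_finsetSum Finset.univ fun k _ =>
    ((hre (tdY k k (integrable_conj_mul (G j) (G j)))).neg.add
      ((hre (tdY j k (integrable_conj_mul (G j) (G k)))).const_mul 2))).add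
      ((him tmag).const_mul 2)
  refine tendsto_nhds_unique (tL.congr fun m => ?_) tR
  exact h.virial_of_notMem hA hA1 hg (hY' m) (fun k => (hc k).cutOrigin m)
    (fun k => zero_notMem_tsupport_cutOrigin m (Y k))

/-- The contribution of the electric potential to the virial identity. -/
theorem HasMagneticGradient.virial_potential (hn : n ≠ 0) (hA : LocallySquareIntegrable A)
    (hA1 : ContDiffOn ℝ 1 A {0}ᶜ) {V : Rn n → ℝ} (hV : ContDiffOn ℝ 1 V {0}ᶜ) {u v : L2 n}
    {G : Fin n → L2 n} (h : HasMagneticGradient A u G) (hv : IsPotentialMul V u v)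
    {Y : Fin n → Rn n → ℝ} (hY : ∀ k, ContDiff ℝ 1 (Y k)) (hc : ∀ k, HasCompactSupport (Y k))
    (h0 : ∀ k, Y k 0 = 0) (hel : Integrable (electricDensity V Y u) volume) :
    2 * ∑ k, (∫ x, (Y k x : ℂ) * (conj (v x) * G k x)).re =
      -(∑ k, (∫ x, ((pderiv k (Y k) x : ℝ) : ℂ) * (conj (u x) * v x)).re) -
        (∫ x, electricDensity V Y u x).re := by
  have hre : ∀ {a : ℕ → ℂ} {b : ℂ}, Tendsto a atTop (𝓝 b) →
      Tendsto (fun m => (a m).re) atTop (𝓝 b.re) := fun h => (Complex.continuous_re.tendsto _).comp h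
  have hY' := fun m k => contDiff_cutOrigin m (hY k)
  have hVat : ∀ {x : Rn n}, x ≠ 0 → ContDiffAt ℝ 1 V x := fun hx =>
    hV.contDiffAt (isOpen_compl_singleton.mem_nhds hx)
  have key : ∀ m, 2 * ∑ k, (∫ x, (cutOrigin m (Y k) x : ℂ) * (conj (v x) * G k x)).re =
      -(∑ k, (∫ x, ((pderiv k (cutOrigin m (Y k)) x : ℝ) : ℂ) * (conj (u x) * v x)).re) -
        (∫ x, electricDensity V (fun k => cutOrigin m (Y k)) u x).re := by
    intro m
    have hts : ∀ k, (0 : Rn n) ∉ tsupport (cutOrigin m (Y k)) := fun k =>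
      zero_notMem_tsupport_cutOrigin m (Y k)
    have hne : ∀ k, ∀ x ∈ tsupport (cutOrigin m (Y k)), x ≠ 0 := fun k x hx hx0 =>
      hts k (hx0 ▸ hx)
    have hZ : ∀ k, ContDiff ℝ 1 fun x => V x * cutOrigin m (Y k) x := fun k =>
      contDiff_of_forall_mem_tsupport fun x hx =>
        (hVat (hne k x (tsupport_mul_subset_right hx))).mul (hY' m k).contDiffAt
    have hZc : ∀ k, HasCompactSupport fun x => V x * cutOrigin m (Y k) x := fun k =>
      ((hc k).cutOrigin m).mul_left
    have hZ0 : ∀ k, (0 : Rn n) ∉ tsupport fun x => V x * cutOrigin m (Y k) x := fun k hm =>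
      hts k (tsupport_mul_subset_right hm)
    have hpd : ∀ k x, pderiv k (fun y => V y * cutOrigin m (Y k) y) x =
        cutOrigin m (Y k) x * pderiv k V x + V x * pderiv k (cutOrigin m (Y k)) x := fun k x => by
      by_cases hx : x ∈ tsupport (cutOrigin m (Y k))
      · rw [pderiv_mul ((hVat (hne k x hx)).differentiableAt one_ne_zero)
          ((hY' m k).differentiable one_ne_zero x), mul_comm (pderiv k V x)]
      · rw [pderiv_of_notMem_tsupport hx,
          pderiv_of_notMem_tsupport fun h => hx (tsupport_mul_subset_right h),
          image_eq_zero_of_notMem_tsupport hx]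
        simp
    -- The real part of `2 V ū ∇_A u` is `V ∇|u|²`. The multiplier `V Yₖ`, cut off near the origin,
    -- is `C¹` and moves the derivative onto `V` and `Y`.
    have e := fun k => h.integral_parts_of_notMem hA hA1 h k (hZ k) (hZc k) (hZ0 k)
    have e1 : ∀ k, ∫ x, ((V x * cutOrigin m (Y k) x : ℝ) : ℂ) * (conj (u x) * G k x) =
        ∫ x, (cutOrigin m (Y k) x : ℂ) * (conj (v x) * G k x) := fun k => by
      refine integral_congr_ae (hv.mono fun x hx => ?_)
      simp only [hx, map_mul, Complex.conj_ofReal, Complex.ofReal_mul]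
      ring
    have e2 : ∀ k, ∫ x, ((V x * cutOrigin m (Y k) x : ℝ) : ℂ) * (conj (G k x) * u x) =
        conj (∫ x, (cutOrigin m (Y k) x : ℂ) * (conj (v x) * G k x)) := fun k => by
      rw [← integral_conj]
      refine integral_congr_ae (hv.mono fun x hx => ?_)
      simp only [hx, map_mul, Complex.conj_ofReal, Complex.ofReal_mul, Complex.conj_conj]
      ring
    have iel : ∀ k, Integrable (fun x => ((cutOrigin m (Y k) x * pderiv k V x : ℝ) : ℂ) *
        (conj (u x) * u x)) volume := fun k => by
      have hcts : Continuous fun x => cutOrigin m (Y k) x * pderiv k V x := by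
        have : ContDiff ℝ 0 fun x => cutOrigin m (Y k) x * pderiv k V x :=
          contDiff_of_forall_mem_tsupport fun x hx =>
            ((hY' m k).of_le (by simp)).contDiffAt.mul
              ((hVat (hne k x (tsupport_mul_subset_left hx))).contDiffAt_pderiv (by simp) k)
        exact this.continuous
      exact integrable_bdd_mul_conj_mul
        (toBddOfCompact _ hcts ((hc k).cutOrigin m).mul_right) u u
    have idiv : ∀ k, Integrable (fun x => ((pderiv k (cutOrigin m (Y k)) x : ℝ) : ℂ) *
        (conj (u x) * v x)) volume := fun k =>
      integrable_bdd_mul_conj_mul (toBddOfCompact _ ((hY' m k).continuous_pderiv k)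
        (((hc k).cutOrigin m).pderiv k)) u v
    have e3 : ∀ k, ∫ x, ((pderiv k (fun y => V y * cutOrigin m (Y k) y) x : ℝ) : ℂ) *
        (conj (u x) * u x) = (∫ x, ((cutOrigin m (Y k) x * pderiv k V x : ℝ) : ℂ) *
        (conj (u x) * u x)) + ∫ x, ((pderiv k (cutOrigin m (Y k)) x : ℝ) : ℂ) *
          (conj (u x) * v x) := fun k => by
      rw [← integral_add (iel k) (idiv k)]
      refine integral_congr_ae (hv.mono fun x hx => ?_)
      simp only [hpd, hx]
      push_cast
      ring
    have e4 : ∫ x, electricDensity V (fun k => cutOrigin m (Y k)) u x =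
        ∑ k, ∫ x, ((cutOrigin m (Y k) x * pderiv k V x : ℝ) : ℂ) * (conj (u x) * u x) := by
      rw [← integral_finsetSum _ fun k _ => iel k]
      congr 1 with x
      simp only [electricDensity, Complex.ofReal_sum, Finset.sum_mul]
    have e5 : ∀ k, 2 * (∫ x, (cutOrigin m (Y k) x : ℂ) * (conj (v x) * G k x)).re =
        -(∫ x, ((cutOrigin m (Y k) x * pderiv k V x : ℝ) : ℂ) * (conj (u x) * u x)).re -
        (∫ x, ((pderiv k (cutOrigin m (Y k)) x : ℝ) : ℂ) * (conj (u x) * v x)).re := fun k => by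
      have := congrArg Complex.re (e k)
      rw [e1, e2, e3] at this
      simp only [Complex.add_re, Complex.conj_re, Complex.neg_re] at this
      linarith
    rw [Finset.mul_sum, Finset.sum_congr rfl fun k _ => e5 k, e4, Complex.re_sum,
      Finset.sum_sub_distrib, Finset.sum_neg_distrib]
    ring
  have tY : ∀ k {F : Rn n → ℂ}, Integrable F volume →
      Tendsto (fun m => ∫ x, (cutOrigin m (Y k) x : ℂ) * F x) atTop
        (𝓝 (∫ x, (Y k x : ℂ) * F x)) := fun k F hF => by
    obtain ⟨C, hC⟩ := (hY k).continuous.bounded_above_of_compact_support (hc k)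
    exact tendsto_integral_coeff hn hF (fun m => (hY' m k).continuous)
      (fun m x => (abs_cutOrigin_le m (Y k) x).trans (hC x)) (fun x hx => tendsto_cutOrigin _ hx)
  have tdY : ∀ j k {F : Rn n → ℂ}, Integrable F volume →
      Tendsto (fun m => ∫ x, ((pderiv j (cutOrigin m (Y k)) x : ℝ) : ℂ) * F x) atTop
        (𝓝 (∫ x, ((pderiv j (Y k) x : ℝ) : ℂ) * F x)) := fun j k F hF => by
    obtain ⟨D, hD⟩ := exists_bound_pderiv_cutOrigin (hY k) (hc k) (h0 k) j
    exact tendsto_integral_coeff hn hF (fun m => (hY' m k).continuous_pderiv j) hD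
      (fun x hx => tendsto_pderiv_cutOrigin _ j hx)
  have tel : Tendsto (fun m => ∫ x, electricDensity V (fun k => cutOrigin m (Y k)) u x) atTop
      (𝓝 (∫ x, electricDensity V Y u x)) := by
    have t := tendsto_integral_coeff hn hel (c := fun m x => cutOrigin m (fun _ => (1 : ℝ)) x)
      (d := fun _ => 1) (C := 1) (fun m => (contDiff_cutOrigin m contDiff_const).continuous)
      (fun m x => (abs_cutOrigin_le m _ x).trans (by simp))
      (fun x hx => tendsto_cutOrigin (fun _ => (1 : ℝ)) hx)
    simp only [Complex.ofReal_one, one_mul] at t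
    refine t.congr fun m => ?_
    congr 1 with x
    simp only [electricDensity, cutOrigin, mul_one, mul_assoc, ← Finset.mul_sum]
    push_cast
    ring
  have tL := (tendsto_finsetSum Finset.univ fun k _ =>
    hre (tY k (integrable_conj_mul v (G k)))).const_mul 2
  have tR := (tendsto_finsetSum Finset.univ fun k _ =>
    hre (tdY k k (integrable_conj_mul u v))).neg.sub (hre tel)
  exact tendsto_nhds_unique (tL.congr key) tR

/-- Testing the equation for `H_A u` with the product of `u` and a multiplier. -/
theorem HasMagneticGradient.inner_mul (hA : LocallySquareIntegrable A) {u g : L2 n}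
    {G : Fin n → L2 n} (h : HasMagneticGradient A u G) (hg : HasFormValue A G g)
    (c : Rn n →ᵇ ℝ) (hc : ContDiff ℝ 1 c) (d : Fin n → Rn n →ᵇ ℝ)
    (hd : ∀ j x, d j x = pderiv j c x) :
    ⟪_root_.mulL2 c u, g⟫_ℂ =
      ∑ j, (⟪_root_.mulL2 c (G j), G j⟫_ℂ + ⟪_root_.mulL2 (d j) u, G j⟫_ℂ) := by
  rw [← hg _ _ (h.mulL2 hA c hc d hd)]
  simp only [inner_add_left]

end WeakVirialIdentity

/-! ### Conservation laws, uniform bounds and continuity along the flow. -/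

section Flow

open Filter Topology BoundedContinuousFunction

variable {n : ℕ} {A : Rn n → Rn n} {V : Rn n → ℝ}

theorem inner_potential_eq {f f' v v' : L2 n} (hv : IsPotentialMul V f v)
    (hv' : IsPotentialMul V f' v') : ⟪f, v'⟫_ℂ = ⟪v, f'⟫_ℂ := by
  rw [inner_L2_eq, inner_L2_eq]
  refine integral_congr_ae ?_
  filter_upwards [hv, hv'] with x hx hx'
  rw [hx, hx', map_mul, Complex.conj_ofReal]
  ring

theorem inner_mulL2_potential_im {f v : L2 n} (hv : IsPotentialMul V f v) (c : Rn n →ᵇ ℝ) :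
    (⟪mulL2 c f, v⟫_ℂ).im = 0 := by
  rw [← Complex.conj_eq_iff_im, inner_conj_symm, inner_L2_eq, inner_L2_eq]
  refine integral_congr_ae ?_
  filter_upwards [hv, coeFn_mulL2 c f] with x hx hx'
  rw [hx, hx', map_mul, map_mul, Complex.conj_ofReal, Complex.conj_ofReal]
  ring

theorem inner_mulL2_self_im (c : Rn n →ᵇ ℝ) (f : L2 n) : (⟪mulL2 c f, f⟫_ℂ).im = 0 := by
  rw [← Complex.conj_eq_iff_im, inner_conj_symm, inner_mulL2_left, inner_mulL2_right]

theorem inner_form_symm {f f' g g' : L2 n} {G G' : Fin n → L2 n}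
    (h : HasMagneticGradient A f G) (h' : HasMagneticGradient A f' G')
    (hg : HasFormValue A G g) (hg' : HasFormValue A G' g') : ⟪f, g'⟫_ℂ = ⟪g, f'⟫_ℂ := by
  rw [← hg' f G h, ← inner_conj_symm g f', ← hg f' G' h', map_sum]
  simp only [inner_conj_symm]

theorem norm_eq_of_re_inner_deriv_eq_zero {E : Type*} [NormedAddCommGroup E]
    [InnerProductSpace ℂ E] {w w' : ℝ → E} (hw : ∀ t, HasDerivAt w (w' t) t)
    (h0 : ∀ t, (⟪w t, w' t⟫_ℂ).re = 0) (t s : ℝ) : ‖w t‖ = ‖w s‖ := by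
  have hd : ∀ t, HasDerivAt (fun t => ⟪w t, w t⟫_ℂ) (⟪w t, w' t⟫_ℂ + ⟪w' t, w t⟫_ℂ) t :=
    fun t => (hw t).inner ℂ (hw t)
  have hz : ∀ t, ⟪w t, w' t⟫_ℂ + ⟪w' t, w t⟫_ℂ = 0 := fun t => by
    rw [← inner_conj_symm (w' t) (w t), Complex.add_conj, h0 t]
    simp
  have hc := is_const_of_deriv_eq_zero (fun t => (hd t).differentiableAt)
    (fun t => (hd t).deriv.trans (hz t)) t s
  simp only [inner_self_eq_norm_sq_to_K] at hc
  have hc' : ‖w t‖ ^ 2 = ‖w s‖ ^ 2 := by exact_mod_cast hc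
  exact (sq_eq_sq₀ (norm_nonneg _) (norm_nonneg _)).mp hc'

/-- A solution `u` of `i u_t = H u` with magnetic gradient `G`, where `g = H_A u` and `v = V u`. -/
structure IsFlow (A : Rn n → Rn n) (V : Rn n → ℝ) (u : ℝ → L2 n) (G : ℝ → Fin n → L2 n)
    (g v : ℝ → L2 n) : Prop where
  grad : ∀ t, HasMagneticGradient A (u t) (G t)
  form : ∀ t, HasFormValue A (G t) (g t)
  pot : ∀ t, IsPotentialMul V (u t) (v t)
  hasDerivAt : ∀ t, HasDerivAt u (-Complex.I • (g t + v t)) t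

theorem IsSchrodingerSolution.exists_isFlow {f : L2 n} {u : ℝ → L2 n}
    (hu : IsSchrodingerSolution A V f u) {G : ℝ → Fin n → L2 n}
    (hG : ∀ t, HasMagneticGradient A (u t) (G t)) : ∃ g v, IsFlow A V u G g v := by
  have h : ∀ t, ∃ g v : L2 n, HasFormValue A (G t) g ∧ IsPotentialMul V (u t) v ∧
      HasDerivAt u (-Complex.I • (g + v)) t := by
    intro t
    obtain ⟨u', h, hu', ⟨g, v, ⟨G', hG', hg⟩, hv, rfl⟩, he⟩ := hu.equation t
    have hGG : G' = G t := hG'.unique (hG t)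
    subst hGG
    refine ⟨g, v, hg, hv, ?_⟩
    rw [← he, smul_smul]
    simpa using hu'
  choose g v h1 h2 h3 using h
  exact ⟨g, v, hG, h1, h2, h3⟩

namespace IsFlow

variable {u : ℝ → L2 n} {G : ℝ → Fin n → L2 n} {g v : ℝ → L2 n}

/-- Symmetry of `H` between two different times, which is needed to treat differences of solutions.
-/
theorem inner_symm (hF : IsFlow A V u G g v) (s t : ℝ) :
    ⟪u s, g t + v t⟫_ℂ = ⟪g s + v s, u t⟫_ℂ := by
  rw [inner_add_right, inner_add_left,
    inner_form_symm (hF.grad s) (hF.grad t) (hF.form s) (hF.form t),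
    inner_potential_eq (hF.pot s) (hF.pot t)]

theorem continuous (hF : IsFlow A V u G g v) : Continuous u :=
  continuous_iff_continuousAt.mpr fun t => (hF.hasDerivAt t).continuousAt

theorem norm_eq (hF : IsFlow A V u G g v) (t : ℝ) : ‖u t‖ = ‖u 0‖ := by
  refine norm_eq_of_re_inner_deriv_eq_zero hF.hasDerivAt (fun t => ?_) t 0
  have h : (⟪u t, g t + v t⟫_ℂ).im = 0 := by
    rw [← Complex.conj_eq_iff_im, inner_conj_symm]
    exact (hF.inner_symm t t).symm
  rw [inner_smul_right]
  simp [h]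

/-- A time translate solves the same equation, and by symmetry of `H` so does the difference, whose
norm is therefore conserved. -/
theorem norm_sub_eq (hF : IsFlow A V u G g v) (t a : ℝ) : ‖u (t + a) - u t‖ = ‖u a - u 0‖ := by
  have hd : ∀ t, HasDerivAt (fun t => u (t + a) - u t)
      (-Complex.I • (g (t + a) + v (t + a)) - -Complex.I • (g t + v t)) t := fun t =>
    ((hF.hasDerivAt (t + a)).comp_add_const t a).sub (hF.hasDerivAt t)
  have h := norm_eq_of_re_inner_deriv_eq_zero hd (fun t => ?_) t 0
  · simpa using h
  have h : (⟪u (t + a) - u t, (g (t + a) + v (t + a)) - (g t + v t)⟫_ℂ).im = 0 := by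
    rw [← Complex.conj_eq_iff_im, inner_conj_symm]
    simp only [inner_sub_left, inner_sub_right, hF.inner_symm]
  rw [← smul_sub, inner_smul_right]
  simp [h]

/-- The difference quotients have norms independent of `t`. Their limit has norm `‖Hu(t)‖`, and no
second time derivative is involved. -/
theorem norm_hamiltonian_eq (hF : IsFlow A V u G g v) (t : ℝ) :
    ‖g t + v t‖ = ‖g 0 + v 0‖ := by
  have h1 : ∀ t, Tendsto (fun a : ℝ => ‖a⁻¹ • (u (t + a) - u t)‖) (𝓝[≠] 0)
      (𝓝 ‖g t + v t‖) := fun t => by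
    have := (hasDerivAt_iff_tendsto_slope_zero.mp (hF.hasDerivAt t)).norm
    rw [norm_smul (-Complex.I)] at this
    simpa using this
  refine tendsto_nhds_unique (h1 t) ((h1 0).congr fun a => ?_)
  rw [norm_smul, norm_smul, hF.norm_sub_eq t a, hF.norm_sub_eq 0 a]

/-- From `‖H_A u‖ ≤ ‖Hu‖ + ‖Vu‖` the fraction `1 - ε` in the Kato-Rellich bound is absorbed on the
left, leaving only conserved quantities divided by `ε`. -/
theorem exists_norm_form_le (hF : IsFlow A V u G g v) (hKR : IsKatoRellich A V) :
    ∃ K, ∀ t, ‖g t‖ ≤ K := by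
  obtain ⟨ε, hε, -, C, hC⟩ := hKR
  refine ⟨(‖g 0 + v 0‖ + C * ‖u 0‖) / ε, fun t => ?_⟩
  obtain ⟨v', hv', hle⟩ := hC (u t) (g t) ⟨G t, hF.grad t, hF.form t⟩
  have hvv : v' = v t := Lp.ext (hv'.trans (hF.pot t).symm)
  rw [hvv, hF.norm_eq] at hle
  have h2 : ‖g t‖ ≤ ‖g t + v t‖ + ‖v t‖ := by
    simpa using norm_sub_le (g t + v t) (v t)
  rw [hF.norm_hamiltonian_eq] at h2
  rw [le_div_iff₀ hε]
  linarith

theorem sum_norm_sq (hF : IsFlow A V u G g v) (t : ℝ) :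
    ∑ j, ‖G t j‖ ^ 2 = (⟪u t, g t⟫_ℂ).re := by
  rw [← hF.form t _ _ (hF.grad t), Complex.re_sum]
  exact Finset.sum_congr rfl fun j _ => (inner_self_eq_norm_sq (𝕜 := ℂ) (G t j)).symm

theorem exists_norm_grad_le (hF : IsFlow A V u G g v) (hKR : IsKatoRellich A V) :
    ∃ K, 0 ≤ K ∧ ∀ t j, ‖G t j‖ ≤ K := by
  obtain ⟨K, hK⟩ := hF.exists_norm_form_le hKR
  refine ⟨Real.sqrt (‖u 0‖ * K), Real.sqrt_nonneg _, fun t j => Real.le_sqrt_of_sq_le ?_⟩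
  calc ‖G t j‖ ^ 2 ≤ ∑ j, ‖G t j‖ ^ 2 :=
        Finset.single_le_sum (f := fun j => ‖G t j‖ ^ 2) (fun j _ => by positivity)
          (Finset.mem_univ j)
    _ = (⟪u t, g t⟫_ℂ).re := hF.sum_norm_sq t
    _ ≤ ‖u t‖ * ‖g t‖ := (Complex.re_le_norm _).trans (norm_inner_le_norm _ _)
    _ ≤ ‖u 0‖ * K := by
        rw [hF.norm_eq]
        gcongr
        exact hK t

/-- Interpolation: the form value of `u(t) - u(s)` is at most `‖u(t) - u(s)‖` times `‖H_A u(t) - H_A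
u(s)‖`, and the second factor is bounded. -/
theorem continuous_grad (hF : IsFlow A V u G g v) (hA : LocallySquareIntegrable A)
    (hKR : IsKatoRellich A V) (j : Fin n) : Continuous fun t => G t j := by
  obtain ⟨K, hK⟩ := hF.exists_norm_form_le hKR
  rw [continuous_iff_continuousAt]
  intro s
  have hb : ∀ t, ‖G t j - G s j‖ ^ 2 ≤ ‖u t - u s‖ * (2 * K) := fun t => by
    have hgr := (hF.grad t).sub hA (hF.grad s)
    have e : ∑ j, ⟪G t j - G s j, G t j - G s j⟫_ℂ = ⟪u t - u s, g t - g s⟫_ℂ := by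
      rw [inner_sub_right, ← hF.form t _ _ hgr, ← hF.form s _ _ hgr, ← Finset.sum_sub_distrib]
      exact Finset.sum_congr rfl fun j _ => by rw [inner_sub_right]
    calc ‖G t j - G s j‖ ^ 2 ≤ ∑ j, ‖G t j - G s j‖ ^ 2 :=
          Finset.single_le_sum (f := fun j => ‖G t j - G s j‖ ^ 2) (fun j _ => by positivity)
            (Finset.mem_univ j)
      _ = (⟪u t - u s, g t - g s⟫_ℂ).re := by
          rw [← e, Complex.re_sum]
          exact Finset.sum_congr rfl fun j _ =>
            (inner_self_eq_norm_sq (𝕜 := ℂ) (G t j - G s j)).symm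
      _ ≤ ‖u t - u s‖ * ‖g t - g s‖ := (Complex.re_le_norm _).trans (norm_inner_le_norm _ _)
      _ ≤ ‖u t - u s‖ * (2 * K) := by
          gcongr
          linarith [norm_sub_le (g t) (g s), hK t, hK s]
  have hlim : Tendsto (fun t => ‖u t - u s‖ * (2 * K)) (𝓝 s) (𝓝 0) := by
    have := ((hF.continuous.tendsto s).sub_const (u s)).norm.mul_const (2 * K)
    simpa using this
  have hsq : Tendsto (fun t => ‖G t j - G s j‖ ^ 2) (𝓝 s) (𝓝 0) :=
    squeeze_zero (fun t => by positivity) hb hlim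
  have hn : Tendsto (fun t => ‖G t j - G s j‖) (𝓝 s) (𝓝 0) := by
    have := (Real.continuous_sqrt.tendsto 0).comp hsq
    simpa [Function.comp_def, Real.sqrt_sq] using this
  exact tendsto_iff_norm_sub_tendsto_zero.mpr hn

/-- The time derivative of `∫ c |u|²`. -/
theorem hasDerivAt_inner_mul (hF : IsFlow A V u G g v) (hA : LocallySquareIntegrable A)
    (c : Rn n →ᵇ ℝ) (hc : ContDiff ℝ 1 c) (d : Fin n → Rn n →ᵇ ℝ)
    (hd : ∀ j x, d j x = pderiv j c x) (t : ℝ) :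
    HasDerivAt (fun t => (⟪mulL2 c (u t), u t⟫_ℂ).re)
      (2 * ∑ j, (⟪mulL2 (d j) (u t), G t j⟫_ℂ).im) t := by
  set u' := -Complex.I • (g t + v t) with hu'
  have h1 : HasDerivAt (fun t => mulL2 c (u t)) (mulL2 c u') t :=
    ((mulL2 c).restrictScalars ℝ).hasFDerivAt.comp_hasDerivAt t (hF.hasDerivAt t)
  have h2 := Complex.reCLM.hasFDerivAt.comp_hasDerivAt t (h1.inner ℂ (hF.hasDerivAt t))
  refine h2.congr_deriv ?_
  have e1 : ⟪mulL2 c u', u t⟫_ℂ = conj ⟪mulL2 c (u t), u'⟫_ℂ := by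
    rw [inner_conj_symm, inner_mulL2_left, inner_mulL2_right]
  -- The part `c|∇_A u|²` is real, so only the terms with a derivative of `c` contribute.
  have e2 : (⟪mulL2 c (u t), g t⟫_ℂ).im = ∑ j, (⟪mulL2 (d j) (u t), G t j⟫_ℂ).im := by
    rw [(hF.grad t).inner_mul hA (hF.form t) c hc d hd, Complex.im_sum]
    refine Finset.sum_congr rfl fun j _ => ?_
    rw [Complex.add_im, inner_mulL2_self_im, zero_add]
  rw [← hu', e1, Complex.add_conj, ← e2, hu', inner_smul_right, inner_add_right]
  simp [inner_mulL2_potential_im (hF.pot t) c]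

end IsFlow

/-- Antisymmetry rewrites `⟪u t, q s - q t⟫` as `-⟪q t, u s - u t⟫`, so the increment of the pairing
contains only increments of `u`, and mere continuity of `q` suffices. This is applied with `q` built
from `∇_A u`. -/
theorem hasDerivAt_inner_of_antisymm {E : Type*} [NormedAddCommGroup E] [InnerProductSpace ℂ E]
    {u q : ℝ → E} {u' : E} {t : ℝ} (hu : HasDerivAt u u' t) (hq : ContinuousAt q t)
    (h : ∀ s, ⟪u t, q s⟫_ℂ = -⟪q t, u s⟫_ℂ) :
    HasDerivAt (fun s => ⟪u s, q s⟫_ℂ) (⟪u', q t⟫_ℂ - ⟪q t, u'⟫_ℂ) t := by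
  rw [hasDerivAt_iff_tendsto_slope] at hu ⊢
  have hq' : Tendsto q (𝓝[≠] t) (𝓝 (q t)) := hq.tendsto.mono_left nhdsWithin_le_nhds
  refine ((hu.inner hq').sub ((tendsto_const_nhds (x := q t)).inner hu)).congr fun s => ?_
  simp only [slope_def_module, inner_smul_left_eq_smul, inner_smul_right_eq_smul, ← smul_sub,
    inner_sub_left, inner_sub_right]
  congr 1
  have e1 := h s
  have e2 := h t
  rw [e1, show ⟪q t, u t⟫_ℂ = -⟪u t, q t⟫_ℂ by rw [e2, neg_neg]]
  ring

end Flow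

/-! ### The first-order operator `2Y·∇_A + div Y` and its action. -/

section Transport

open Filter Topology BoundedContinuousFunction

variable {n : ℕ} {A : Rn n → Rn n} {V : Rn n → ℝ}

/-- The function `2 Y · ∇_A u + D u`, for `G = ∇_A u`. -/
noncomputable def transport (Y : Fin n → Rn n →ᵇ ℝ) (D : Rn n →ᵇ ℝ) (u : L2 n)
    (G : Fin n → L2 n) : L2 n :=
  ∑ k, (2 : ℂ) • mulL2 (Y k) (G k) + mulL2 D u

theorem inner_transport_right (Y : Fin n → Rn n →ᵇ ℝ) (D : Rn n →ᵇ ℝ) (w u : L2 n)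
    (G : Fin n → L2 n) : ⟪w, transport Y D u G⟫_ℂ =
      2 * ∑ k, (∫ x, (Y k x : ℂ) * (conj (w x) * G k x)) + ∫ x, (D x : ℂ) * (conj (w x) * u x) := by
  simp only [transport, inner_add_right, inner_sum, inner_smul_right, inner_mulL2_right,
    Finset.mul_sum]

theorem inner_transport_left (Y : Fin n → Rn n →ᵇ ℝ) (D : Rn n →ᵇ ℝ) (w u : L2 n)
    (G : Fin n → L2 n) : ⟪transport Y D u G, w⟫_ℂ =
      2 * ∑ k, (∫ x, (Y k x : ℂ) * (conj (G k x) * w x)) + ∫ x, (D x : ℂ) * (conj (u x) * w x) := by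
  simp only [transport, inner_add_left, sum_inner, inner_smul_left, inner_mulL2_left,
    Finset.mul_sum, map_ofNat]

variable {Y : Fin n → Rn n →ᵇ ℝ} {D : Rn n →ᵇ ℝ}

theorem integral_div_eq_sum (hY : ∀ k, ContDiff ℝ 1 (Y k)) (hc : ∀ k, HasCompactSupport (Y k))
    (hD : ∀ x, D x = ∑ k, pderiv k (Y k) x) (u v : L2 n) :
    ∫ x, (D x : ℂ) * (conj (u x) * v x) =
      ∑ k, ∫ x, ((pderiv k (Y k) x : ℝ) : ℂ) * (conj (u x) * v x) := by
  have hi : ∀ k, Integrable (fun x => ((pderiv k (Y k) x : ℝ) : ℂ) * (conj (u x) * v x)) :=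
    fun k => integrable_bdd_mul_conj_mul
      (toBddOfCompact _ ((hY k).continuous_pderiv k) ((hc k).pderiv k)) u v
  rw [← integral_finsetSum _ fun k _ => hi k]
  congr 1 with x
  rw [hD, Complex.ofReal_sum, Finset.sum_mul]

/-- Integrating `2Y·∇_A` by parts gives its negative minus `2 div Y`. The zeroth-order term `div Y`
is exactly what balances this. -/
theorem HasMagneticGradient.inner_transport_antisymm (hn : n ≠ 0) (hA : LocallySquareIntegrable A)
    (hA1 : ContDiffOn ℝ 1 A {0}ᶜ) {u v : L2 n} {G Γ : Fin n → L2 n}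
    (hu : HasMagneticGradient A u G) (hv : HasMagneticGradient A v Γ)
    (hY : ∀ k, ContDiff ℝ 1 (Y k)) (hc : ∀ k, HasCompactSupport (Y k)) (h0 : ∀ k, Y k 0 = 0)
    (hD : ∀ x, D x = ∑ k, pderiv k (Y k) x) :
    ⟪v, transport Y D u G⟫_ℂ = -⟪transport Y D v Γ, u⟫_ℂ := by
  rw [inner_transport_left, inner_transport_right, integral_div_eq_sum hY hc hD]
  have e : ∑ k, (∫ x, (Y k x : ℂ) * (conj (v x) * G k x)) +
      ∑ k, (∫ x, (Y k x : ℂ) * (conj (Γ k x) * u x)) =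
      -∑ k, ∫ x, ((pderiv k (Y k) x : ℝ) : ℂ) * (conj (v x) * u x) := by
    rw [← Finset.sum_add_distrib, ← Finset.sum_neg_distrib]
    exact Finset.sum_congr rfl fun k _ => hu.integral_parts hn hA hA1 hv k (hY k) (hc k) (h0 k)
  linear_combination 2 * e

/-- The virial identity for the full Hamiltonian. -/
theorem HasMagneticGradient.re_inner_transport (hn : n ≠ 0) (hA : LocallySquareIntegrable A)
    (hA1 : ContDiffOn ℝ 1 A {0}ᶜ) (hV : ContDiffOn ℝ 1 V {0}ᶜ) {u g v : L2 n}
    {G : Fin n → L2 n} (h : HasMagneticGradient A u G) (hg : HasFormValue A G g)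
    (hv : IsPotentialMul V u v) (hY : ∀ k, ContDiff ℝ 2 (Y k))
    (hc : ∀ k, HasCompactSupport (Y k)) (h0 : ∀ k, Y k 0 = 0)
    (hD : ∀ x, D x = ∑ k, pderiv k (Y k) x)
    (hmag : Integrable (magneticDensity A (fun k => Y k) u G))
    (hel : Integrable (electricDensity V (fun k => Y k) u)) :
    (⟪g + v, transport Y D u G⟫_ℂ).re =
      2 * (∑ j, ∑ k, (∫ x, ((pderiv j (Y k) x : ℝ) : ℂ) * (conj (G j x) * G k x)).re) +
      (∑ j, (∫ x, ((pderiv j D x : ℝ) : ℂ) * (conj (u x) * G j x)).re) +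
      2 * (∫ x, magneticDensity A (fun k => Y k) u G x).im -
      (∫ x, electricDensity V (fun k => Y k) u x).re := by
  have hY1 : ∀ k, ContDiff ℝ 1 (Y k) := fun k => (hY k).of_le (by norm_num)
  have hDe : (D : Rn n → ℝ) = fun x => ∑ k, pderiv k (Y k) x := funext hD
  have hD1 : ContDiff ℝ 1 D := by
    rw [hDe]
    exact ContDiff.sum fun k _ => (hY k).contDiff_pderiv (by norm_num) k
  have hDc : HasCompactSupport D := by
    rw [hDe]
    exact HasCompactSupport.intro (isCompact_iUnion fun k => hc k) fun x hx =>
      Finset.sum_eq_zero fun k _ => pderiv_of_notMem_tsupport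
        (fun h => hx (Set.mem_iUnion_of_mem k h)) k
  -- The virial identities for `H_A` and for `V` leave `-∫ (div Y)|∇_A u|²` and `-∫ (div Y) V|u|²`.
  -- The zeroth-order part of the operator cancels both and leaves only the term in `∇ div Y`.
  have e1 := h.virial hn hA hA1 hg hY1 hc h0 hmag
  have e2 := h.virial_potential hn hA hA1 hV hv hY1 hc h0 hel
  have e3 := h.inner_mul hA hg D hD1
    (fun j => toBddOfCompact _ (hD1.continuous_pderiv j) (hDc.pderiv j)) fun j x => rfl
  have hsw : ∀ a b : L2 n, (∫ x, (D x : ℂ) * (conj (a x) * b x)).re =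
      (∫ x, (D x : ℂ) * (conj (b x) * a x)).re := fun a b => by
    rw [← inner_mulL2_left, ← inner_mulL2_right, ← inner_conj_symm, Complex.conj_re]
  simp only [inner_mulL2_left, toBddOfCompact_apply] at e3
  have e3' := congrArg Complex.re e3
  rw [inner_add_left, inner_transport_right, inner_transport_right]
  simp only [Complex.re_sum, Complex.add_re, Finset.sum_add_distrib, Finset.sum_neg_distrib,
    ← Finset.mul_sum] at e1 e2 e3'
  have e4 : ∀ j, (∫ x, (D x : ℂ) * (conj (G j x) * G j x)).re =
      ∑ k, (∫ x, ((pderiv k (Y k) x : ℝ) : ℂ) * (conj (G j x) * G j x)).re := fun j => by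
    rw [integral_div_eq_sum hY1 hc hD, Complex.re_sum]
  have e5 : (∫ x, (D x : ℂ) * (conj (u x) * v x)).re =
      ∑ k, (∫ x, ((pderiv k (Y k) x : ℝ) : ℂ) * (conj (u x) * v x)).re := by
    rw [integral_div_eq_sum hY1 hc hD, Complex.re_sum]
  simp only [e4] at e3'
  have re2 : ∀ z : ℂ, (2 * z).re = 2 * z.re := fun z => by simp
  simp only [Complex.add_re, re2, Complex.re_sum, hsw g u, hsw v u, e5]
  linarith

theorem continuous_transport {u : ℝ → L2 n} {G : ℝ → Fin n → L2 n} (hu : Continuous u)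
    (hG : ∀ j, Continuous fun t => G t j) : Continuous fun t => transport Y D (u t) (G t) := by
  have h1 : ∀ k ∈ Finset.univ, Continuous fun t => (2 : ℂ) • mulL2 (Y k) (G t k) := fun k _ => by
    have h : Continuous fun t => mulL2 (Y k) (G t k) := (mulL2 (Y k)).continuous.comp (hG k)
    exact h.const_smul (2 : ℂ)
  have h2 : Continuous fun t => mulL2 D (u t) := (mulL2 D).continuous.comp hu
  exact (continuous_finsetSum _ h1).add h2

/-- The time derivative of the Morawetz action of a compactly supported vector field. -/
theorem IsFlow.hasDerivAt_action {u : ℝ → L2 n} {G : ℝ → Fin n → L2 n} {g v : ℝ → L2 n}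
    (hF : IsFlow A V u G g v) (hn : n ≠ 0) (hA : LocallySquareIntegrable A)
    (hA1 : ContDiffOn ℝ 1 A {0}ᶜ) (hV : ContDiffOn ℝ 1 V {0}ᶜ) (hKR : IsKatoRellich A V)
    (hY : ∀ k, ContDiff ℝ 2 (Y k)) (hc : ∀ k, HasCompactSupport (Y k)) (h0 : ∀ k, Y k 0 = 0)
    (hD : ∀ x, D x = ∑ k, pderiv k (Y k) x) {t : ℝ}
    (hmag : Integrable (magneticDensity A (fun k => Y k) (u t) (G t)))
    (hel : Integrable (electricDensity V (fun k => Y k) (u t))) :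
    HasDerivAt (fun t => 2 * ∑ k, (∫ x, (Y k x : ℂ) * (conj (u t x) * G t k x)).im)
      (4 * (∑ j, ∑ k, (∫ x, ((pderiv j (Y k) x : ℝ) : ℂ) * (conj (G t j x) * G t k x)).re) +
      2 * (∑ j, (∫ x, ((pderiv j D x : ℝ) : ℂ) * (conj (u t x) * G t j x)).re) +
      4 * (∫ x, magneticDensity A (fun k => Y k) (u t) (G t) x).im -
      2 * (∫ x, electricDensity V (fun k => Y k) (u t) x).re) t := by
  have hY1 : ∀ k, ContDiff ℝ 1 (Y k) := fun k => (hY k).of_le (by norm_num)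
  have h := hasDerivAt_inner_of_antisymm (hF.hasDerivAt t)
    (continuous_transport (Y := Y) (D := D) hF.continuous
      (hF.continuous_grad hA hKR)).continuousAt fun s =>
    (hF.grad s).inner_transport_antisymm hn hA hA1 (hF.grad t) hY1 hc h0 hD
  have h2 := Complex.imCLM.hasFDerivAt.comp_hasDerivAt t h
  have e := (hF.grad t).re_inner_transport hn hA hA1 hV (hF.form t) (hF.pot t) hY hc h0 hD hmag hel
  -- The divergence term contributes a real number, so the action is the imaginary part of the full
  -- pairing with the antisymmetric operator.
  have hf : (fun t => 2 * ∑ k, (∫ x, (Y k x : ℂ) * (conj (u t x) * G t k x)).im) =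
      fun t => (⟪u t, transport Y D (u t) (G t)⟫_ℂ).im := by
    ext t
    have := inner_mulL2_self_im D (u t)
    rw [inner_mulL2_left] at this
    rw [inner_transport_right, Complex.add_im, this, add_zero, ← Complex.im_sum]
    simp
  rw [hf]
  refine h2.congr_deriv ?_
  rw [← inner_conj_symm (transport Y D (u t) (G t)), inner_smul_left]
  simp only [Complex.imCLM_apply, Complex.sub_im, Complex.conj_im]
  have : (conj (-Complex.I) * ⟪g t + v t, transport Y D (u t) (G t)⟫_ℂ).im =
      (⟪g t + v t, transport Y D (u t) (G t)⟫_ℂ).re := by simp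
  rw [this, e]
  ring

end Transport

/-! ### Limits that are uniform on compact time intervals. -/

section UniformLimits

open Filter Topology BoundedContinuousFunction

variable {n : ℕ}

theorem norm_integral_mul_conj_mul_le (c : Rn n →ᵇ ℝ) {C : ℝ} (hC : ∀ x, |c x| ≤ C)
    (f g : L2 n) : ‖∫ x, (c x : ℂ) * (conj (f x) * g x)‖ ≤ C * ‖f‖ * ‖g‖ := by
  rw [← inner_mulL2_left]
  exact (norm_inner_le_norm _ _).trans (by gcongr; exact norm_mulL2_le hC f)

/-- The squared norm is the integral of `c²|f|²`, to which dominated convergence applies. Only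
strong convergence holds, hence the compactness argument that follows. -/
theorem tendsto_mulL2 (hn : n ≠ 0) {c : ℕ → Rn n →ᵇ ℝ} {C : ℝ} (hC : ∀ k x, |c k x| ≤ C)
    (hlim : ∀ x ≠ 0, Tendsto (fun k => c k x) atTop (𝓝 0)) (f : L2 n) :
    Tendsto (fun k => ‖mulL2 (c k) f‖) atTop (𝓝 0) := by
  have h := tendsto_integral_coeff hn (integrable_conj_mul f f)
    (c := fun k x => c k x * c k x) (d := fun _ => 0) (C := C * C)
    (fun k => (c k).continuous.mul (c k).continuous)
    (fun k x => by
      rw [abs_mul]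
      exact mul_le_mul (hC k x) (hC k x) (abs_nonneg _) ((abs_nonneg _).trans (hC k x)))
    (fun x hx => by simpa using (hlim x hx).mul (hlim x hx))
  have e : ∀ k, ∫ x, ((c k x * c k x : ℝ) : ℂ) * (conj (f x) * f x) =
      ((‖mulL2 (c k) f‖ ^ 2 : ℝ) : ℂ) := fun k => by
    have h1 : ⟪mulL2 (c k) f, mulL2 (c k) f⟫_ℂ = ((‖mulL2 (c k) f‖ ^ 2 : ℝ) : ℂ) := by
      rw [inner_self_eq_norm_sq_to_K]
      push_cast
      rfl
    rw [← h1, inner_L2_eq]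
    refine integral_congr_ae ?_
    filter_upwards [coeFn_mulL2 (c k) f] with x hx
    simp only [hx, map_mul, Complex.conj_ofReal, Complex.ofReal_mul]
    ring
  simp only [e, Complex.ofReal_zero, zero_mul, integral_zero] at h
  have h2 : Tendsto (fun k => ‖mulL2 (c k) f‖ ^ 2) atTop (𝓝 0) :=
    (Complex.continuous_re.tendsto 0).comp h
  have h3 := (Real.continuous_sqrt.tendsto 0).comp h2
  simpa [Function.comp_def, Real.sqrt_sq] using h3

/-- Pointwise bounded convergence of multipliers is uniform along continuous curves on compact
sets of times. -/
theorem eventually_norm_mulL2_lt (hn : n ≠ 0) {c : ℕ → Rn n →ᵇ ℝ} {C : ℝ}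
    (hC : ∀ k x, |c k x| ≤ C) (hlim : ∀ x ≠ 0, Tendsto (fun k => c k x) atTop (𝓝 0))
    {H : ℝ → L2 n} (hH : Continuous H) {S : Set ℝ} (hS : IsCompact S) {ε : ℝ} (hε : 0 < ε) :
    ∀ᶠ k in atTop, ∀ t ∈ S, ‖mulL2 (c k) (H t)‖ < ε := by
  have hC0 : 0 ≤ C := (abs_nonneg _).trans (hC 0 0)
  -- The multipliers are equicontinuous with constant `C`. Near each time it is enough to know
  -- convergence at that time, and compactness makes the choice of `k` uniform.
  refine hS.induction_on (p := fun S => ∀ᶠ k in atTop, ∀ t ∈ S, ‖mulL2 (c k) (H t)‖ < ε)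
    (by simp) (fun s t hst ht => ht.mono fun k hk x hx => hk x (hst hx))
    (fun s t hs ht => ?_) (fun s _ => ?_)
  · filter_upwards [hs, ht] with k h1 h2 x hx
    exact hx.elim (h1 x) (h2 x)
  · have hlt : ∀ᶠ t in 𝓝 s, C * ‖H t - H s‖ < ε / 2 := by
      have : Tendsto (fun t => C * ‖H t - H s‖) (𝓝 s) (𝓝 0) := by
        have := ((hH.tendsto s).sub_const (H s)).norm.const_mul C
        simpa using this
      exact this.eventually_lt_const (half_pos hε)
    refine ⟨_, mem_nhdsWithin_of_mem_nhds hlt, ?_⟩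
    filter_upwards [(tendsto_mulL2 hn hC hlim (H s)).eventually_lt_const (half_pos hε)]
      with k hk t ht
    have e : mulL2 (c k) (H t) = mulL2 (c k) (H t - H s) + mulL2 (c k) (H s) := by
      rw [map_sub, sub_add_cancel]
    rw [e]
    have h1 := norm_add_le (mulL2 (c k) (H t - H s)) (mulL2 (c k) (H s))
    have h2 := norm_mulL2_le (hC k) (H t - H s)
    have h3 : C * ‖H t - H s‖ < ε / 2 := ht
    linarith

/-- Cut-offs at infinity converge uniformly on locally uniformly convergent integrals. -/
theorem ConvergesLocallyUniformly.eventually_norm_lt {F : ℝ → Rn n → ℂ}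
    (hF : ConvergesLocallyUniformly F) (T : ℝ) {ε : ℝ} (hε : 0 < ε) :
    ∀ᶠ k : ℕ in atTop, ∀ t, |t| ≤ T →
      ‖(∫ x, (scaledBump n ((k : ℝ) + 1)⁻¹ x : ℂ) * F t x) - ∫ x, F t x‖ < ε := by
  obtain ⟨K, hK, -, hle⟩ := hF.2 T (ε / 2) (half_pos hε)
  obtain ⟨R, hR⟩ := hK.isBounded.exists_norm_le
  -- For `k ≥ R` the cut-off equals `1` on `K`, so the error lives where the uniform tail bound `ε /
  -- 2` applies.
  filter_upwards [tendsto_natCast_atTop_atTop.eventually_ge_atTop R] with k hk t ht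
  have hi : Integrable (fun x => (scaledBump n ((k : ℝ) + 1)⁻¹ x : ℂ) * F t x) :=
    (hF.1 t).bdd_mul (c := 1)
      (Complex.continuous_ofReal.comp (contDiff_scaledBump _).continuous).aestronglyMeasurable
      (Eventually.of_forall fun x => by
        rw [Complex.norm_real]
        exact abs_scaledBump_le_one _ x)
  rw [← integral_sub hi (hF.1 t)]
  have h1 : ∀ x ∈ K, scaledBump n ((k : ℝ) + 1)⁻¹ x = 1 := fun x hx => by
    refine scaledBump_eq_one ?_
    have hp : (0 : ℝ) < k + 1 := by positivity
    rw [abs_of_pos (by positivity), inv_mul_le_iff₀ hp]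
    linarith [hR x hx]
  have e : ∫ x, ((scaledBump n ((k : ℝ) + 1)⁻¹ x : ℂ) * F t x - F t x) =
      ∫ x in Kᶜ, ((scaledBump n ((k : ℝ) + 1)⁻¹ x : ℂ) * F t x - F t x) := by
    refine (setIntegral_eq_integral_of_forall_compl_eq_zero fun x hx => ?_).symm
    rw [h1 x (by simpa using hx)]
    simp
  rw [e]
  refine lt_of_le_of_lt (norm_integral_le_of_norm_le (g := fun x => ‖F t x‖)
    (hF.1 t).norm.integrableOn (Eventually.of_forall fun x => ?_)) ((hle t ht).trans_lt (by linarith))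
  rw [← sub_one_mul, norm_mul, ← Complex.ofReal_one, ← Complex.ofReal_sub, Complex.norm_real,
    Real.norm_eq_abs]
  have := scaledBump_nonneg (n := n) ((k : ℝ) + 1)⁻¹ x
  have := scaledBump_le_one (n := n) ((k : ℝ) + 1)⁻¹ x
  have : |scaledBump n ((k : ℝ) + 1)⁻¹ x - 1| ≤ 1 := by
    rw [abs_le]
    constructor <;> linarith
  exact mul_le_of_le_one_left (norm_nonneg _) this

end UniformLimits

/-! ### Radial functions: parity and gradient. -/

section RadialFunctions

open Filter Topology

variable {n : ℕ}

theorem pderiv_neg_of_even {f : Rn n → ℝ} (hf : ∀ x, f (-x) = f x) (k : Fin n) (x : Rn n) :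
    pderiv k f (-x) = -pderiv k f x := by
  have h := fderiv_comp_smul (𝕜 := ℝ) (f := f) (x := x) (-1)
  simp only [neg_smul, one_smul] at h
  rw [show (fun x => f (-x)) = f from funext hf] at h
  simp [pderiv, h]

theorem pderiv_neg_of_odd {f : Rn n → ℝ} (hf : ∀ x, f (-x) = -f x) (k : Fin n) (x : Rn n) :
    pderiv k f (-x) = pderiv k f x := by
  have h := fderiv_comp_smul (𝕜 := ℝ) (f := f) (x := x) (-1)
  simp only [neg_smul, one_smul] at h
  rw [show (fun x => f (-x)) = fun x => -f x from funext hf, fderiv_fun_neg, neg_inj] at h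
  simp [pderiv, h]

theorem pderiv_zero_of_even {f : Rn n → ℝ} (hf : ∀ x, f (-x) = f x) (k : Fin n) :
    pderiv k f 0 = 0 := by
  have := pderiv_neg_of_even hf k 0
  rw [neg_zero] at this
  linarith

/-- The profile is recovered by restricting `φ` to the ray through `x`. Its values at negative
arguments are unconstrained, but only radii near `‖x‖ > 0` matter. -/
theorem differentiableAt_profile {φ : Rn n → ℝ} {φ₀ : ℝ → ℝ} (hrad : ∀ x, φ x = φ₀ ‖x‖) {x : Rn n}
    (hx : x ≠ 0) (hd : DifferentiableAt ℝ φ x) : DifferentiableAt ℝ φ₀ ‖x‖ := by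
  have hx' : 0 < ‖x‖ := norm_pos_iff.mpr hx
  have hg : HasDerivAt (fun r : ℝ => r • (‖x‖⁻¹ • x)) ((1 : ℝ) • (‖x‖⁻¹ • x)) ‖x‖ :=
    (hasDerivAt_id _).smul_const _
  have hgx : ‖x‖ • (‖x‖⁻¹ • x) = x := by
    rw [smul_smul, mul_inv_cancel₀ hx'.ne', one_smul]
  have h1 : DifferentiableAt ℝ (fun r : ℝ => φ (r • (‖x‖⁻¹ • x))) ‖x‖ :=
    DifferentiableAt.comp (g := φ) ‖x‖ (by rw [hgx]; exact hd) hg.differentiableAt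
  refine h1.congr_of_eventuallyEq ?_
  filter_upwards [lt_mem_nhds hx'] with r hr
  rw [hrad, norm_smul, norm_smul, norm_inv, norm_norm, inv_mul_cancel₀ hx'.ne', mul_one,
    Real.norm_of_nonneg hr.le]

theorem pderiv_radial {φ : Rn n → ℝ} {φ₀ : ℝ → ℝ} (hrad : ∀ x, φ x = φ₀ ‖x‖) {x : Rn n}
    (hx : x ≠ 0) (hd : DifferentiableAt ℝ φ x) (k : Fin n) :
    pderiv k φ x = deriv φ₀ ‖x‖ * (x k / ‖x‖) := by
  have hx' : 0 < ‖x‖ := norm_pos_iff.mpr hx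
  have hn : HasFDerivAt (fun y : Rn n => ‖y‖ ^ 2) (2 • innerSL ℝ x) x :=
    (hasStrictFDerivAt_norm_sq x).hasFDerivAt
  have hs := hn.sqrt (by positivity)
  simp only [Real.sqrt_sq (norm_nonneg _)] at hs
  have hc := (differentiableAt_profile hrad hx hd).hasDerivAt.comp_hasFDerivAt x hs
  have e : φ₀ ∘ norm = φ := funext fun y => (hrad y).symm
  have hc' : HasFDerivAt φ _ x := e ▸ hc
  rw [pderiv, hc'.fderiv]
  simp [EuclideanSpace.inner_single_right]
  field_simp
  simp

theorem sum_sq_pderiv_radial {φ : Rn n → ℝ} {φ₀ : ℝ → ℝ} (hrad : ∀ x, φ x = φ₀ ‖x‖) {x : Rn n}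
    (hx : x ≠ 0) (hd : DifferentiableAt ℝ φ x) :
    ∑ k, pderiv k φ x ^ 2 = deriv φ₀ ‖x‖ ^ 2 := by
  have hx' : 0 < ‖x‖ := norm_pos_iff.mpr hx
  have h2 : ∑ k, x k ^ 2 = ‖x‖ ^ 2 := (EuclideanSpace.real_norm_sq_eq x).symm
  simp only [pderiv_radial hrad hx hd, mul_pow, div_pow, ← Finset.mul_sum, ← Finset.sum_div, h2]
  field_simp

/-- Off the origin `∇φ = φ' x/|x|`, so the radial expressions of the theorem are the densities for
the field `∇φ`. The next lemma is the magnetic counterpart. -/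
theorem electricTerm_eq {φ : Rn n → ℝ} {φ₀ : ℝ → ℝ} (hrad : ∀ x, φ x = φ₀ ‖x‖)
    (hd : Differentiable ℝ φ) (V : Rn n → ℝ) (u : L2 n) {x : Rn n} (hx : x ≠ 0) :
    electricTerm φ₀ V u x = electricDensity V (fun k => pderiv k φ) u x := by
  rw [electricTerm, electricDensity, radialDeriv, fderiv_apply_eq_sum_pderiv, Complex.conj_mul']
  simp only [pderiv_radial hrad hx (hd x)]
  rw [← Complex.ofReal_pow, ← Complex.ofReal_mul, Finset.mul_sum, Finset.sum_mul, Finset.sum_mul]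
  congr 1
  refine Finset.sum_congr rfl fun k _ => ?_
  simp only [PiLp.smul_apply, smul_eq_mul]
  ring

theorem magneticTerm_eq {φ : Rn n → ℝ} {φ₀ : ℝ → ℝ} (hrad : ∀ x, φ x = φ₀ ‖x‖)
    (hd : Differentiable ℝ φ) (A : Rn n → Rn n) (u : L2 n) (G : Fin n → L2 n) {x : Rn n}
    (hx : x ≠ 0) : magneticTerm φ₀ A u G x = magneticDensity A (fun k => pderiv k φ) u G x := by
  simp only [magneticTerm, magneticDensity, tangentialField, Matrix.vecMul, dotProduct,
    pderiv_radial hrad hx (hd x), Complex.ofReal_sum, Finset.mul_sum, Finset.sum_mul]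
  refine Finset.sum_congr rfl fun j _ => Finset.sum_congr rfl fun k _ => ?_
  push_cast
  ring

end RadialFunctions

/-! ### Radial multipliers with bounded Hessian, and their cut-off gradients. -/

section Multipliers

open Filter Topology

variable {n : ℕ}

/-- The properties of a radial `C⁴` function with bounded Hessian that are used below. -/
structure IsMultiplier (φ : Rn n → ℝ) (C : ℝ) : Prop where
  nonneg : 0 ≤ C
  contDiff : ContDiff ℝ 4 φ
  hess_le : ∀ x j k, |pderiv j (pderiv k φ) x| ≤ C
  grad_le : ∀ x k, |pderiv k φ x| ≤ C * ‖x‖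
  pderiv_lap_zero : ∀ j, pderiv j (fun x => ∑ k, pderiv k (pderiv k φ) x) 0 = 0

theorem abs_le_mul_norm_of_pderiv_le {f : Rn n → ℝ} (hf : Differentiable ℝ f) (h0 : f 0 = 0)
    {C : ℝ} (hC : ∀ j x, |pderiv j f x| ≤ C) (x : Rn n) : |f x| ≤ n * C * ‖x‖ := by
  have hb : ∀ y ∈ (Set.univ : Set (Rn n)), ‖fderiv ℝ f y‖ ≤ n * C := fun y _ => by
    -- In dimension zero the bounds on partials say nothing about the sign of `C`, so that case is
    -- separate.
    rcases Nat.eq_zero_or_pos n with rfl | hn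
    · refine ContinuousLinearMap.opNorm_le_bound _ (by simp) fun v => ?_
      rw [fderiv_apply_eq_sum_pderiv]
      simp
    · have hC0 : 0 ≤ C := (abs_nonneg _).trans (hC ⟨0, hn⟩ 0)
      refine ContinuousLinearMap.opNorm_le_bound _ (by positivity) fun v => ?_
      rw [fderiv_apply_eq_sum_pderiv]
      calc ‖∑ j, v j • pderiv j f y‖ ≤ ∑ j : Fin n, ‖v‖ * C := by
            refine norm_sum_le_of_le _ fun j _ => ?_
            rw [norm_smul]
            exact mul_le_mul (PiLp.norm_apply_le v j) (hC j y) (norm_nonneg _) (norm_nonneg _)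
        _ = n * C * ‖v‖ := by
            simp
            ring
  have := convex_univ.norm_image_sub_le_of_norm_fderiv_le (fun y _ => hf y) hb
    (Set.mem_univ 0) (Set.mem_univ x)
  simpa [h0] using this

/-- A radial function is even, so `∇φ` and `∇Δφ` are odd and vanish at the origin. The factor `n` in
the constant comes from bounding the derivative of `∂ₖφ` by its `n` partials. -/
theorem IsMultiplier.of_radial (hn : n ≠ 0) {φ : Rn n → ℝ} {φ₀ : ℝ → ℝ}
    (hrad : ∀ x, φ x = φ₀ ‖x‖) (hφ : ContDiff ℝ 4 φ) {C : ℝ}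
    (hC : ∀ x j k, |hessian φ x j k| ≤ C) : IsMultiplier φ (n * C) := by
  have he : ∀ x, φ (-x) = φ x := fun x => by rw [hrad, hrad, norm_neg]
  have hn1 : (1 : ℝ) ≤ n := by exact_mod_cast Nat.one_le_iff_ne_zero.mpr hn
  have hC0 : 0 ≤ C := (abs_nonneg _).trans (hC 0 ⟨0, Nat.pos_of_ne_zero hn⟩ ⟨0, Nat.pos_of_ne_zero hn⟩)
  refine ⟨by positivity, hφ, fun x j k => (hC x j k).trans (le_mul_of_one_le_left hC0 hn1),
    fun x k => ?_, fun j => pderiv_zero_of_even (fun x => ?_) j⟩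
  · exact abs_le_mul_norm_of_pderiv_le
      ((hφ.contDiff_pderiv (m := 3) (by norm_num) k).differentiable (by norm_num))
      (pderiv_zero_of_even he k) (fun j x => hC x j k) x
  · exact Finset.sum_congr rfl fun k _ =>
      pderiv_neg_of_odd (fun y => pderiv_neg_of_even he k y) k x

/-- The squared gradient `|∇φ|²`. -/
noncomputable def gradSq (φ : Rn n → ℝ) (x : Rn n) : ℝ := ∑ k, pderiv k φ x ^ 2

/-- The gradient of `φ`, cut off at scale `s⁻¹`. -/
noncomputable def cutField (φ : Rn n → ℝ) (s : ℝ) (k : Fin n) (x : Rn n) : ℝ :=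
  scaledBump n s x * pderiv k φ x

namespace IsMultiplier

variable {φ : Rn n → ℝ} {C : ℝ}

theorem contDiff_grad (h : IsMultiplier φ C) (k : Fin n) : ContDiff ℝ 3 (pderiv k φ) :=
  h.contDiff.contDiff_pderiv (by norm_num) k

theorem contDiff_cutField (h : IsMultiplier φ C) (s : ℝ) (k : Fin n) :
    ContDiff ℝ 3 (cutField φ s k) :=
  ((contDiff_scaledBump s).of_le (WithTop.coe_le_coe.mpr (le_top (a := (3 : ℕ∞))))).mul (h.contDiff_grad k)

theorem hasCompactSupport_cutField (φ : Rn n → ℝ) {s : ℝ} (hs : s ≠ 0) (k : Fin n) :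
    HasCompactSupport (cutField φ s k) := (hasCompactSupport_scaledBump hs).mul_right

theorem grad_zero (h : IsMultiplier φ C) (k : Fin n) : pderiv k φ 0 = 0 := by
  simpa using h.grad_le 0 k

theorem pderiv_cutField (h : IsMultiplier φ C) (s : ℝ) (j k : Fin n) (x : Rn n) :
    pderiv j (cutField φ s k) x =
      pderiv j (scaledBump n s) x * pderiv k φ x + scaledBump n s x * pderiv j (pderiv k φ) x :=
  pderiv_mul ((contDiff_scaledBump s).differentiable (by simp) x)
    ((h.contDiff_grad k).differentiable (by norm_num) x) j

/-- Although `∇φ` may grow linearly, `|∇χ|·‖x‖` is bounded independently of the scale, so the cut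
field has derivatives bounded uniformly in `s`. -/
theorem exists_pderiv_cutField_le (h : IsMultiplier φ C) :
    ∃ L, 0 ≤ L ∧ ∀ s j k x, |pderiv j (cutField φ s k) x| ≤ L := by
  obtain ⟨B, hB0, hB⟩ := exists_scaledBump_bound n
  have hC0 := h.nonneg
  refine ⟨B * C + C, by positivity, fun s j k x => ?_⟩
  rw [h.pderiv_cutField]
  refine (abs_add_le _ _).trans (add_le_add ?_ ?_)
  · rw [abs_mul]
    calc |pderiv j (scaledBump n s) x| * |pderiv k φ x|
        ≤ |pderiv j (scaledBump n s) x| * (C * ‖x‖) := by gcongr; exact h.grad_le x k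
      _ = |pderiv j (scaledBump n s) x| * ‖x‖ * C := by ring
      _ ≤ B * C := by gcongr; exact (hB s x j j).2.1
  · rw [abs_mul]
    calc |scaledBump n s x| * |pderiv j (pderiv k φ) x| ≤ 1 * C :=
          mul_le_mul (abs_scaledBump_le_one s x) (h.hess_le x j k) (abs_nonneg _) zero_le_one
      _ = C := one_mul C

theorem _root_.tendsto_scaledBump (x : Rn n) :
    Tendsto (fun k : ℕ => scaledBump n ((k : ℝ) + 1)⁻¹ x) atTop (𝓝 1) := by
  refine tendsto_const_nhds.congr' ?_
  filter_upwards [tendsto_natCast_atTop_atTop.eventually_ge_atTop ‖x‖] with k hk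
  refine (scaledBump_eq_one ?_).symm
  have hp : (0 : ℝ) < k + 1 := by positivity
  rw [abs_of_pos (by positivity), inv_mul_le_iff₀ hp]
  linarith

end IsMultiplier

end Multipliers

/-! ### Propagation of the moment of `|∇φ|²`. -/

section Moments

open Filter Topology BoundedContinuousFunction

variable {n : ℕ} {A : Rn n → Rn n} {V : Rn n → ℝ}

theorem integrable_norm_sq (u : L2 n) : Integrable fun x => ‖u x‖ ^ 2 :=
  (memLp_two_iff_integrable_sq_norm (Lp.aestronglyMeasurable u)).mp (Lp.memLp u)

theorem integrable_bdd_mul_norm_sq (c : Rn n →ᵇ ℝ) (u : L2 n) :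
    Integrable fun x => c x * ‖u x‖ ^ 2 :=
  (integrable_norm_sq u).bdd_mul c.continuous.aestronglyMeasurable
    (Eventually.of_forall c.norm_coe_le_norm)

theorem re_inner_mulL2_self (c : Rn n →ᵇ ℝ) (u : L2 n) :
    (⟪mulL2 c u, u⟫_ℂ).re = ∫ x, c x * ‖u x‖ ^ 2 := by
  rw [inner_mulL2_left, ← RCLike.re_eq_complex_re,
    ← integral_re (integrable_bdd_mul_conj_mul c u u)]
  congr 1 with x
  rw [Complex.conj_mul', RCLike.re_eq_complex_re]
  norm_cast

theorem norm_mulL2_sq (c : Rn n →ᵇ ℝ) (u : L2 n) :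
    ‖mulL2 c u‖ ^ 2 = ∫ x, c x ^ 2 * ‖u x‖ ^ 2 := by
  rw [← inner_self_eq_norm_sq (𝕜 := ℂ), inner_L2_eq, RCLike.re_eq_complex_re,
    ← RCLike.re_eq_complex_re, ← integral_re (integrable_conj_mul _ _)]
  refine integral_congr_ae ?_
  filter_upwards [coeFn_mulL2 c u] with x hx
  rw [hx, Complex.conj_mul', RCLike.re_eq_complex_re, ← Complex.ofReal_pow, Complex.ofReal_re,
    norm_mul, Complex.norm_real, mul_pow, Real.norm_eq_abs, sq_abs]

theorem norm_mulL2_sq_le {c : Rn n →ᵇ ℝ} {w : Rn n → ℝ} {u : L2 n}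
    (hi : Integrable fun x => w x * ‖u x‖ ^ 2) (h : ∀ x, c x ^ 2 ≤ w x) :
    ‖mulL2 c u‖ ^ 2 ≤ ∫ x, w x * ‖u x‖ ^ 2 := by
  rw [norm_mulL2_sq]
  refine integral_mono_of_nonneg (Eventually.of_forall fun x => by positivity) hi
    (Eventually.of_forall fun x => ?_)
  exact mul_le_mul_of_nonneg_right (h x) (by positivity)

/-- Fatou's lemma for weighted masses. -/
theorem integrable_mul_norm_sq_of_tendsto {c : ℕ → Rn n →ᵇ ℝ} {w : Rn n → ℝ}
    (h0 : ∀ k x, 0 ≤ c k x) (hlim : ∀ x, Tendsto (fun k => c k x) atTop (𝓝 (w x))) {u : L2 n}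
    {M : ℝ} (hM : ∀ k, ∫ x, c k x * ‖u x‖ ^ 2 ≤ M) :
    Integrable (fun x => w x * ‖u x‖ ^ 2) ∧ ∫ x, w x * ‖u x‖ ^ 2 ≤ M := by
  have hw0 : ∀ x, 0 ≤ w x := fun x => ge_of_tendsto' (hlim x) fun k => h0 k x
  have hlim' : ∀ x, Tendsto (fun k => c k x * ‖u x‖ ^ 2) atTop (𝓝 (w x * ‖u x‖ ^ 2)) :=
    fun x => (hlim x).mul_const _
  have hmeas : AEStronglyMeasurable (fun x => w x * ‖u x‖ ^ 2) volume :=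
    aestronglyMeasurable_of_tendsto_ae atTop (fun k => (integrable_bdd_mul_norm_sq (c k) u).1)
      (Eventually.of_forall hlim')
  have hle : ∫⁻ x, ENNReal.ofReal (w x * ‖u x‖ ^ 2) ≤ ENNReal.ofReal M := by
    calc ∫⁻ x, ENNReal.ofReal (w x * ‖u x‖ ^ 2)
        = ∫⁻ x, liminf (fun k => ENNReal.ofReal (c k x * ‖u x‖ ^ 2)) atTop :=
          lintegral_congr fun x =>
            ((ENNReal.continuous_ofReal.tendsto _).comp (hlim' x)).liminf_eq.symm
      _ ≤ liminf (fun k => ∫⁻ x, ENNReal.ofReal (c k x * ‖u x‖ ^ 2)) atTop :=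
          lintegral_liminf_le' fun k =>
            (integrable_bdd_mul_norm_sq (c k) u).1.aemeasurable.ennreal_ofReal
      _ ≤ ENNReal.ofReal M := by
          refine liminf_le_of_frequently_le' (Frequently.of_forall fun k => ?_)
          rw [← ofReal_integral_eq_lintegral_ofReal (integrable_bdd_mul_norm_sq (c k) u)
            (Eventually.of_forall fun x => mul_nonneg (h0 k x) (by positivity))]
          exact ENNReal.ofReal_le_ofReal (hM k)
  have hnn : 0 ≤ᵐ[volume] fun x => w x * ‖u x‖ ^ 2 :=
    Eventually.of_forall fun x => mul_nonneg (hw0 x) (by positivity)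
  have hi : Integrable (fun x => w x * ‖u x‖ ^ 2) := by
    refine ⟨hmeas, ?_⟩
    rw [hasFiniteIntegral_iff_ofReal hnn]
    exact hle.trans_lt ENNReal.ofReal_lt_top
  refine ⟨hi, ?_⟩
  have hM0 : 0 ≤ M := (integral_nonneg fun x => mul_nonneg (h0 0 x) (by positivity)).trans (hM 0)
  rw [← ofReal_integral_eq_lintegral_ofReal hi hnn] at hle
  exact (ENNReal.ofReal_le_ofReal_iff hM0).mp hle

namespace IsFlow

variable {u : ℝ → L2 n} {G : ℝ → Fin n → L2 n} {g v : ℝ → L2 n}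

/-- Finite speed of growth of a moment whose weight `ψ` satisfies `|∇ψ| ≲ √ψ`. -/
theorem sqrt_moment_le (hF : IsFlow A V u G g v) (hA : LocallySquareIntegrable A) {K : ℝ}
    (hK0 : 0 ≤ K) (hK : ∀ t j, ‖G t j‖ ≤ K) {ψ : Rn n →ᵇ ℝ} (hψ : ContDiff ℝ 1 ψ)
    (hψ0 : ∀ x, 0 ≤ ψ x) {d : Fin n → Rn n →ᵇ ℝ} (hd : ∀ j x, d j x = pderiv j ψ x) {L : ℝ}
    (hL0 : 0 ≤ L) (hL : ∀ j x, d j x ^ 2 ≤ L ^ 2 * ψ x) (t : ℝ) :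
    √(1 + ∫ x, ψ x * ‖u t x‖ ^ 2) ≤ √(1 + ∫ x, ψ x * ‖u 0 x‖ ^ 2) + n * L * K * |t| := by
  set y : ℝ → ℝ := fun t => ∫ x, ψ x * ‖u t x‖ ^ 2 with hy
  have hy0 : ∀ t, 0 ≤ y t := fun t => integral_nonneg fun x => mul_nonneg (hψ0 x) (by positivity)
  have hdy : ∀ t, HasDerivAt y (2 * ∑ j, (⟪mulL2 (d j) (u t), G t j⟫_ℂ).im) t := fun t => by
    have := hF.hasDerivAt_inner_mul hA ψ hψ d hd t
    simpa only [re_inner_mulL2_self] using this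
  -- By Cauchy-Schwarz and the hypothesis on `∇ψ`, `|y'| ≤ 2nLK√y`, which says that `√y` is
  -- Lipschitz.
  have hb : ∀ t, |2 * ∑ j, (⟪mulL2 (d j) (u t), G t j⟫_ℂ).im| ≤ 2 * (n * (L * √(y t) * K)) :=
    fun t => by
      rw [abs_mul, abs_two]
      gcongr
      calc |∑ j, (⟪mulL2 (d j) (u t), G t j⟫_ℂ).im| ≤ ∑ j : Fin n, L * √(y t) * K := by
            refine (Finset.abs_sum_le_sum_abs _ _).trans (Finset.sum_le_sum fun j _ => ?_)
            refine (Complex.abs_im_le_norm _).trans ((norm_inner_le_norm _ _).trans ?_)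
            refine mul_le_mul ?_ (hK t j) (norm_nonneg _) (by positivity)
            have := norm_mulL2_sq_le (c := d j) (u := u t) (w := fun x => L ^ 2 * ψ x) (by
              simpa only [mul_assoc] using (integrable_bdd_mul_norm_sq ψ (u t)).const_mul (L ^ 2))
              (hL j)
            simp only [mul_assoc, integral_const_mul] at this
            refine (Real.le_sqrt_of_sq_le this).trans ?_
            rw [Real.sqrt_mul (by positivity), Real.sqrt_sq hL0]
        _ = n * (L * √(y t) * K) := by simp
  -- The added `1` keeps the square root differentiable where the moment vanishes.
  have hds : ∀ t, HasDerivAt (fun t => √(1 + y t))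
      ((2 * ∑ j, (⟪mulL2 (d j) (u t), G t j⟫_ℂ).im) / (2 * √(1 + y t))) t := fun t =>
    ((hdy t).const_add 1).sqrt (by linarith [hy0 t])
  have hbs : ∀ t ∈ (Set.univ : Set ℝ),
      ‖(2 * ∑ j, (⟪mulL2 (d j) (u t), G t j⟫_ℂ).im) / (2 * √(1 + y t))‖ ≤ n * L * K :=
    fun t _ => by
      have hp : 0 < √(1 + y t) := Real.sqrt_pos.mpr (by linarith [hy0 t])
      have hle : √(y t) ≤ √(1 + y t) := Real.sqrt_le_sqrt (by linarith)
      rw [norm_div, Real.norm_eq_abs, Real.norm_of_nonneg (by positivity), div_le_iff₀ (by positivity)]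
      calc _ ≤ _ := hb t
        _ = n * L * K * (2 * √(y t)) := by ring
        _ ≤ n * L * K * (2 * √(1 + y t)) := by gcongr
  have := convex_univ.norm_image_sub_le_of_norm_hasDerivWithin_le
    (fun t _ => (hds t).hasDerivWithinAt) hbs (Set.mem_univ 0) (Set.mem_univ t)
  rw [sub_zero, Real.norm_eq_abs, Real.norm_eq_abs] at this
  linarith [le_abs_self (√(1 + y t) - √(1 + y 0))]

/-- The moment bound applies to the squared norms of the cut fields, with constants independent of
the cut-off, and Fatou's lemma removes the cut-off. -/
theorem exists_grad_moment_le (hF : IsFlow A V u G g v) (hA : LocallySquareIntegrable A)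
    (hKR : IsKatoRellich A V) {φ : Rn n → ℝ} {C : ℝ} (hφ : IsMultiplier φ C)
    (h0 : Integrable fun x => gradSq φ x * ‖u 0 x‖ ^ 2) (T : ℝ) :
    ∃ M, ∀ t, |t| ≤ T → Integrable (fun x => gradSq φ x * ‖u t x‖ ^ 2) ∧
      ∫ x, gradSq φ x * ‖u t x‖ ^ 2 ≤ M := by
  obtain ⟨K, hK0, hK⟩ := hF.exists_norm_grad_le hKR
  obtain ⟨L, hL0, hL⟩ := hφ.exists_pderiv_cutField_le
  set M₀ := ∫ x, gradSq φ x * ‖u 0 x‖ ^ 2 with hM₀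
  refine ⟨(√(1 + M₀) + n * (2 * n * L) * K * T) ^ 2, fun t ht => ?_⟩
  have hs : ∀ k : ℕ, ((k : ℝ) + 1)⁻¹ ≠ 0 := fun k => by positivity
  set ψ : ℕ → Rn n → ℝ := fun k x => ∑ l, cutField φ ((k : ℝ) + 1)⁻¹ l x ^ 2 with hψ
  have hY1 : ∀ k l, ContDiff ℝ 1 (cutField φ ((k : ℝ) + 1)⁻¹ l) := fun k l =>
    (hφ.contDiff_cutField _ l).of_le (by norm_num)
  have hψ1 : ∀ k, ContDiff ℝ 1 (ψ k) := fun k =>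
    ContDiff.sum fun l _ => (hY1 k l).pow 2
  have hψc : ∀ k, HasCompactSupport (ψ k) := fun k =>
    HasCompactSupport.intro (hasCompactSupport_scaledBump (n := n) (hs k)) fun x hx => by
      simp [hψ, cutField, image_eq_zero_of_notMem_tsupport hx]
  have hψd : ∀ k j x, pderiv j (ψ k) x = ∑ l, cutField φ ((k : ℝ) + 1)⁻¹ l x *
      (2 * pderiv j (cutField φ ((k : ℝ) + 1)⁻¹ l) x) := fun k j x => by
    have hd : ∀ l, DifferentiableAt ℝ (cutField φ ((k : ℝ) + 1)⁻¹ l) x := fun l =>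
      (hY1 k l).differentiable one_ne_zero x
    simp only [hψ, sq]
    rw [pderiv_sum fun l _ => (hd l).fun_mul (hd l)]
    refine Finset.sum_congr rfl fun l _ => ?_
    rw [pderiv_mul (hd l) (hd l)]
    ring
  have hψ0 : ∀ k x, 0 ≤ ψ k x := fun k x => Finset.sum_nonneg fun l _ => sq_nonneg _
  -- Cauchy-Schwarz in the sum `2 ∑ Yₗ ∂ⱼYₗ`. The factor `n` is relaxed to `n ^ 2` to obtain a
  -- perfect square.
  have hψL : ∀ k j x, pderiv j (ψ k) x ^ 2 ≤ (2 * n * L) ^ 2 * ψ k x := fun k j x => by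
    rw [hψd]
    refine (Finset.sum_mul_sq_le_sq_mul_sq _ _ _).trans ?_
    rw [mul_comm]
    refine mul_le_mul_of_nonneg_right ?_ (hψ0 k x)
    have hn2 : (n : ℝ) ≤ n ^ 2 := by exact_mod_cast Nat.le_self_pow two_ne_zero n
    calc ∑ l, (2 * pderiv j (cutField φ ((k : ℝ) + 1)⁻¹ l) x) ^ 2 ≤ ∑ _l : Fin n, (2 * L) ^ 2 := by
          refine Finset.sum_le_sum fun l _ => sq_le_sq' ?_ ?_ <;>
          linarith [abs_le.mp (hL ((k : ℝ) + 1)⁻¹ j l x)]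
      _ = n * (2 * L) ^ 2 := by simp
      _ ≤ n ^ 2 * (2 * L) ^ 2 := by gcongr
      _ = (2 * n * L) ^ 2 := by ring
  have hψm : ∀ k x, ψ k x ≤ gradSq φ x := fun k x => by
    refine Finset.sum_le_sum fun l _ => ?_
    rw [cutField, mul_pow]
    refine mul_le_of_le_one_left (sq_nonneg _) ?_
    exact pow_le_one₀ (scaledBump_nonneg _ x) (scaledBump_le_one _ x)
  have hlim : ∀ x, Tendsto (fun k => ψ k x) atTop (𝓝 (gradSq φ x)) := fun x => by
    refine tendsto_finsetSum _ fun l _ => ?_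
    simpa [cutField] using ((tendsto_scaledBump x).mul_const (pderiv l φ x)).pow 2
  refine integrable_mul_norm_sq_of_tendsto
    (c := fun k => toBddOfCompact (ψ k) (hψ1 k).continuous (hψc k)) hψ0 hlim fun k => ?_
  have key := hF.sqrt_moment_le hA hK0 hK
    (ψ := toBddOfCompact (ψ k) (hψ1 k).continuous (hψc k)) (hψ1 k) (hψ0 k)
    (d := fun j => toBddOfCompact _ ((hψ1 k).continuous_pderiv j) ((hψc k).pderiv j))
    (fun j x => rfl) (L := 2 * n * L) (by positivity) (hψL k) t
  simp only [toBddOfCompact_apply] at key ⊢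
  have h1 : ∫ x, ψ k x * ‖u 0 x‖ ^ 2 ≤ M₀ :=
    integral_mono_of_nonneg (Eventually.of_forall fun x => mul_nonneg (hψ0 k x) (by positivity)) h0
      (Eventually.of_forall fun x => mul_le_mul_of_nonneg_right (hψm k x) (by positivity))
  have h2 : √(1 + ∫ x, ψ k x * ‖u t x‖ ^ 2) ≤ √(1 + M₀) + n * (2 * n * L) * K * T :=
    key.trans (add_le_add (Real.sqrt_le_sqrt (by linarith)) (by gcongr))
  have h3 : 0 ≤ ∫ x, ψ k x * ‖u t x‖ ^ 2 :=
    integral_nonneg fun x => mul_nonneg (hψ0 k x) (by positivity)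
  have h4 := pow_le_pow_left₀ (Real.sqrt_nonneg _) h2 2
  rw [Real.sq_sqrt (by linarith)] at h4
  linarith

end IsFlow

end Moments

/-! ### Pairings with an unbounded weight. -/

section WeightedIntegrals

open Filter Topology BoundedContinuousFunction

variable {n : ℕ}

theorem memLp_weight_mul {ρ : Rn n → ℝ} (hρ : Continuous ρ) {u : L2 n}
    (hi : Integrable fun x => ρ x ^ 2 * ‖u x‖ ^ 2) : MemLp (fun x => (ρ x : ℂ) * u x) 2 volume := by
  have hm : AEStronglyMeasurable (fun x => (ρ x : ℂ) * u x) volume :=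
    (Complex.continuous_ofReal.comp hρ).aestronglyMeasurable.mul (Lp.aestronglyMeasurable u)
  rw [memLp_two_iff_integrable_sq_norm hm]
  refine hi.congr (Eventually.of_forall fun x => ?_)
  simp [mul_pow]

theorem norm_toLp_weight_mul_sq {ρ : Rn n → ℝ} (hρ : Continuous ρ) {u : L2 n}
    (hi : Integrable fun x => ρ x ^ 2 * ‖u x‖ ^ 2) :
    ‖(memLp_weight_mul hρ hi).toLp _‖ ^ 2 = ∫ x, ρ x ^ 2 * ‖u x‖ ^ 2 := by
  rw [← inner_self_eq_norm_sq (𝕜 := ℂ), inner_L2_eq, RCLike.re_eq_complex_re,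
    ← RCLike.re_eq_complex_re, ← integral_re (integrable_conj_mul _ _)]
  refine integral_congr_ae ?_
  filter_upwards [(memLp_weight_mul hρ hi).coeFn_toLp] with x hx
  rw [hx, Complex.conj_mul', RCLike.re_eq_complex_re, ← Complex.ofReal_pow, Complex.ofReal_re,
    norm_mul, Complex.norm_real, mul_pow, Real.norm_eq_abs, sq_abs]

theorem integrable_weight_mul_conj_mul {ρ : Rn n → ℝ} (hρ : Continuous ρ) {u : L2 n}
    (hi : Integrable fun x => ρ x ^ 2 * ‖u x‖ ^ 2) (a : Rn n →ᵇ ℝ) (f : L2 n) :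
    Integrable fun x => ((a x * ρ x : ℝ) : ℂ) * (conj (u x) * f x) := by
  refine (integrable_bdd_mul_conj_mul a ((memLp_weight_mul hρ hi).toLp _) f).congr ?_
  filter_upwards [(memLp_weight_mul hρ hi).coeFn_toLp] with x hx
  rw [hx, map_mul, Complex.conj_ofReal]
  push_cast
  ring

/-- The growth is carried by `ρu`, bounded through a moment, while only the bounded factor `a` acts
on `f`. Convergence of such pairings thus reduces to strong convergence of bounded multipliers. -/
theorem norm_integral_weight_mul_conj_mul_le {ρ : Rn n → ℝ} (hρ : Continuous ρ) {u : L2 n}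
    (hi : Integrable fun x => ρ x ^ 2 * ‖u x‖ ^ 2) {M : ℝ} (hM : ∫ x, ρ x ^ 2 * ‖u x‖ ^ 2 ≤ M)
    (a : Rn n →ᵇ ℝ) (f : L2 n) :
    ‖∫ x, ((a x * ρ x : ℝ) : ℂ) * (conj (u x) * f x)‖ ≤ √M * ‖mulL2 a f‖ := by
  have e : ∫ x, ((a x * ρ x : ℝ) : ℂ) * (conj (u x) * f x) =
      ⟪(memLp_weight_mul hρ hi).toLp _, mulL2 a f⟫_ℂ := by
    rw [inner_mulL2_right]
    refine integral_congr_ae ?_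
    filter_upwards [(memLp_weight_mul hρ hi).coeFn_toLp] with x hx
    rw [hx, map_mul, Complex.conj_ofReal]
    push_cast
    ring
  rw [e]
  refine (norm_inner_le_norm _ _).trans (mul_le_mul_of_nonneg_right ?_ (norm_nonneg _))
  refine Real.le_sqrt_of_sq_le ?_
  rw [norm_toLp_weight_mul_sq hρ hi]
  exact hM

end WeightedIntegrals

/-! ### Bounded regularizations with uniformly controlled gradient. -/

section Regularization

open Filter Topology

variable {n : ℕ}

/-- The bounded function `p / (1 + δ (1 + φ² + |∇φ|²))`. -/
noncomputable def regularize (φ p : Rn n → ℝ) (δ : ℝ) (x : Rn n) : ℝ :=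
  p x * (1 + δ * (1 + φ x ^ 2 + gradSq φ x))⁻¹

theorem gradSq_nonneg (φ : Rn n → ℝ) (x : Rn n) : 0 ≤ gradSq φ x :=
  Finset.sum_nonneg fun _ _ => sq_nonneg _

theorem abs_pderiv_le_sqrt_gradSq (φ : Rn n → ℝ) (k : Fin n) (x : Rn n) :
    |pderiv k φ x| ≤ √(gradSq φ x) :=
  Real.abs_le_sqrt (Finset.single_le_sum (f := fun k => pderiv k φ x ^ 2)
    (fun _ _ => sq_nonneg _) (Finset.mem_univ k))

theorem one_le_regularizer (φ : Rn n → ℝ) {δ : ℝ} (hδ : 0 ≤ δ) (x : Rn n) :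
    1 ≤ 1 + δ * (1 + φ x ^ 2 + gradSq φ x) := by
  have := gradSq_nonneg φ x
  have : 0 ≤ δ * (1 + φ x ^ 2 + gradSq φ x) := by positivity
  linarith

theorem mul_inv_regularizer_le (φ : Rn n → ℝ) {δ : ℝ} (hδ : 0 ≤ δ) (x : Rn n) :
    δ * (1 + φ x ^ 2 + gradSq φ x) * (1 + δ * (1 + φ x ^ 2 + gradSq φ x))⁻¹ ≤ 1 := by
  have := one_le_regularizer φ hδ x
  rw [← div_eq_mul_inv, div_le_one (by linarith)]
  linarith

theorem abs_regularize_le_abs (φ p : Rn n → ℝ) {δ : ℝ} (hδ : 0 ≤ δ) (x : Rn n) :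
    |regularize φ p δ x| ≤ |p x| := by
  have h := one_le_regularizer φ hδ x
  have h' : 0 < 1 + δ * (1 + φ x ^ 2 + gradSq φ x) := by linarith
  rw [regularize, abs_mul, abs_inv, abs_of_pos h']
  exact mul_le_of_le_one_right (abs_nonneg _) (inv_le_one_of_one_le₀ h)

theorem tendsto_inv_regularizer (φ : Rn n → ℝ) (x : Rn n) :
    Tendsto (fun k : ℕ => (1 + ((k : ℝ) + 1)⁻¹ * (1 + φ x ^ 2 + gradSq φ x))⁻¹) atTop (𝓝 1) := by
  have h : Tendsto (fun k : ℕ => ((k : ℝ) + 1)⁻¹) atTop (𝓝 0) := by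
    simpa using tendsto_one_div_add_atTop_nhds_zero_nat (𝕜 := ℝ)
  have := ((h.mul_const (1 + φ x ^ 2 + gradSq φ x)).const_add 1).inv₀ (by simp)
  simpa using this

theorem tendsto_regularize (φ p : Rn n → ℝ) (x : Rn n) :
    Tendsto (fun k : ℕ => regularize φ p ((k : ℝ) + 1)⁻¹ x) atTop (𝓝 (p x)) := by
  simpa [regularize] using (tendsto_inv_regularizer φ x).const_mul (p x)

namespace IsMultiplier

variable {φ p : Rn n → ℝ} {C δ : ℝ}

theorem contDiff_gradSq (h : IsMultiplier φ C) : ContDiff ℝ 3 (gradSq φ) :=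
  ContDiff.sum fun k _ => (h.contDiff_grad k).pow 2

theorem contDiff_regularizer (h : IsMultiplier φ C) (δ : ℝ) :
    ContDiff ℝ 1 fun x => 1 + δ * (1 + φ x ^ 2 + gradSq φ x) :=
  contDiff_const.add (contDiff_const.mul ((contDiff_const.add
    ((h.contDiff.of_le (by norm_num)).pow 2)).add (h.contDiff_gradSq.of_le (by norm_num))))

theorem contDiff_regularize (h : IsMultiplier φ C) (hp : ContDiff ℝ 1 p) (hδ : 0 ≤ δ) :
    ContDiff ℝ 1 (regularize φ p δ) :=
  hp.mul ((h.contDiff_regularizer δ).inv fun x => by linarith [one_le_regularizer φ hδ x])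

theorem pderiv_regularizer (h : IsMultiplier φ C) (δ : ℝ) (j : Fin n) (x : Rn n) :
    pderiv j (fun y => 1 + δ * (1 + φ y ^ 2 + gradSq φ y)) x =
      δ * (2 * (φ x * pderiv j φ x + ∑ k, pderiv k φ x * pderiv j (pderiv k φ) x)) := by
  have hd : DifferentiableAt ℝ φ x := h.contDiff.differentiable (by norm_num) x
  have hg : ∀ k, DifferentiableAt ℝ (pderiv k φ) x := fun k =>
    (h.contDiff_grad k).differentiable (by norm_num) x
  have hs : HasFDerivAt (fun y => 1 + δ * (1 + φ y ^ 2 + gradSq φ y)) _ x :=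
    ((((hd.hasFDerivAt.pow 2).const_add 1).add
      (HasFDerivAt.fun_sum (u := Finset.univ) fun k _ => (hg k).hasFDerivAt.pow 2)).const_mul
        δ).const_add 1
  rw [pderiv, hs.fderiv]
  simp [pderiv, mul_add, Finset.mul_sum, mul_assoc]

theorem pderiv_regularize (h : IsMultiplier φ C) (hp : ContDiff ℝ 1 p) (hδ : 0 ≤ δ) (j : Fin n)
    (x : Rn n) : pderiv j (regularize φ p δ) x =
      (pderiv j p x - p x * (δ * (2 * (φ x * pderiv j φ x +
        ∑ k, pderiv k φ x * pderiv j (pderiv k φ) x))) *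
        (1 + δ * (1 + φ x ^ 2 + gradSq φ x))⁻¹) * (1 + δ * (1 + φ x ^ 2 + gradSq φ x))⁻¹ := by
  have hw := (h.contDiff_regularizer δ).differentiable one_ne_zero x
  have hne : 1 + δ * (1 + φ x ^ 2 + gradSq φ x) ≠ 0 := by
    linarith [one_le_regularizer φ hδ x]
  have hi : HasFDerivAt (fun y => (1 + δ * (1 + φ y ^ 2 + gradSq φ y))⁻¹) _ x :=
    (hasDerivAt_inv hne).comp_hasFDerivAt x hw.hasFDerivAt
  have hi' : pderiv j (fun y => (1 + δ * (1 + φ y ^ 2 + gradSq φ y))⁻¹) x =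
      -((1 + δ * (1 + φ x ^ 2 + gradSq φ x)) ^ 2)⁻¹ *
        pderiv j (fun y => 1 + δ * (1 + φ y ^ 2 + gradSq φ y)) x := by
    simp only [pderiv]
    rw [hi.fderiv]
    simp
  have e : pderiv j (regularize φ p δ) x = _ :=
    pderiv_mul (hp.differentiable one_ne_zero x) hi.differentiableAt j
  rw [e, hi', h.pderiv_regularizer]
  field_simp
  ring

/-- The gradient of the regularization is controlled by `|∇φ|`, uniformly in `δ`. -/
theorem abs_pderiv_regularize_le (h : IsMultiplier φ C) (hp : ContDiff ℝ 1 p)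
    (hp0 : ∀ x, p x ^ 2 ≤ 1 + φ x ^ 2) (hp1 : ∀ j x, |pderiv j p x| ≤ √(gradSq φ x))
    (hδ : 0 ≤ δ) (j : Fin n) (x : Rn n) :
    |pderiv j (regularize φ p δ) x| ≤ (3 + 2 * n * C) * √(gradSq φ x) *
      (1 + δ * (1 + φ x ^ 2 + gradSq φ x))⁻¹ := by
  rw [h.pderiv_regularize hp hδ]
  set w := 1 + φ x ^ 2 + gradSq φ x with hw
  set η := (1 + δ * w)⁻¹ with hη
  set r := √(gradSq φ x) with hr
  have hr0 : 0 ≤ r := Real.sqrt_nonneg _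
  have hC := h.nonneg
  have hη0 : 0 ≤ η := inv_nonneg.mpr (by linarith [one_le_regularizer φ hδ x])
  have hδw : δ * w * η ≤ 1 := mul_inv_regularizer_le φ hδ x
  rw [abs_mul, abs_of_nonneg hη0]
  refine mul_le_mul_of_nonneg_right ?_ hη0
  have hS : |∑ k, pderiv k φ x * pderiv j (pderiv k φ) x| ≤ n * C * r := by
    calc _ ≤ ∑ _k : Fin n, r * C := by
          refine (Finset.abs_sum_le_sum_abs _ _).trans (Finset.sum_le_sum fun k _ => ?_)
          rw [abs_mul]
          exact mul_le_mul (abs_pderiv_le_sqrt_gradSq φ k x) (h.hess_le x j k) (abs_nonneg _) hr0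
      _ = n * C * r := by
          simp
          ring
  -- Differentiating the denominator produces factors `|p|` and `|p||φ|`. Both are at most `w = 1 +
  -- φ² + |∇φ|²`, so `δ w η ≤ 1` absorbs `δ`. This gives `2 + 2nC`, and `∂ⱼp` adds the last `1`.
  have hpw : |p x| ≤ w := by
    have := gradSq_nonneg φ x
    nlinarith [sq_abs (p x), sq_nonneg (|p x| - 1), hp0 x, sq_nonneg (φ x)]
  have hpφ : |p x| * |φ x| ≤ w := by
    have := gradSq_nonneg φ x
    nlinarith [sq_abs (p x), sq_abs (φ x), sq_nonneg (|p x| - |φ x|), hp0 x]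
  have hφj : |φ x * pderiv j φ x| ≤ |φ x| * r := by
    rw [abs_mul]
    exact mul_le_mul_of_nonneg_left (abs_pderiv_le_sqrt_gradSq φ j x) (abs_nonneg _)
  have h2 : |p x * (δ * (2 * (φ x * pderiv j φ x +
      ∑ k, pderiv k φ x * pderiv j (pderiv k φ) x))) * η| ≤ (2 + 2 * n * C) * r := by
    rw [abs_mul, abs_mul, abs_mul, abs_mul, abs_of_nonneg hη0, abs_of_nonneg hδ, abs_two]
    calc _ ≤ |p x| * (δ * (2 * (|φ x| * r + n * C * r))) * η := by
          gcongr
          exact (abs_add_le _ _).trans (add_le_add hφj hS)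
      _ = δ * (2 * (|p x| * |φ x|) + 2 * n * C * |p x|) * η * r := by ring
      _ ≤ δ * (2 * w + 2 * n * C * w) * η * r := by gcongr
      _ = (2 + 2 * n * C) * (δ * w * η) * r := by ring
      _ ≤ (2 + 2 * n * C) * 1 * r := by gcongr
      _ = (2 + 2 * n * C) * r := by ring
  refine (abs_sub _ _).trans ?_
  linarith [hp1 j x]

theorem abs_pderiv_regularize_le_sqrt (h : IsMultiplier φ C) (hp : ContDiff ℝ 1 p)
    (hp0 : ∀ x, p x ^ 2 ≤ 1 + φ x ^ 2) (hp1 : ∀ j x, |pderiv j p x| ≤ √(gradSq φ x))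
    (hδ : 0 ≤ δ) (j : Fin n) (x : Rn n) :
    |pderiv j (regularize φ p δ) x| ≤ (3 + 2 * n * C) * √(gradSq φ x) := by
  have hC := h.nonneg
  exact (h.abs_pderiv_regularize_le hp hp0 hp1 hδ j x).trans (mul_le_of_le_one_right
    (by positivity) (inv_le_one_of_one_le₀ (one_le_regularizer φ hδ x)))

/-- A bound depending on `δ`; it serves only to make these derivatives bounded multipliers. -/
theorem abs_pderiv_regularize_le_const (h : IsMultiplier φ C) (hp : ContDiff ℝ 1 p)
    (hp0 : ∀ x, p x ^ 2 ≤ 1 + φ x ^ 2) (hp1 : ∀ j x, |pderiv j p x| ≤ √(gradSq φ x))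
    (hδ : 0 < δ) (j : Fin n) (x : Rn n) :
    |pderiv j (regularize φ p δ) x| ≤ (3 + 2 * n * C) * δ⁻¹ := by
  have hC := h.nonneg
  have hm := gradSq_nonneg φ x
  have h1 := one_le_regularizer φ hδ.le x
  refine (h.abs_pderiv_regularize_le hp hp0 hp1 hδ.le j x).trans ?_
  rw [mul_assoc]
  refine mul_le_mul_of_nonneg_left ?_ (by positivity)
  have hle : √(gradSq φ x) ≤ 1 + φ x ^ 2 + gradSq φ x := by
    nlinarith [Real.sq_sqrt hm, sq_nonneg (√(gradSq φ x) - 1), sq_nonneg (φ x)]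
  rw [← div_eq_mul_inv, div_le_iff₀ (by linarith), inv_mul_eq_div, le_div_iff₀ hδ]
  nlinarith

theorem abs_regularize_le_const (hp0 : ∀ x, p x ^ 2 ≤ 1 + φ x ^ 2) (hδ : 0 < δ) (x : Rn n) :
    |regularize φ p δ x| ≤ δ⁻¹ := by
  have hm := gradSq_nonneg φ x
  have h1 := one_le_regularizer φ hδ.le x
  have hle : |p x| ≤ 1 + φ x ^ 2 + gradSq φ x := by
    nlinarith [sq_abs (p x), sq_nonneg (|p x| - 1), hp0 x, sq_nonneg (φ x)]
  have h2 : 0 < 1 + δ * (1 + φ x ^ 2 + gradSq φ x) := by linarith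
  rw [regularize, abs_mul, abs_inv, abs_of_pos h2, ← div_eq_mul_inv,
    div_le_iff₀ (by linarith), inv_mul_eq_div, le_div_iff₀ hδ]
  nlinarith

theorem tendsto_pderiv_regularize (h : IsMultiplier φ C) (hp : ContDiff ℝ 1 p) (j : Fin n)
    (x : Rn n) : Tendsto (fun k : ℕ => pderiv j (regularize φ p ((k : ℝ) + 1)⁻¹) x) atTop
      (𝓝 (pderiv j p x)) := by
  have hδ : Tendsto (fun k : ℕ => ((k : ℝ) + 1)⁻¹) atTop (𝓝 0) := by
    simpa using tendsto_one_div_add_atTop_nhds_zero_nat (𝕜 := ℝ)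
  have hη := tendsto_inv_regularizer φ x
  have e : ∀ k : ℕ, _ := fun k =>
    h.pderiv_regularize hp (δ := ((k : ℝ) + 1)⁻¹) (by positivity) j x
  simp only [e]
  have := ((((hδ.mul_const (2 * (φ x * pderiv j φ x +
    ∑ k, pderiv k φ x * pderiv j (pderiv k φ) x))).const_mul (p x)).mul hη).const_sub
      (pderiv j p x)).mul hη
  simpa using this

end IsMultiplier

end Regularization

/-! ### Finiteness and first derivative of the weighted mass. -/

section FirstDerivative

open Filter Topology BoundedContinuousFunction

variable {n : ℕ} {A : Rn n → Rn n} {V : Rn n → ℝ} {φ : Rn n → ℝ} {C : ℝ}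

/-- The weight `(1 + |∇φ|²)^(1/2)`. -/
noncomputable def gradWeight (φ : Rn n → ℝ) (x : Rn n) : ℝ := √(1 + gradSq φ x)

theorem gradWeight_sq (φ : Rn n → ℝ) (x : Rn n) : gradWeight φ x ^ 2 = 1 + gradSq φ x :=
  Real.sq_sqrt (by linarith [gradSq_nonneg φ x])

theorem gradWeight_pos (φ : Rn n → ℝ) (x : Rn n) : 0 < gradWeight φ x :=
  Real.sqrt_pos.mpr (by linarith [gradSq_nonneg φ x])

theorem sqrt_gradSq_le_gradWeight (φ : Rn n → ℝ) (x : Rn n) : √(gradSq φ x) ≤ gradWeight φ x :=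
  Real.sqrt_le_sqrt (by linarith)

theorem IsMultiplier.continuous_gradWeight (h : IsMultiplier φ C) : Continuous (gradWeight φ) :=
  (continuous_const.add h.contDiff_gradSq.continuous).sqrt

theorem sq_le_of_abs_le_mul_sqrt {a L y : ℝ} (hy : 0 ≤ y) (h : |a| ≤ L * √y) :
    a ^ 2 ≤ L ^ 2 * y := by
  have := pow_le_pow_left₀ (abs_nonneg a) h 2
  rwa [sq_abs, mul_pow, Real.sq_sqrt hy] at this

/-- The quotient of a continuous function by the weight, as a bounded continuous function. -/
noncomputable def IsMultiplier.divWeight (h : IsMultiplier φ C) {c : Rn n → ℝ} (hc : Continuous c)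
    {L : ℝ} (hL : ∀ x, |c x| ≤ L * √(gradSq φ x)) : Rn n →ᵇ ℝ :=
  toBdd (fun x => c x / gradWeight φ x)
    (hc.div h.continuous_gradWeight fun x => (gradWeight_pos φ x).ne')
    ⟨|L|, fun x => by
      rw [abs_div, abs_of_pos (gradWeight_pos φ x), div_le_iff₀ (gradWeight_pos φ x)]
      refine (hL x).trans ?_
      exact mul_le_mul (le_abs_self L) (sqrt_gradSq_le_gradWeight φ x) (Real.sqrt_nonneg _)
        (abs_nonneg L)⟩

theorem IsMultiplier.divWeight_apply (h : IsMultiplier φ C) {c : Rn n → ℝ} (hc : Continuous c)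
    {L : ℝ} (hL : ∀ x, |c x| ≤ L * √(gradSq φ x)) (x : Rn n) :
    h.divWeight hc hL x = c x / gradWeight φ x := rfl

theorem IsMultiplier.abs_divWeight_le (h : IsMultiplier φ C) {c : Rn n → ℝ} (hc : Continuous c)
    {L : ℝ} (hL0 : 0 ≤ L) (hL : ∀ x, |c x| ≤ L * √(gradSq φ x)) (x : Rn n) :
    |h.divWeight hc hL x| ≤ L := by
  rw [h.divWeight_apply, abs_div, abs_of_pos (gradWeight_pos φ x), div_le_iff₀ (gradWeight_pos φ x)]
  exact (hL x).trans (mul_le_mul_of_nonneg_left (sqrt_gradSq_le_gradWeight φ x) hL0)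

theorem IsMultiplier.integrable_mul_conj_mul (h : IsMultiplier φ C) {c : Rn n → ℝ}
    (hc : Continuous c) {L : ℝ} (hL : ∀ x, |c x| ≤ L * √(gradSq φ x)) {u : L2 n}
    (hi : Integrable fun x => gradWeight φ x ^ 2 * ‖u x‖ ^ 2) (f : L2 n) :
    Integrable fun x => (c x : ℂ) * (conj (u x) * f x) := by
  have := integrable_weight_mul_conj_mul h.continuous_gradWeight hi (h.divWeight hc hL) f
  simpa only [h.divWeight_apply, div_mul_cancel₀ _ (gradWeight_pos φ _).ne'] using this

theorem IsMultiplier.norm_integral_mul_conj_mul_le (h : IsMultiplier φ C) {c : Rn n → ℝ}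
    (hc : Continuous c) {L : ℝ} (hL : ∀ x, |c x| ≤ L * √(gradSq φ x)) {u : L2 n}
    (hi : Integrable fun x => gradWeight φ x ^ 2 * ‖u x‖ ^ 2) {M : ℝ}
    (hM : ∫ x, gradWeight φ x ^ 2 * ‖u x‖ ^ 2 ≤ M) (f : L2 n) :
    ‖∫ x, (c x : ℂ) * (conj (u x) * f x)‖ ≤ √M * ‖mulL2 (h.divWeight hc hL) f‖ := by
  have := norm_integral_weight_mul_conj_mul_le h.continuous_gradWeight hi hM (h.divWeight hc hL) f
  simpa only [h.divWeight_apply, div_mul_cancel₀ _ (gradWeight_pos φ _).ne'] using this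

namespace IsFlow

variable {u : ℝ → L2 n} {G : ℝ → Fin n → L2 n} {g v : ℝ → L2 n}

theorem exists_weight_moment_le (hF : IsFlow A V u G g v) (hA : LocallySquareIntegrable A)
    (hKR : IsKatoRellich A V) (hφ : IsMultiplier φ C)
    (h0 : Integrable fun x => gradSq φ x * ‖u 0 x‖ ^ 2) (T : ℝ) :
    ∃ M, ∀ t, |t| ≤ T → Integrable (fun x => gradWeight φ x ^ 2 * ‖u t x‖ ^ 2) ∧
      ∫ x, gradWeight φ x ^ 2 * ‖u t x‖ ^ 2 ≤ M := by
  obtain ⟨M, hM⟩ := hF.exists_grad_moment_le hA hKR hφ h0 T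
  refine ⟨‖u 0‖ ^ 2 + M, fun t ht => ?_⟩
  have e : (fun x => gradWeight φ x ^ 2 * ‖u t x‖ ^ 2) =
      fun x => ‖u t x‖ ^ 2 + gradSq φ x * ‖u t x‖ ^ 2 := by
    ext x
    rw [gradWeight_sq]
    ring
  have hu : ∫ x, ‖u t x‖ ^ 2 = ‖u t‖ ^ 2 := by
    have := norm_mulL2_sq (1 : Rn n →ᵇ ℝ) (u t)
    have h1 : mulL2 (1 : Rn n →ᵇ ℝ) (u t) = u t := by
      refine Lp.ext ?_
      filter_upwards [coeFn_mulL2 (1 : Rn n →ᵇ ℝ) (u t)] with x hx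
      simp [hx]
    simpa [h1] using this.symm
  rw [e]
  refine ⟨(integrable_norm_sq (u t)).add (hM t ht).1, ?_⟩
  rw [integral_add (integrable_norm_sq (u t)) (hM t ht).1, hu, hF.norm_eq]
  exact add_le_add le_rfl (hM t ht).2

/-- The multiplier `φ` stays integrable against `|u(t)|²`. -/
theorem integrable_multiplier (hF : IsFlow A V u G g v) (hA : LocallySquareIntegrable A)
    (hKR : IsKatoRellich A V) (hφ : IsMultiplier φ C)
    (h0 : Integrable fun x => gradSq φ x * ‖u 0 x‖ ^ 2)
    (hφ0 : Integrable fun x => φ x * ‖u 0 x‖ ^ 2) (t : ℝ) :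
    Integrable fun x => φ x * ‖u t x‖ ^ 2 := by
  obtain ⟨K, hK0, hK⟩ := hF.exists_norm_grad_le hKR
  obtain ⟨M, hM⟩ := hF.exists_grad_moment_le hA hKR hφ h0 |t|
  have hC := hφ.nonneg
  set L : ℝ := 3 + 2 * n * C with hL
  have hL0 : 0 ≤ L := by positivity
  have hφ1 : ContDiff ℝ 1 φ := hφ.contDiff.of_le (by norm_num)
  -- A positive `C¹` majorant of `|φ|` satisfying `|∇s| ≤ |∇φ|`; positivity is needed for Fatou's
  -- lemma.
  set s : Rn n → ℝ := fun x => √(1 + φ x ^ 2) with hs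
  have hpos : ∀ x, 0 < 1 + φ x ^ 2 := fun x => by positivity
  have hs1 : ContDiff ℝ 1 s := (contDiff_const.add (hφ1.pow 2)).sqrt fun x => (hpos x).ne'
  have hs0 : ∀ x, 0 ≤ s x := fun x => Real.sqrt_nonneg _
  have hssq : ∀ x, s x ^ 2 = 1 + φ x ^ 2 := fun x => Real.sq_sqrt (hpos x).le
  have hφs : ∀ x, |φ x| ≤ s x := fun x => Real.abs_le_sqrt (by linarith)
  have hsd : ∀ j x, |pderiv j s x| ≤ √(gradSq φ x) := fun j x => by
    have hd := (hφ1.differentiable one_ne_zero x).hasFDerivAt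
    have h1 : HasFDerivAt s _ x := ((hd.pow 2).const_add 1).sqrt (hpos x).ne'
    have e : pderiv j s x = φ x / s x * pderiv j φ x := by
      rw [pderiv, h1.fderiv]
      have : s x ≠ 0 := (Real.sqrt_pos.mpr (hpos x)).ne'
      simp only [one_div, pderiv, FunLike.coe_smul, Pi.smul_apply, smul_eq_mul, nsmul_eq_mul,
        Nat.add_one_sub_one, pow_one, Nat.cast_ofNat]
      change (2 * s x)⁻¹ * _ = _
      field_simp
    rw [e, abs_mul]
    refine (mul_le_of_le_one_left (abs_nonneg _) ?_).trans (abs_pderiv_le_sqrt_gradSq φ j x)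
    rw [abs_div, abs_of_nonneg (hs0 x)]
    exact div_le_one_of_le₀ (hφs x) (hs0 x)
  have hδ : ∀ k : ℕ, (0 : ℝ) < ((k : ℝ) + 1)⁻¹ := fun k => by positivity
  have hr1 := fun k => hφ.contDiff_regularize hs1 (hδ k).le
  set r : ℕ → Rn n →ᵇ ℝ := fun k => toBdd (regularize φ s ((k : ℝ) + 1)⁻¹) (hr1 k).continuous
    ⟨_, IsMultiplier.abs_regularize_le_const (fun x => (hssq x).le) (hδ k)⟩ with hr
  set d : ℕ → Fin n → Rn n →ᵇ ℝ := fun k j => toBdd (pderiv j (regularize φ s ((k : ℝ) + 1)⁻¹))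
    ((hr1 k).continuous_pderiv j)
    ⟨_, hφ.abs_pderiv_regularize_le_const hs1 (fun x => (hssq x).le) hsd (hδ k) j⟩ with hd
  have hr0 : ∀ k x, 0 ≤ r k x := fun k x =>
    mul_nonneg (hs0 x) (inv_nonneg.mpr (by linarith [one_le_regularizer φ (hδ k).le x]))
  have hrs : ∀ k x, r k x ≤ s x := fun k x => by
    have := abs_regularize_le_abs φ s (hδ k).le x
    rw [abs_of_nonneg (hs0 x)] at this
    exact (le_abs_self _).trans this
  have hsi : Integrable fun x => s x * ‖u 0 x‖ ^ 2 := by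
    refine ((integrable_norm_sq (u 0)).add hφ0.norm).mono'
      (hs1.continuous.aestronglyMeasurable.mul (integrable_norm_sq (u 0)).1)
      (Eventually.of_forall fun x => ?_)
    have : s x ≤ 1 + |φ x| := Real.sqrt_le_iff.mpr
      ⟨by positivity, by nlinarith [abs_nonneg (φ x), sq_abs (φ x)]⟩
    simp only [norm_mul, Real.norm_eq_abs, abs_of_nonneg (hs0 x), Pi.add_apply, abs_pow, abs_norm]
    nlinarith [sq_nonneg ‖u 0 x‖]
  have hder : ∀ k t', HasDerivAt (fun t => ∫ x, r k x * ‖u t x‖ ^ 2)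
      (2 * ∑ j, (⟪mulL2 (d k j) (u t'), G t' j⟫_ℂ).im) t' := fun k t' => by
    have := hF.hasDerivAt_inner_mul hA (r k) (hr1 k) (d k) (fun j x => rfl) t'
    simpa only [re_inner_mulL2_self] using this
  -- The time derivative of the regularized mass involves only its gradient, which is controlled by
  -- `|∇φ|`, so the propagated moment bounds it uniformly in `k`.
  have hbd : ∀ k t', |t'| ≤ |t| →
      ‖2 * ∑ j, (⟪mulL2 (d k j) (u t'), G t' j⟫_ℂ).im‖ ≤ 2 * (n * (√(L ^ 2 * M) * K)) :=
    fun k t' ht' => by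
      rw [norm_mul, Real.norm_eq_abs, Real.norm_eq_abs, abs_two]
      gcongr
      calc |∑ j, (⟪mulL2 (d k j) (u t'), G t' j⟫_ℂ).im| ≤ ∑ j : Fin n, √(L ^ 2 * M) * K := by
            refine (Finset.abs_sum_le_sum_abs _ _).trans (Finset.sum_le_sum fun j _ => ?_)
            refine (Complex.abs_im_le_norm _).trans ((norm_inner_le_norm _ _).trans ?_)
            refine mul_le_mul ?_ (hK t' j) (norm_nonneg _) (by positivity)
            have := norm_mulL2_sq_le (c := d k j) (u := u t') (w := fun x => L ^ 2 * gradSq φ x) (by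
              simpa only [mul_assoc] using (hM t' ht').1.const_mul (L ^ 2)) fun x =>
                sq_le_of_abs_le_mul_sqrt (gradSq_nonneg φ x)
                  (hφ.abs_pderiv_regularize_le_sqrt hs1 (fun x => (hssq x).le) hsd (hδ k).le j x)
            simp only [mul_assoc, integral_const_mul] at this
            exact Real.le_sqrt_of_sq_le (this.trans (by gcongr; exact (hM t' ht').2))
        _ = n * (√(L ^ 2 * M) * K) := by simp
  have hle : ∀ k, ∫ x, r k x * ‖u t x‖ ^ 2 ≤
      (∫ x, s x * ‖u 0 x‖ ^ 2) + 2 * (n * (√(L ^ 2 * M) * K)) * |t| := fun k => by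
    have h1 := (convex_Icc (-|t|) |t|).norm_image_sub_le_of_norm_hasDerivWithin_le
      (fun t' _ => (hder k t').hasDerivWithinAt) (fun t' ht' => hbd k t' (abs_le.mpr ht'))
      (x := 0) (y := t) ⟨by simp, by simp⟩ (abs_le.mp le_rfl)
    have h2 : ∫ x, r k x * ‖u 0 x‖ ^ 2 ≤ ∫ x, s x * ‖u 0 x‖ ^ 2 :=
      integral_mono_of_nonneg (Eventually.of_forall fun x => mul_nonneg (hr0 k x) (by positivity))
        hsi (Eventually.of_forall fun x => mul_le_mul_of_nonneg_right (hrs k x) (by positivity))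
    rw [sub_zero, Real.norm_eq_abs, Real.norm_eq_abs] at h1
    linarith [le_abs_self ((∫ x, r k x * ‖u t x‖ ^ 2) - ∫ x, r k x * ‖u 0 x‖ ^ 2)]
  have hfin := (integrable_mul_norm_sq_of_tendsto hr0 (fun x => tendsto_regularize φ s x) hle).1
  refine hfin.mono' (hφ1.continuous.aestronglyMeasurable.mul (integrable_norm_sq (u t)).1)
    (Eventually.of_forall fun x => ?_)
  rw [norm_mul, norm_pow, norm_norm]
  exact mul_le_mul_of_nonneg_right (hφs x) (by positivity)

/-- The regularized masses converge for each time, and their derivatives converge locally uniformly: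
the gradient error divided by `√(1 + |∇φ|²)` is bounded and tends to zero, and it acts on the
continuous curve `∇_A u`. -/
theorem hasDerivAt_thetaS (hF : IsFlow A V u G g v) (hn : n ≠ 0) (hA : LocallySquareIntegrable A)
    (hKR : IsKatoRellich A V) (hφ : IsMultiplier φ C)
    (h0 : Integrable fun x => gradSq φ x * ‖u 0 x‖ ^ 2)
    (hφ0 : Integrable fun x => φ x * ‖u 0 x‖ ^ 2) (t : ℝ) :
    HasDerivAt (thetaS φ u)
      (2 * ∑ j, (∫ x, ((pderiv j φ x : ℝ) : ℂ) * (conj (u t x) * G t j x)).im) t := by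
  obtain ⟨M, hM⟩ := hF.exists_weight_moment_le hA hKR hφ h0 (|t| + 1)
  have hC := hφ.nonneg
  set L : ℝ := 3 + 2 * n * C with hL
  have hL0 : 0 ≤ L := by positivity
  have hφ1 : ContDiff ℝ 1 φ := hφ.contDiff.of_le (by norm_num)
  have hsq : ∀ x, φ x ^ 2 ≤ 1 + φ x ^ 2 := fun x => by linarith
  have hgr := abs_pderiv_le_sqrt_gradSq φ
  have hδ : ∀ k : ℕ, (0 : ℝ) < ((k : ℝ) + 1)⁻¹ := fun k => by positivity
  have hr1 := fun k => hφ.contDiff_regularize hφ1 (hδ k).le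
  set r : ℕ → Rn n →ᵇ ℝ := fun k => toBdd (regularize φ φ ((k : ℝ) + 1)⁻¹) (hr1 k).continuous
    ⟨_, IsMultiplier.abs_regularize_le_const hsq (hδ k)⟩ with hr
  set d : ℕ → Fin n → Rn n →ᵇ ℝ := fun k j => toBdd (pderiv j (regularize φ φ ((k : ℝ) + 1)⁻¹))
    ((hr1 k).continuous_pderiv j)
    ⟨_, hφ.abs_pderiv_regularize_le_const hφ1 hsq hgr (hδ k) j⟩ with hd
  have hcc : ∀ k j, Continuous fun x => d k j x - pderiv j φ x := fun k j =>
    (d k j).continuous.sub (hφ1.continuous_pderiv j)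
  have hcL : ∀ k j x, |d k j x - pderiv j φ x| ≤ (L + 1) * √(gradSq φ x) := fun k j x => by
    refine (abs_sub _ _).trans ?_
    rw [add_one_mul]
    exact add_le_add (hφ.abs_pderiv_regularize_le_sqrt hφ1 hsq hgr (hδ k).le j x) (hgr j x)
  have hsmall : ∀ ε > 0, ∀ᶠ k in atTop, ∀ j, ∀ t' ∈ Set.Icc (-(|t| + 1)) (|t| + 1),
      ‖mulL2 (hφ.divWeight (hcc k j) (hcL k j)) (G t' j)‖ < ε := fun ε hε => by
    rw [eventually_all]
    intro j
    refine eventually_norm_mulL2_lt hn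
      (fun k => hφ.abs_divWeight_le (hcc k j) (by positivity) (hcL k j)) (fun x _ => ?_)
      (hF.continuous_grad hA hKR j) isCompact_Icc hε
    have := ((hφ.tendsto_pderiv_regularize hφ1 j x).sub_const (pderiv j φ x)).div_const
      (gradWeight φ x)
    simpa [hφ.divWeight_apply, hd] using this
  refine hasDerivAt_of_tendstoUniformlyOn (l := atTop) (s := Set.Ioo (-(|t| + 1)) (|t| + 1))
    (f := fun k t => (⟪mulL2 (r k) (u t), u t⟫_ℂ).re)
    (f' := fun k t => 2 * ∑ j, (⟪mulL2 (d k j) (u t), G t j⟫_ℂ).im)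
    (g' := fun t => 2 * ∑ j, (∫ x, ((pderiv j φ x : ℝ) : ℂ) * (conj (u t x) * G t j x)).im)
    isOpen_Ioo ?_ (Eventually.of_forall fun k t' _ =>
      hF.hasDerivAt_inner_mul hA (r k) (hr1 k) (d k) (fun j x => rfl) t') (fun t' _ => ?_)
    ⟨by linarith [neg_abs_le t], by linarith [le_abs_self t]⟩
  · rw [Metric.tendstoUniformlyOn_iff]
    intro ε hε
    -- The `+ 1` makes the division legitimate even if `M` vanishes, and makes the final inequality
    -- strict.
    have hp : 0 < 2 * (n * √M) + 1 := by positivity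
    filter_upwards [hsmall (ε / (2 * (n * √M) + 1)) (by positivity)] with k hk t' ht'
    have hIcc := Set.Ioo_subset_Icc_self ht'
    obtain ⟨hi, hMt⟩ := hM t' (abs_le.mpr hIcc)
    rw [dist_comm, Real.dist_eq, ← mul_sub, ← Finset.sum_sub_distrib, abs_mul, abs_two]
    have hj : ∀ j, |(⟪mulL2 (d k j) (u t'), G t' j⟫_ℂ).im -
        (∫ x, ((pderiv j φ x : ℝ) : ℂ) * (conj (u t' x) * G t' j x)).im| ≤
        √M * (ε / (2 * (n * √M) + 1)) := fun j => by
      have hi2 := hφ.integrable_mul_conj_mul (hφ1.continuous_pderiv j) (L := 1)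
        (fun x => by simpa using hgr j x) hi (G t' j)
      rw [inner_mulL2_left, ← Complex.sub_im,
        ← integral_sub (integrable_bdd_mul_conj_mul (d k j) (u t') (G t' j)) hi2]
      simp only [← sub_mul, ← Complex.ofReal_sub]
      refine (Complex.abs_im_le_norm _).trans
        ((hφ.norm_integral_mul_conj_mul_le (hcc k j) (hcL k j) hi hMt (G t' j)).trans ?_)
      exact mul_le_mul_of_nonneg_left (hk j t' hIcc).le (Real.sqrt_nonneg _)
    calc 2 * |∑ j, ((⟪mulL2 (d k j) (u t'), G t' j⟫_ℂ).im -
          (∫ x, ((pderiv j φ x : ℝ) : ℂ) * (conj (u t' x) * G t' j x)).im)|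
        ≤ 2 * ∑ _j : Fin n, √M * (ε / (2 * (n * √M) + 1)) := by
          gcongr
          exact (Finset.abs_sum_le_sum_abs _ _).trans (Finset.sum_le_sum fun j _ => hj j)
      _ = ε * (2 * (n * √M) / (2 * (n * √M) + 1)) := by
          simp
          ring
      _ < ε := by
          refine mul_lt_of_lt_one_right hε ?_
          rw [div_lt_one hp]
          linarith
  · simp only [re_inner_mulL2_self]
    refine tendsto_integral_of_dominated_convergence (fun x => ‖φ x * ‖u t' x‖ ^ 2‖)
      (fun k => (integrable_bdd_mul_norm_sq (r k) (u t')).1)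
      (hF.integrable_multiplier hA hKR hφ h0 hφ0 t').norm
      (fun k => Eventually.of_forall fun x => ?_)
      (Eventually.of_forall fun x => (tendsto_regularize φ φ x).mul_const _)
    rw [norm_mul, norm_mul]
    exact mul_le_mul_of_nonneg_right (abs_regularize_le_abs φ φ (hδ k).le x) (norm_nonneg _)

end IsFlow

end FirstDerivative

/-! ### The bi-Laplacian term for a cut-off gradient field. -/

section CutoffDivergence

open Filter Topology BoundedContinuousFunction

variable {n : ℕ} {A : Rn n → Rn n} {φ : Rn n → ℝ} {C : ℝ}

/-- The Laplacian in coordinates. -/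
noncomputable def coordLaplacian (φ : Rn n → ℝ) (x : Rn n) : ℝ :=
  ∑ k, pderiv k (pderiv k φ) x

/-- The divergence of the truncated gradient. -/
noncomputable def cutDiv (φ : Rn n → ℝ) (s : ℝ) (x : Rn n) : ℝ :=
  ∑ k, pderiv k (cutField φ s k) x

/-- The function `∇χ · ∇φ` for the cut-off `χ` at scale `s⁻¹`. -/
noncomputable def cutTransition (φ : Rn n → ℝ) (s : ℝ) (x : Rn n) : ℝ :=
  ∑ k, pderiv k (scaledBump n s) x * pderiv k φ x

theorem contDiff_pderiv_scaledBump (s : ℝ) (j : Fin n) (m : ℕ) :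
    ContDiff ℝ m (pderiv j (scaledBump n s)) :=
  ((contDiff_scaledBump s).contDiff_pderiv (m := ∞) (by simp) j).of_le
    (WithTop.coe_le_coe.mpr le_top)

theorem pderiv_scaledBump_zero (s : ℝ) (j : Fin n) : pderiv j (scaledBump n s) 0 = 0 := by
  rw [(scaledBump_eventuallyEq_one (s := s) (x := (0 : Rn n)) (by simp)).pderiv_eq j]
  simp [pderiv]

/-- Integrated form of `2 Re (ū ∇_A u) = ∇|u|²`, in which the potential drops out. -/
theorem HasMagneticGradient.two_mul_re_integral (hn : n ≠ 0) (hA : LocallySquareIntegrable A)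
    (hA1 : ContDiffOn ℝ 1 A {0}ᶜ) {u : L2 n} {G : Fin n → L2 n}
    (h : HasMagneticGradient A u G) (j : Fin n) {Z : Rn n → ℝ} (hZ : ContDiff ℝ 1 Z)
    (hc : HasCompactSupport Z) (h0 : Z 0 = 0) :
    2 * (∫ x, (Z x : ℂ) * (conj (u x) * G j x)).re =
      -(∫ x, ((pderiv j Z x : ℝ) : ℂ) * (conj (u x) * u x)).re := by
  have e := congrArg Complex.re (h.integral_parts hn hA hA1 h j hZ hc h0)
  have e2 : ∫ x, (Z x : ℂ) * (conj (G j x) * u x) =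
      conj (∫ x, (Z x : ℂ) * (conj (u x) * G j x)) := by
    rw [← integral_conj]
    congr 1 with x
    simp only [map_mul, Complex.conj_ofReal, Complex.conj_conj]
    ring
  rw [e2, Complex.add_re, Complex.conj_re, Complex.neg_re] at e
  linarith

namespace IsMultiplier

theorem contDiff_coordLaplacian (h : IsMultiplier φ C) : ContDiff ℝ 2 (coordLaplacian φ) :=
  ContDiff.sum fun k _ => (h.contDiff_grad k).contDiff_pderiv (by norm_num) k

theorem biLaplacian_eq (h : IsMultiplier φ C) (x : Rn n) :
    biLaplacian φ x = ∑ j, pderiv j (pderiv j (coordLaplacian φ)) x := by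
  have e : Laplacian.laplacian φ = coordLaplacian φ :=
    funext fun y => laplacian_eq_sum_pderiv (h.contDiff.of_le (by norm_num)) y
  rw [biLaplacian, e, laplacian_eq_sum_pderiv h.contDiff_coordLaplacian]

theorem abs_coordLaplacian_le (h : IsMultiplier φ C) (x : Rn n) :
    |coordLaplacian φ x| ≤ n * C := by
  refine (Finset.abs_sum_le_sum_abs _ _).trans
    ((Finset.sum_le_sum fun k _ => h.hess_le x k k).trans ?_)
  simp

theorem contDiff_cutTransition (h : IsMultiplier φ C) (s : ℝ) : ContDiff ℝ 1 (cutTransition φ s) :=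
  ContDiff.sum fun k _ => (contDiff_pderiv_scaledBump s k 1).mul
    ((h.contDiff_grad k).of_le (by norm_num))

theorem cutDiv_eq (h : IsMultiplier φ C) (s : ℝ) :
    cutDiv φ s = fun x => cutTransition φ s x + scaledBump n s x * coordLaplacian φ x := by
  ext x
  simp only [cutDiv, h.pderiv_cutField, Finset.sum_add_distrib, cutTransition, coordLaplacian,
    Finset.mul_sum]

theorem contDiff_cutDiv (h : IsMultiplier φ C) (s : ℝ) : ContDiff ℝ 1 (cutDiv φ s) :=
  ContDiff.sum fun k _ => (h.contDiff_cutField s k).contDiff_pderiv (by norm_num) k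

theorem hasCompactSupport_cutDiv (φ : Rn n → ℝ) {s : ℝ} (hs : s ≠ 0) :
    HasCompactSupport (cutDiv φ s) :=
  HasCompactSupport.intro (hasCompactSupport_scaledBump (n := n) hs) fun _ hx =>
    Finset.sum_eq_zero fun k _ => pderiv_of_notMem_tsupport
      (fun h => hx (tsupport_mul_subset_left h)) k

theorem pderiv_cutDiv (h : IsMultiplier φ C) (s : ℝ) (j : Fin n) (x : Rn n) :
    pderiv j (cutDiv φ s) x = pderiv j (cutTransition φ s) x +
      (pderiv j (scaledBump n s) x * coordLaplacian φ x +
        scaledBump n s x * pderiv j (coordLaplacian φ) x) := by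
  have h1 := (contDiff_scaledBump (n := n) s).differentiable (by simp) x
  have h2 := h.contDiff_coordLaplacian.differentiable (by norm_num) x
  rw [h.cutDiv_eq, pderiv_add ((h.contDiff_cutTransition s).differentiable one_ne_zero x)
    (h1.fun_mul h2), pderiv_mul h1 h2]

/-- The coefficient of `conj u (∇_A u)ⱼ` in the cut-off error. -/
noncomputable def _root_.cutError (φ : Rn n → ℝ) (s : ℝ) (j : Fin n) (x : Rn n) : ℝ :=
  2 * (pderiv j (scaledBump n s) x * coordLaplacian φ x) + pderiv j (cutTransition φ s) x

/-- The coefficient of `|u|²` in the cut-off error. -/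
noncomputable def _root_.cutErrorZero (φ : Rn n → ℝ) (s : ℝ) (j : Fin n) (x : Rn n) : ℝ :=
  pderiv j (pderiv j (scaledBump n s)) x * coordLaplacian φ x

theorem continuous_cutError (h : IsMultiplier φ C) (s : ℝ) (j : Fin n) :
    Continuous (cutError φ s j) :=
  (continuous_const.mul ((contDiff_pderiv_scaledBump s j 0).continuous.mul
    h.contDiff_coordLaplacian.continuous)).add ((h.contDiff_cutTransition s).continuous_pderiv j)

theorem continuous_cutErrorZero (h : IsMultiplier φ C) (s : ℝ) (j : Fin n) :
    Continuous (cutErrorZero φ s j) :=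
  ((contDiff_pderiv_scaledBump s j 1).continuous_pderiv j).mul h.contDiff_coordLaplacian.continuous

/-- Each error term carries a derivative of the cut-off. First derivatives are `O(s)` against the
bounded Hessian, and second derivatives are `O(s)` against `∇φ = O(‖x‖)`. No third derivative of `φ`
occurs, and none is assumed bounded. -/
theorem exists_cutError_le (h : IsMultiplier φ C) : ∃ E, 0 ≤ E ∧ ∀ s, 0 < s → s ≤ 1 → ∀ j x,
    |cutError φ s j x| ≤ E * s ∧ |cutErrorZero φ s j x| ≤ E * s := by
  obtain ⟨B, hB0, hB⟩ := exists_scaledBump_bound n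
  have hC := h.nonneg
  refine ⟨4 * n * B * C, by positivity, fun s hs hs1 j x => ⟨?_, ?_⟩⟩
  · have hd : ∀ k, DifferentiableAt ℝ (pderiv k (scaledBump n s)) x := fun k =>
      (contDiff_pderiv_scaledBump s k 1).differentiable one_ne_zero x
    have hg : ∀ k, DifferentiableAt ℝ (pderiv k φ) x := fun k =>
      (h.contDiff_grad k).differentiable (by norm_num) x
    have e : pderiv j (cutTransition φ s) x = ∑ k, (pderiv j (pderiv k (scaledBump n s)) x *
        pderiv k φ x + pderiv k (scaledBump n s) x * pderiv j (pderiv k φ) x) := by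
      have : cutTransition φ s = fun y => ∑ k, pderiv k (scaledBump n s) y * pderiv k φ y := rfl
      rw [this, pderiv_sum fun k _ => (hd k).fun_mul (hg k)]
      exact Finset.sum_congr rfl fun k _ => pderiv_mul (hd k) (hg k) j
    have h1 : |pderiv j (cutTransition φ s) x| ≤ n * (2 * B * C * s) := by
      rw [e]
      calc _ ≤ ∑ _k : Fin n, 2 * B * C * s := by
            refine (Finset.abs_sum_le_sum_abs _ _).trans (Finset.sum_le_sum fun k _ => ?_)
            refine (abs_add_le _ _).trans ?_
            rw [abs_mul, abs_mul]
            have b := hB s x j k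
            rw [abs_of_pos hs] at b
            have a1 : |pderiv j (pderiv k (scaledBump n s)) x| * |pderiv k φ x| ≤ B * s * C := by
              calc _ ≤ |pderiv j (pderiv k (scaledBump n s)) x| * (C * ‖x‖) := by
                    gcongr
                    exact h.grad_le x k
                _ = |pderiv j (pderiv k (scaledBump n s)) x| * ‖x‖ * C := by ring
                _ ≤ B * s * C := mul_le_mul_of_nonneg_right b.2.2.2 hC
            have a2 : |pderiv k (scaledBump n s) x| * |pderiv j (pderiv k φ) x| ≤ B * s * C :=
              mul_le_mul b.1 (h.hess_le x j k) (abs_nonneg _) (by positivity)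
            linarith
        _ = n * (2 * B * C * s) := by simp
    have b := hB s x j j
    rw [abs_of_pos hs] at b
    have h2 : |pderiv j (scaledBump n s) x * coordLaplacian φ x| ≤ B * s * (n * C) := by
      rw [abs_mul]
      exact mul_le_mul b.1 (h.abs_coordLaplacian_le x) (abs_nonneg _) (by positivity)
    refine (abs_add_le _ _).trans ?_
    rw [abs_mul, abs_two]
    linarith
  · have b := hB s x j j
    rw [abs_of_pos hs] at b
    rw [cutErrorZero, abs_mul]
    calc _ ≤ B * s ^ 2 * (n * C) :=
          mul_le_mul b.2.2.1 (h.abs_coordLaplacian_le x) (abs_nonneg _) (by positivity)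
      _ ≤ B * s * (n * C) := by
          gcongr
          nlinarith
      _ ≤ 4 * n * B * C * s := by
          have : 0 ≤ n * B * C * s := by positivity
          linarith

/-- Integration by parts in the bi-Laplacian term, with a cut-off. -/
theorem sum_re_integral_cutDiv (h : IsMultiplier φ C) (hn : n ≠ 0)
    (hA : LocallySquareIntegrable A) (hA1 : ContDiffOn ℝ 1 A {0}ᶜ) {u : L2 n} {G : Fin n → L2 n}
    (hu : HasMagneticGradient A u G) {s : ℝ} (hs : s ≠ 0) :
    2 * ∑ j, (∫ x, ((pderiv j (cutDiv φ s) x : ℝ) : ℂ) * (conj (u x) * G j x)).re =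
      -(∫ x, (scaledBump n s x : ℂ) * biLaplacianTerm φ u x).re +
      ∑ j, ((∫ x, (cutErrorZero φ s j x : ℂ) * (conj (u x) * u x)).re +
        2 * (∫ x, (cutError φ s j x : ℂ) * (conj (u x) * G j x)).re) := by
  have hbc := hasCompactSupport_scaledBump (n := n) hs
  have hl2 := h.contDiff_coordLaplacian
  have hl1 : ContDiff ℝ 1 (coordLaplacian φ) := hl2.of_le (by norm_num)
  have hdl : ∀ j, ContDiff ℝ 1 (pderiv j (coordLaplacian φ)) := fun j =>
    hl2.contDiff_pderiv (by norm_num) j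
  have hb1 : ContDiff ℝ 1 (scaledBump n s) := (contDiff_scaledBump s).of_le (by simp)
  have hdb := fun j => contDiff_pderiv_scaledBump (n := n) s j 1
  -- The gradient of the divergence is written as `Z₁ - Z₂` plus an error. Subtracting `Z₂` before
  -- integrating by parts makes the mixed terms `∂ⱼχ ∂ⱼΔφ` cancel, which contain uncontrolled third
  -- derivatives.
  set Z₁ : Fin n → Rn n → ℝ := fun j x => scaledBump n s x * pderiv j (coordLaplacian φ) x with hZ₁
  set Z₂ : Fin n → Rn n → ℝ := fun j x => pderiv j (scaledBump n s) x * coordLaplacian φ x with hZ₂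
  have cZ₁ : ∀ j, ContDiff ℝ 1 (Z₁ j) := fun j => hb1.mul (hdl j)
  have cZ₂ : ∀ j, ContDiff ℝ 1 (Z₂ j) := fun j => (hdb j).mul hl1
  have sZ₁ : ∀ j, HasCompactSupport (Z₁ j) := fun j => hbc.mul_right
  have sZ₂ : ∀ j, HasCompactSupport (Z₂ j) := fun j => (hbc.pderiv j).mul_right
  -- Integration by parts across the origin needs both multipliers to vanish there: `∇Δφ` does by
  -- parity, and `∇χ` because the cut-off is constant near `0`.
  have e1 := fun j => hu.two_mul_re_integral hn hA hA1 j (cZ₁ j) (sZ₁ j) (by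
    have := h.pderiv_lap_zero j
    change scaledBump n s 0 * pderiv j (fun x => ∑ k, pderiv k (pderiv k φ) x) 0 = 0
    rw [this, mul_zero])
  have e2 := fun j => hu.two_mul_re_integral hn hA hA1 j (cZ₂ j) (sZ₂ j) (by
    simp only [hZ₂, pderiv_scaledBump_zero, zero_mul])
  have i1 : ∀ {c : Rn n → ℝ}, Continuous c → HasCompactSupport c → ∀ f g : L2 n,
      Integrable fun x => (c x : ℂ) * (conj (f x) * g x) := fun hc hs f g =>
    integrable_bdd_mul_conj_mul (toBddOfCompact _ hc hs) f g
  have sE : ∀ j, HasCompactSupport (cutError φ s j) := fun j =>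
    HasCompactSupport.intro hbc fun x hx => by
      have hx' : x ∉ tsupport (cutTransition φ s) := fun hm => hx
        (closure_minimal (fun y hy => by
          by_contra hyt
          exact hy (Finset.sum_eq_zero fun k _ => by rw [pderiv_of_notMem_tsupport hyt, zero_mul]))
          (isClosed_tsupport _) hm)
      rw [cutError, pderiv_of_notMem_tsupport hx, pderiv_of_notMem_tsupport hx']
      simp
  have sE0 : ∀ j, HasCompactSupport (cutErrorZero φ s j) := fun j =>
    ((hbc.pderiv j).pderiv j).mul_right
  have e3 : ∀ j, ∫ x, ((pderiv j (cutDiv φ s) x : ℝ) : ℂ) * (conj (u x) * G j x) =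
      (∫ x, (Z₁ j x : ℂ) * (conj (u x) * G j x)) - (∫ x, (Z₂ j x : ℂ) * (conj (u x) * G j x)) +
        ∫ x, (cutError φ s j x : ℂ) * (conj (u x) * G j x) := fun j => by
    have k1 := i1 (cZ₁ j).continuous (sZ₁ j) u (G j)
    have k2 := i1 (cZ₂ j).continuous (sZ₂ j) u (G j)
    have k12 : Integrable fun x => (Z₁ j x : ℂ) * (conj (u x) * G j x) -
        (Z₂ j x : ℂ) * (conj (u x) * G j x) := k1.sub k2
    rw [← integral_sub k1 k2,
      ← integral_add k12 (i1 (h.continuous_cutError s j) (sE j) u (G j))]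
    congr 1 with x
    simp only [h.pderiv_cutDiv, hZ₁, hZ₂, cutError]
    push_cast
    ring
  have cB : ∀ j, Continuous fun x => scaledBump n s x * pderiv j (pderiv j (coordLaplacian φ)) x :=
    fun j => hb1.continuous.mul ((hdl j).continuous_pderiv j)
  have e4 : ∀ j, (∫ x, ((pderiv j (Z₁ j) x : ℝ) : ℂ) * (conj (u x) * u x)) -
      (∫ x, ((pderiv j (Z₂ j) x : ℝ) : ℂ) * (conj (u x) * u x)) =
      (∫ x, ((scaledBump n s x * pderiv j (pderiv j (coordLaplacian φ)) x : ℝ) : ℂ) *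
        (conj (u x) * u x)) - ∫ x, (cutErrorZero φ s j x : ℂ) * (conj (u x) * u x) := fun j => by
    rw [← integral_sub (i1 ((cZ₁ j).continuous_pderiv j) ((sZ₁ j).pderiv j) u u)
      (i1 ((cZ₂ j).continuous_pderiv j) ((sZ₂ j).pderiv j) u u),
      ← integral_sub (i1 (cB j) hbc.mul_right u u)
        (i1 (h.continuous_cutErrorZero s j) (sE0 j) u u)]
    congr 1 with x
    rw [show pderiv j (Z₁ j) x = _ from pderiv_mul (hb1.differentiable one_ne_zero x)
        ((hdl j).differentiable one_ne_zero x) j,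
      show pderiv j (Z₂ j) x = _ from pderiv_mul ((hdb j).differentiable one_ne_zero x)
        (hl1.differentiable one_ne_zero x) j, cutErrorZero]
    push_cast
    ring
  have e5 : ∫ x, (scaledBump n s x : ℂ) * biLaplacianTerm φ u x =
      ∑ j, ∫ x, ((scaledBump n s x * pderiv j (pderiv j (coordLaplacian φ)) x : ℝ) : ℂ) *
        (conj (u x) * u x) := by
    rw [← integral_finsetSum _ fun j _ => i1 (cB j) hbc.mul_right u u]
    congr 1 with x
    rw [biLaplacianTerm, h.biLaplacian_eq, ← Finset.sum_mul, Complex.conj_mul']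
    push_cast
    rw [← Finset.mul_sum]
    ring
  rw [e5, Complex.re_sum, Finset.mul_sum, ← Finset.sum_neg_distrib, ← Finset.sum_add_distrib]
  refine Finset.sum_congr rfl fun j _ => ?_
  have e4' := congrArg Complex.re (e4 j)
  rw [e3 j]
  simp only [Complex.add_re, Complex.sub_re] at e4' ⊢
  linarith [e1 j, e2 j]

theorem exists_cutDiv_error_le (h : IsMultiplier φ C) (hn : n ≠ 0)
    (hA : LocallySquareIntegrable A) (hA1 : ContDiffOn ℝ 1 A {0}ᶜ) : ∃ E, 0 ≤ E ∧
      ∀ s, 0 < s → s ≤ 1 → ∀ (u : L2 n) (G : Fin n → L2 n), HasMagneticGradient A u G →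
        |2 * ∑ j, (∫ x, ((pderiv j (cutDiv φ s) x : ℝ) : ℂ) * (conj (u x) * G j x)).re +
          (∫ x, (scaledBump n s x : ℂ) * biLaplacianTerm φ u x).re| ≤
        s * ∑ j, (E * ‖u‖ * ‖u‖ + 2 * (E * ‖u‖ * ‖G j‖)) := by
  obtain ⟨E, hE0, hE⟩ := h.exists_cutError_le
  refine ⟨E, hE0, fun s hs hs1 u G hu => ?_⟩
  rw [h.sum_re_integral_cutDiv hn hA hA1 hu hs.ne', neg_add_cancel_comm, Finset.mul_sum]
  refine (Finset.abs_sum_le_sum_abs _ _).trans (Finset.sum_le_sum fun j _ => ?_)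
  have h1 := _root_.norm_integral_mul_conj_mul_le (toBdd _ (h.continuous_cutErrorZero s j)
    ⟨_, fun x => (hE s hs hs1 j x).2⟩) (fun x => (hE s hs hs1 j x).2) u u
  have h2 := _root_.norm_integral_mul_conj_mul_le (toBdd _ (h.continuous_cutError s j)
    ⟨_, fun x => (hE s hs hs1 j x).1⟩) (fun x => (hE s hs hs1 j x).1) u (G j)
  simp only [toBdd_apply] at h1 h2
  refine (abs_add_le _ _).trans ?_
  rw [abs_mul, abs_two]
  have h1' := (Complex.abs_re_le_norm _).trans h1
  have h2' := (Complex.abs_re_le_norm _).trans h2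
  linarith

end IsMultiplier

end CutoffDivergence

/-! ### Removing the cut-off from the derivative of the action. -/

section SecondDerivative

open Filter Topology BoundedContinuousFunction

variable {n : ℕ} {A : Rn n → Rn n} {V : Rn n → ℝ} {φ : Rn n → ℝ} {C : ℝ}

theorem inv_natCast_add_one_le_one (k : ℕ) : ((k : ℝ) + 1)⁻¹ ≤ 1 :=
  inv_le_one_of_one_le₀ (by linarith [(Nat.cast_nonneg k : (0 : ℝ) ≤ k)])

theorem integrable_scaledBump_mul {F : Rn n → ℂ} (hF : Integrable F) (s : ℝ) :
    Integrable fun x => (scaledBump n s x : ℂ) * F x :=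
  hF.bdd_mul (c := 1)
    (Complex.continuous_ofReal.comp (contDiff_scaledBump s).continuous).aestronglyMeasurable
    (Eventually.of_forall fun x => by
      rw [Complex.norm_real]
      exact abs_scaledBump_le_one s x)

namespace IsMultiplier

theorem tendsto_pderiv_cutField (j l : Fin n) (x : Rn n) :
    Tendsto (fun k : ℕ => pderiv j (cutField φ ((k : ℝ) + 1)⁻¹ l) x) atTop
      (𝓝 (pderiv j (pderiv l φ) x)) := by
  refine tendsto_const_nhds.congr' ?_
  filter_upwards [tendsto_natCast_atTop_atTop.eventually_ge_atTop ‖x‖] with k hk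
  refine (Filter.EventuallyEq.pderiv_eq ?_ j).symm
  have hp : (0 : ℝ) < k + 1 := by positivity
  have h1 : |((k : ℝ) + 1)⁻¹| * ‖x‖ < 1 := by
    rw [abs_of_pos (by positivity), inv_mul_lt_iff₀ hp]
    linarith
  filter_upwards [scaledBump_eventuallyEq_one h1] with y hy
  rw [cutField, hy, one_mul]

/-- The Hessian as bounded continuous functions. -/
noncomputable def hess (h : IsMultiplier φ C) (j k : Fin n) : Rn n →ᵇ ℝ :=
  toBdd (pderiv j (pderiv k φ)) (((h.contDiff_grad k).of_le (by norm_num)).continuous_pderiv j)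
    ⟨C, fun x => h.hess_le x j k⟩

theorem hess_apply (h : IsMultiplier φ C) (j k : Fin n) (x : Rn n) :
    h.hess j k x = pderiv j (pderiv k φ) x := rfl

theorem hessianTerm_eq (h : IsMultiplier φ C) (G : Fin n → L2 n) (x : Rn n) :
    hessianTerm φ G x = ∑ j, ∑ k, (h.hess j k x : ℂ) * (conj (G j x) * G k x) := by
  rw [hessianTerm, Finset.sum_comm]
  refine Finset.sum_congr rfl fun j _ => Finset.sum_congr rfl fun k _ => ?_
  rw [h.hess_apply, pderiv_comm (h.contDiff.of_le (by norm_num)), hessian, Matrix.of_apply]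
  ring

theorem integrable_hessianTerm (h : IsMultiplier φ C) (G : Fin n → L2 n) :
    Integrable (hessianTerm φ G) := by
  rw [show hessianTerm φ G = _ from funext (h.hessianTerm_eq G)]
  exact integrable_finsetSum _ fun j _ => integrable_finsetSum _ fun k _ =>
    integrable_bdd_mul_conj_mul (h.hess j k) (G j) (G k)

/-- A real symmetric matrix defines a Hermitian form, so the integral is real. This reconciles the
complex integral of the theorem with the real parts produced by the virial identity. -/
theorem integral_hessianTerm (h : IsMultiplier φ C) (G : Fin n → L2 n) :
    ∫ x, hessianTerm φ G x =
      ((∑ j, ∑ k, (∫ x, ((pderiv j (pderiv k φ) x : ℝ) : ℂ) * (conj (G j x) * G k x)).re : ℝ) :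
        ℂ) := by
  have hi : ∀ j k, Integrable fun x => (h.hess j k x : ℂ) * (conj (G j x) * G k x) := fun j k =>
    integrable_bdd_mul_conj_mul (h.hess j k) (G j) (G k)
  have e : ∫ x, hessianTerm φ G x =
      ∑ j, ∑ k, ∫ x, ((pderiv j (pderiv k φ) x : ℝ) : ℂ) * (conj (G j x) * G k x) := by
    simp only [h.hessianTerm_eq]
    rw [integral_finsetSum _ fun j _ => integrable_finsetSum _ fun k _ => hi j k]
    exact Finset.sum_congr rfl fun j _ => integral_finsetSum _ fun k _ => hi j k
  have hr : conj (∫ x, hessianTerm φ G x) = ∫ x, hessianTerm φ G x := by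
    rw [← integral_conj]
    congr 1 with x
    conv_lhs => rw [h.hessianTerm_eq]
    simp only [hessianTerm, map_sum, map_mul, Complex.conj_ofReal, Complex.conj_conj,
      h.hess_apply, hessian, Matrix.of_apply]
    exact Finset.sum_congr rfl fun j _ => Finset.sum_congr rfl fun k _ => by ring
  rw [← Complex.conj_eq_iff_re.mp hr, e]
  simp only [Complex.re_sum]

end IsMultiplier

namespace IsFlow

variable {u : ℝ → L2 n} {G : ℝ → Fin n → L2 n} {g v : ℝ → L2 n}

/-- The derivatives of the cut field are uniformly bounded and converge pointwise to the Hessian.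
Acting on the continuous curve `∇_A u` they converge uniformly on compact time intervals. -/
theorem eventually_hessian_lt (hF : IsFlow A V u G g v) (hn : n ≠ 0)
    (hA : LocallySquareIntegrable A) (hKR : IsKatoRellich A V) (hφ : IsMultiplier φ C) (T : ℝ)
    {ε : ℝ} (hε : 0 < ε) : ∀ᶠ k : ℕ in atTop, ∀ t, |t| ≤ T →
      |(∑ j, ∑ l, (∫ x, ((pderiv j (cutField φ ((k : ℝ) + 1)⁻¹ l) x : ℝ) : ℂ) *
          (conj (G t j x) * G t l x)).re) -
        ∑ j, ∑ l, (∫ x, ((pderiv j (pderiv l φ) x : ℝ) : ℂ) *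
          (conj (G t j x) * G t l x)).re| < ε := by
  obtain ⟨K, hK0, hK⟩ := hF.exists_norm_grad_le hKR
  obtain ⟨L, hL0, hL⟩ := hφ.exists_pderiv_cutField_le
  have hc : ∀ (k : ℕ) j l, Continuous (pderiv j (cutField φ ((k : ℝ) + 1)⁻¹ l)) := fun k j l =>
    ((hφ.contDiff_cutField _ l).of_le (by norm_num)).continuous_pderiv j
  set d : ℕ → Fin n → Fin n → Rn n →ᵇ ℝ := fun k j l =>
    toBdd _ (hc k j l) ⟨L, hL _ j l⟩ with hd
  have hsmall : ∀ ε > 0, ∀ᶠ k in atTop, ∀ j l, ∀ t ∈ Set.Icc (-T) T,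
      ‖mulL2 (d k j l - hφ.hess j l) (G t l)‖ < ε := fun ε hε => by
    simp only [eventually_all]
    intro j l
    refine eventually_norm_mulL2_lt hn (C := L + C) (fun k x => ?_) (fun x _ => ?_)
      (hF.continuous_grad hA hKR l) isCompact_Icc hε
    · exact (abs_sub _ _).trans (add_le_add (hL _ j l x) (hφ.hess_le x j l))
    · have := (IsMultiplier.tendsto_pderiv_cutField (φ := φ) j l x).sub_const
        (pderiv j (pderiv l φ) x)
      simpa [hd, hφ.hess_apply] using this
  have hp : 0 < (n : ℝ) * (n * K) + 1 := by positivity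
  filter_upwards [hsmall (ε / (n * (n * K) + 1)) (by positivity)] with k hk t ht
  rw [← Finset.sum_sub_distrib]
  simp only [← Finset.sum_sub_distrib]
  have hjl : ∀ j l, |(∫ x, ((pderiv j (cutField φ ((k : ℝ) + 1)⁻¹ l) x : ℝ) : ℂ) *
      (conj (G t j x) * G t l x)).re - (∫ x, ((pderiv j (pderiv l φ) x : ℝ) : ℂ) *
        (conj (G t j x) * G t l x)).re| ≤ K * (ε / (n * (n * K) + 1)) := fun j l => by
    have e : (∫ x, ((pderiv j (cutField φ ((k : ℝ) + 1)⁻¹ l) x : ℝ) : ℂ) *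
        (conj (G t j x) * G t l x)) - ∫ x, ((pderiv j (pderiv l φ) x : ℝ) : ℂ) *
        (conj (G t j x) * G t l x) = ⟪G t j, mulL2 (d k j l - hφ.hess j l) (G t l)⟫_ℂ := by
      have i1 : Integrable fun x => ((pderiv j (cutField φ ((k : ℝ) + 1)⁻¹ l) x : ℝ) : ℂ) *
          (conj (G t j x) * G t l x) := integrable_bdd_mul_conj_mul (d k j l) _ _
      have i2 : Integrable fun x => ((pderiv j (pderiv l φ) x : ℝ) : ℂ) *
          (conj (G t j x) * G t l x) := integrable_bdd_mul_conj_mul (hφ.hess j l) _ _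
      rw [inner_mulL2_right, ← integral_sub i1 i2]
      congr 1 with x
      simp only [hd, BoundedContinuousFunction.sub_apply, toBdd_apply, hφ.hess_apply]
      push_cast
      ring
    rw [← Complex.sub_re, e]
    refine (Complex.abs_re_le_norm _).trans ((norm_inner_le_norm _ _).trans ?_)
    exact mul_le_mul (hK t j) (hk j l t (abs_le.mp ht)).le (norm_nonneg _) hK0
  calc _ ≤ ∑ _j : Fin n, ∑ _l : Fin n, K * (ε / (n * (n * K) + 1)) :=
        (Finset.abs_sum_le_sum_abs _ _).trans (Finset.sum_le_sum fun j _ =>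
          (Finset.abs_sum_le_sum_abs _ _).trans (Finset.sum_le_sum fun l _ => hjl j l))
    _ = ε * ((n * (n * K)) / (n * (n * K) + 1)) := by
        simp
        ring
    _ < ε := by
        refine mul_lt_of_lt_one_right hε ?_
        rw [div_lt_one hp]
        linarith

/-- The error is `s` times norms of `u` and `∇_A u` that are bounded for all times, so here
uniformity in `t` is global. -/
theorem eventually_cutDiv_lt (hF : IsFlow A V u G g v) (hn : n ≠ 0)
    (hA : LocallySquareIntegrable A) (hA1 : ContDiffOn ℝ 1 A {0}ᶜ) (hKR : IsKatoRellich A V)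
    (hφ : IsMultiplier φ C) {ε : ℝ} (hε : 0 < ε) : ∀ᶠ k : ℕ in atTop, ∀ t,
      |2 * ∑ j, (∫ x, ((pderiv j (cutDiv φ ((k : ℝ) + 1)⁻¹) x : ℝ) : ℂ) *
          (conj (u t x) * G t j x)).re +
        (∫ x, (scaledBump n ((k : ℝ) + 1)⁻¹ x : ℂ) * biLaplacianTerm φ (u t) x).re| < ε := by
  obtain ⟨K, hK0, hK⟩ := hF.exists_norm_grad_le hKR
  obtain ⟨E, hE0, hE⟩ := hφ.exists_cutDiv_error_le hn hA hA1
  set N := ∑ _j : Fin n, (E * ‖u 0‖ * ‖u 0‖ + 2 * (E * ‖u 0‖ * K)) with hN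
  have hlim : Tendsto (fun k : ℕ => ((k : ℝ) + 1)⁻¹ * N) atTop (𝓝 0) := by
    simpa using (tendsto_one_div_add_atTop_nhds_zero_nat (𝕜 := ℝ)).mul_const N
  filter_upwards [hlim.eventually_lt_const hε] with k hk t
  refine (hE _ (by positivity) (inv_natCast_add_one_le_one k) (u t) (G t) (hF.grad t)).trans_lt
    (lt_of_le_of_lt ?_ hk)
  refine mul_le_mul_of_nonneg_left (Finset.sum_le_sum fun j _ => ?_) (by positivity)
  rw [hF.norm_eq]
  gcongr
  exact hK t j

/-- The second derivative of the virial quantity. -/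
theorem hasDerivAt_gradAction (hF : IsFlow A V u G g v) (hn : n ≠ 0)
    (hA : LocallySquareIntegrable A) (hA1 : ContDiffOn ℝ 1 A {0}ᶜ) (hV : ContDiffOn ℝ 1 V {0}ᶜ)
    (hKR : IsKatoRellich A V) (hφ : IsMultiplier φ C)
    (h0 : Integrable fun x => gradSq φ x * ‖u 0 x‖ ^ 2)
    (hI2 : ConvergesLocallyUniformly (fun t => biLaplacianTerm φ (u t)))
    (hI3 : ConvergesLocallyUniformly (fun t => electricDensity V (fun k => pderiv k φ) (u t)))
    (hI4 : ConvergesLocallyUniformly (fun t => magneticDensity A (fun k => pderiv k φ) (u t) (G t)))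
    (t : ℝ) :
    HasDerivAt (fun t => 2 * ∑ j, (∫ x, ((pderiv j φ x : ℝ) : ℂ) * (conj (u t x) * G t j x)).im)
      (4 * (∑ j, ∑ k, (∫ x, ((pderiv j (pderiv k φ) x : ℝ) : ℂ) *
          (conj (G t j x) * G t k x)).re) -
        (∫ x, biLaplacianTerm φ (u t) x).re +
        4 * (∫ x, magneticDensity A (fun k => pderiv k φ) (u t) (G t) x).im -
        2 * (∫ x, electricDensity V (fun k => pderiv k φ) (u t) x).re) t := by
  have hs : ∀ k : ℕ, ((k : ℝ) + 1)⁻¹ ≠ 0 := fun k => by positivity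
  have hYc : ∀ (k : ℕ) l, ContDiff ℝ 3 (cutField φ ((k : ℝ) + 1)⁻¹ l) := fun k l =>
    hφ.contDiff_cutField _ l
  have hYs : ∀ (k : ℕ) l, HasCompactSupport (cutField φ ((k : ℝ) + 1)⁻¹ l) := fun k l =>
    IsMultiplier.hasCompactSupport_cutField φ (hs k) l
  set Y : ℕ → Fin n → Rn n →ᵇ ℝ := fun k l =>
    toBddOfCompact _ (hYc k l).continuous (hYs k l) with hY
  set D : ℕ → Rn n →ᵇ ℝ := fun k => toBddOfCompact (cutDiv φ ((k : ℝ) + 1)⁻¹)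
    (hφ.contDiff_cutDiv _).continuous (IsMultiplier.hasCompactSupport_cutDiv φ (hs k)) with hD
  -- The densities are linear in the field, so cutting the field multiplies them by the scalar
  -- cut-off, the situation covered by the uniform tail hypothesis.
  have emag : ∀ (k : ℕ) t, magneticDensity A (fun l => Y k l) (u t) (G t) = fun x =>
      (scaledBump n ((k : ℝ) + 1)⁻¹ x : ℂ) *
        magneticDensity A (fun l => pderiv l φ) (u t) (G t) x := fun k t => by
    ext x
    simp only [magneticDensity, Finset.mul_sum, hY, toBddOfCompact_apply, cutField]
    refine Finset.sum_congr rfl fun j _ => Finset.sum_congr rfl fun l _ => ?_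
    push_cast
    ring
  have eel : ∀ (k : ℕ) t, electricDensity V (fun l => Y k l) (u t) = fun x =>
      (scaledBump n ((k : ℝ) + 1)⁻¹ x : ℂ) *
        electricDensity V (fun l => pderiv l φ) (u t) x := fun k t => by
    ext x
    simp only [electricDensity, hY, toBddOfCompact_apply, cutField, mul_assoc, ← Finset.mul_sum]
    push_cast
    ring
  have hder : ∀ (k : ℕ) t, HasDerivAt
      (fun t => 2 * ∑ l, (∫ x, (Y k l x : ℂ) * (conj (u t x) * G t l x)).im) _ t := fun k t =>
    hF.hasDerivAt_action hn hA hA1 hV hKR (Y := Y k) (D := D k)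
      (fun l => (hYc k l).of_le (by norm_num)) (hYs k)
      (fun l => by
        change cutField φ ((k : ℝ) + 1)⁻¹ l 0 = 0
        rw [cutField, hφ.grad_zero, mul_zero]) (fun x => rfl)
      (by
        rw [emag]
        exact integrable_scaledBump_mul (hI4.1 t) _)
      (by
        rw [eel]
        exact integrable_scaledBump_mul (hI3.1 t) _)
  simp only [emag, eel] at hder
  refine hasDerivAt_of_tendstoUniformlyOn (l := atTop) (s := Set.Ioo (-(|t| + 1)) (|t| + 1))
    (g' := fun t => 4 * (∑ j, ∑ k, (∫ x, ((pderiv j (pderiv k φ) x : ℝ) : ℂ) *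
          (conj (G t j x) * G t k x)).re) -
        (∫ x, biLaplacianTerm φ (u t) x).re +
        4 * (∫ x, magneticDensity A (fun k => pderiv k φ) (u t) (G t) x).im -
        2 * (∫ x, electricDensity V (fun k => pderiv k φ) (u t) x).re)
    isOpen_Ioo ?_ (Eventually.of_forall fun k t' _ => hder k t') (fun t' ht' => ?_)
    ⟨by linarith [neg_abs_le t], by linarith [le_abs_self t]⟩
  · rw [Metric.tendstoUniformlyOn_iff]
    intro ε hε
    -- The five errors enter with coefficients `4, 1, 1, 2, 4`, so twelve twentieths of `ε` are
    -- used.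
    filter_upwards [hF.eventually_hessian_lt hn hA hKR hφ (|t| + 1) (ε := ε / 20) (by positivity),
      hF.eventually_cutDiv_lt hn hA hA1 hKR hφ (ε := ε / 20) (by positivity),
      hI2.eventually_norm_lt (|t| + 1) (ε := ε / 20) (by positivity),
      hI3.eventually_norm_lt (|t| + 1) (ε := ε / 20) (by positivity),
      hI4.eventually_norm_lt (|t| + 1) (ε := ε / 20) (by positivity)] with k k1 k2 k3 k4 k5 t' ht'
    have hT : |t'| ≤ |t| + 1 := abs_le.mpr (Set.Ioo_subset_Icc_self ht')
    have l1 := abs_lt.mp (k1 t' hT)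
    have l2 := abs_lt.mp (k2 t')
    have l3 := abs_lt.mp ((Complex.abs_re_le_norm _).trans_lt (k3 t' hT))
    have l4 := abs_lt.mp ((Complex.abs_re_le_norm _).trans_lt (k4 t' hT))
    have l5 := abs_lt.mp ((Complex.abs_im_le_norm _).trans_lt (k5 t' hT))
    rw [Complex.sub_re] at l3 l4
    rw [Complex.sub_im] at l5
    rw [Real.dist_eq, abs_lt]
    change _ < _ - (4 * (∑ j, ∑ l, (∫ x, ((pderiv j (cutField φ ((k : ℝ) + 1)⁻¹ l) x : ℝ) : ℂ) *
      (conj (G t' j x) * G t' l x)).re) +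
      2 * (∑ j, (∫ x, ((pderiv j (cutDiv φ ((k : ℝ) + 1)⁻¹) x : ℝ) : ℂ) *
        (conj (u t' x) * G t' j x)).re) + _ - _) ∧ _ - (4 * (∑ j, ∑ l,
          (∫ x, ((pderiv j (cutField φ ((k : ℝ) + 1)⁻¹ l) x : ℝ) : ℂ) *
      (conj (G t' j x) * G t' l x)).re) +
      2 * (∑ j, (∫ x, ((pderiv j (cutDiv φ ((k : ℝ) + 1)⁻¹) x : ℝ) : ℂ) *
        (conj (u t' x) * G t' j x)).re) + _ - _) < _
    constructor <;> linarith
  -- Convergence of the actions themselves: the moment bound makes `∇φ · ū ∇_A u` integrable, so it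
  -- dominates its cut-off versions.
  · obtain ⟨M, hM⟩ := hF.exists_weight_moment_le hA hKR hφ h0 (|t| + 1)
    have hi := (hM t' (abs_le.mpr (Set.Ioo_subset_Icc_self ht'))).1
    refine (tendsto_finsetSum _ fun j _ => (Complex.continuous_im.tendsto _).comp ?_).const_mul 2
    have hi2 := hφ.integrable_mul_conj_mul ((hφ.contDiff_grad j).continuous) (L := 1)
      (fun x => by simpa using abs_pderiv_le_sqrt_gradSq φ j x) hi (G t' j)
    have := tendsto_integral_coeff hn hi2 (c := fun k : ℕ => scaledBump n ((k : ℝ) + 1)⁻¹)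
      (d := fun _ => 1) (C := 1) (fun k => (contDiff_scaledBump _).continuous)
      (fun k x => abs_scaledBump_le_one _ x) (fun x _ => tendsto_scaledBump x)
    simp only [Complex.ofReal_one, one_mul] at this
    refine this.congr fun k => ?_
    congr 1 with x
    simp only [hY, toBddOfCompact_apply, cutField]
    push_cast
    ring

end IsFlow

/-- Tail integrals depend only on almost everywhere classes. This transfers the hypotheses from the
radial expressions to the densities, which agree off the origin. -/
theorem ConvergesLocallyUniformly.congr {F F' : ℝ → Rn n → ℂ} (hF : ConvergesLocallyUniformly F)
    (h : ∀ t, F t =ᵐ[volume] F' t) : ConvergesLocallyUniformly F' := by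
  refine ⟨fun t => (hF.1 t).congr (h t), fun T δ hδ => ?_⟩
  obtain ⟨K, hK, h0, hle⟩ := hF.2 T δ hδ
  refine ⟨K, hK, h0, fun t ht => le_of_eq_of_le (integral_congr_ae ?_) (hle t ht)⟩
  filter_upwards [ae_restrict_of_ae (h t)] with x hx
  rw [hx]

end SecondDerivative

/-! ### Conclusion: the virial identity for radial multipliers. -/

theorem theorem1p2 (n : ℕ) (hn : 2 ≤ n)
    -- the potentials: classically differentiable away from the origin
    (A : Rn n → Rn n) (hA : ContDiffOn ℝ 1 A {0}ᶜ)
    (hA2 : LocallyIntegrable (fun x => ‖A x‖ ^ 2) volume)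
    (V : Rn n → ℝ) (hV : ContDiffOn ℝ 1 V {0}ᶜ)
    (hKR : IsKatoRellich A V)
    -- the radial multiplier
    (φ : Rn n → ℝ) (φ₀ : ℝ → ℝ) (hrad : ∀ x, φ x = φ₀ ‖x‖)
    (hφ : ContDiff ℝ 4 φ) (hD2 : ∃ C : ℝ, ∀ x j k, |hessian φ x j k| ≤ C)
    -- the initial datum and the solution, with its magnetic gradient
    (f : L2 n) (hf : ∃ g : L2 n, IsMagneticLaplacian A f g)
    (hf0 : Integrable (fun x => φ x * ‖f x‖ ^ 2))
    (hf1 : Integrable (fun x => (deriv φ₀ ‖x‖) ^ 2 * ‖f x‖ ^ 2))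
    (u : ℝ → L2 n) (hu : IsSchrodingerSolution A V f u)
    (G : ℝ → Fin n → L2 n) (hG : ∀ t, HasMagneticGradient A (u t) (G t))
    -- the integrals over potentials and bi-Laplacian make sense
    (hI2 : ConvergesLocallyUniformly (fun t => biLaplacianTerm φ (u t)))
    (hI3 : ConvergesLocallyUniformly (fun t => electricTerm φ₀ V (u t)))
    (hI4 : ConvergesLocallyUniformly (fun t => magneticTerm φ₀ A (u t) (G t))) :
    (∀ t, Integrable (fun x => φ x * ‖u t x‖ ^ 2)) ∧
    (∀ t, Integrable (hessianTerm φ (G t))) ∧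
    Differentiable ℝ (thetaS φ u) ∧
    Differentiable ℝ (deriv (thetaS φ u)) ∧
    ∀ t : ℝ, ((deriv (deriv (thetaS φ u)) t : ℝ) : ℂ) =
      4 * (∫ x, hessianTerm φ (G t) x)
      - (∫ x, biLaplacianTerm φ (u t) x)
      - 2 * (∫ x, electricTerm φ₀ V (u t) x)
      + 4 * (((∫ x, magneticTerm φ₀ A (u t) (G t) x).im : ℝ) : ℂ) := by
  have hn0 : n ≠ 0 := by omega
  have : Nonempty (Fin n) := ⟨⟨0, by omega⟩⟩
  obtain ⟨C, hC⟩ := hD2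
  have hmul : IsMultiplier φ (n * C) := .of_radial hn0 hrad hφ hC
  have hA' : LocallySquareIntegrable A := locallySquareIntegrable_of_contDiffOn hn0 hA hA2
  have hd : Differentiable ℝ φ := hφ.differentiable (by norm_num)
  have hne : ∀ᵐ x : Rn n, x ≠ 0 := by
    rw [ae_iff]
    simp
  obtain ⟨g, v, hF⟩ := hu.exists_isFlow hG
  have h0 : Integrable fun x => gradSq φ x * ‖u 0 x‖ ^ 2 := by
    rw [hu.initial]
    refine hf1.congr ?_
    filter_upwards [hne] with x hx
    rw [gradSq, sum_sq_pderiv_radial hrad hx (hd x)]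
  have hφ0 : Integrable fun x => φ x * ‖u 0 x‖ ^ 2 := by
    rw [hu.initial]
    exact hf0
  have e3 : ∀ t, electricTerm φ₀ V (u t) =ᵐ[volume]
      electricDensity V (fun k => pderiv k φ) (u t) := fun t => by
    filter_upwards [hne] with x hx
    exact electricTerm_eq hrad hd V (u t) hx
  have e4 : ∀ t, magneticTerm φ₀ A (u t) (G t) =ᵐ[volume]
      magneticDensity A (fun k => pderiv k φ) (u t) (G t) := fun t => by
    filter_upwards [hne] with x hx
    exact magneticTerm_eq hrad hd A (u t) (G t) hx
  have hd1 := hF.hasDerivAt_thetaS hn0 hA' hKR hmul h0 hφ0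
  have hd2 := hF.hasDerivAt_gradAction hn0 hA' hA hV hKR hmul h0 hI2 (hI3.congr e3) (hI4.congr e4)
  have hderiv : deriv (thetaS φ u) = _ := funext fun t => (hd1 t).deriv
  refine ⟨hF.integrable_multiplier hA' hKR hmul h0 hφ0, fun t => hmul.integrable_hessianTerm (G t),
    fun t => (hd1 t).differentiableAt, ?_, fun t => ?_⟩
  · rw [hderiv]
    exact fun t => (hd2 t).differentiableAt
  -- The bi-Laplacian and electric integrands are real-valued, so taking real parts in the computed
  -- derivative loses nothing.
  · have hbi : ∫ x, biLaplacianTerm φ (u t) x =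
        (((∫ x, biLaplacianTerm φ (u t) x).re : ℝ) : ℂ) := by
      simp only [biLaplacianTerm, integral_complex_ofReal, Complex.ofReal_re]
    have hel : ∫ x, electricTerm φ₀ V (u t) x =
        (((∫ x, electricTerm φ₀ V (u t) x).re : ℝ) : ℂ) := by
      simp only [electricTerm, integral_complex_ofReal, Complex.ofReal_re]
    rw [hderiv, (hd2 t).deriv, ← integral_congr_ae (e3 t), ← integral_congr_ae (e4 t),
      hmul.integral_hessianTerm, hbi, hel]
    push_cast
    simp only [Complex.ofReal_re]
    ring
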